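/- Theorem 3. Let $n,p\ge 1$ be integers and let $\mathbb X\subseteq\mathbb R^p$ be closed and convex with $r\,\mathbb B\subseteq\mathbb X\subseteq R\,\mathbb B$ for some $r>0$ and $R$, where $\mathbb B$ is the closed Euclidean unit ball. For agents $i\in\{1,\dots,n\}$ and iterations $t=1,2,\dots$ let $f_{i,t}:\mathbb X\to\mathbb R$ and $g_{i,t}:\mathbb X\to\mathbb R^{m_i}$ be (deterministic) functions, $f_{i,t}$ and each component of $g_{i,t}$ being convex, such that $|f_{i,t}|\le F$ on $\mathbb X$ and such that at every $x\in\mathbb X$ there are a subgradient of $f_{i,t}$ of norm at most $G_1$ and a subgradient (matrix) of $g_{i,t}$ of operator norm at most $G_2$. Put $f_t=\frac1n\sum_j f_{j,t}$, $g_t=\mathrm{col}(g_{1,t},\dots,g_{n,t})$, and assume that $\mathcal X_T=\{x\in\mathbb X: g_t(x)\le 0,\ t=1,\dots,T\}$ is nonempty for every $T\ge1$. Let $\mathcal G_t$ be directed graphs on the agents and $W_t$ doubly stochastic $n\times n$ matrices such that for some $w\in(0,1)$ one has $[W_t]_{ij}\ge w$ if $(j,i)$ is an edge of $\mathcal G_t$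 or $i=j$, and $[W_t]_{ij}=0$ otherwise, and such that for some integer $B\ge1$ the union of $\mathcal G_t,\dots,\mathcal G_{t+B-1}$ is strongly connected for every $t\ge 1$. Finally, suppose that for some $\mu>0$ all $f_{i,t}$ are $\mu$-strongly convex on $\mathbb X$: $f_{i,t}(x)\ge f_{i,t}(y)+\langle x-y,s\rangle+\frac\mu2\|x-y\|^2$ for all $x,y\in\mathbb X$ and all subgradients $s$ of $f_{i,t}$ at $y$. Let $c\in(0,1)$ and $\gamma_0>0$ with $4(p^2+1)G_2^2\,\gamma_0\le 1$, and for $t\ge1$ let $$\alpha_t=t^{-c},\qquad \gamma_t=\gamma_0/\alpha_t,\qquad \xi_t=\alpha_t,\qquad \delta_t=r\,\alpha_t .$$ Starting from $z_{i,1}\in(1-\xi_1)\mathbb X$, the algorithm (which does not use $\mu$) generates, for $t=1,2,\dots$, $$x_{i,t}=\sum_{j=1}^n[W_t]_{ij}z_{j,t},\qquad q_{i,t+1}=\gamma_t[g_{i,t}(x_{i,t})]_+,$$ $$\hat\omega_{i,t+1}=\tfrac p{\delta_t}\big(f_{i,t}(x_{i,t}+\delta_tu_{i,t})-f_{i,t}(x_{i,t})\big)u_{i,t}+\Big(\tfrac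 p{\delta_t}\,u_{i,t}\big(g_{i,t}(x_{i,t}+\delta_tu_{i,t})-g_{i,t}(x_{i,t})\big)^{\!\top}\Big)q_{i,t+1},$$ $$z_{i,t+1}=\mathcal P_{(1-\xi_{t+1})\mathbb X}\big(x_{i,t}-\alpha_t\hat\omega_{i,t+1}\big),$$ where the $u_{i,t}$ are independent and uniformly distributed on the unit sphere of $\mathbb R^p$, $\mathcal P_K$ is the Euclidean projection onto $K$ and $[\cdot]_+$ is the componentwise positive part. Let $$\mathrm{Reg}(T)=\frac1n\sum_{i=1}^n\Big(\sum_{t=1}^Tf_t(x_{i,t})-\min_{x\in\mathcal X_T}\sum_{t=1}^Tf_t(x)\Big),\qquad \mathrm{CCV}(T)=\frac1n\sum_{i=1}^n\sum_{t=1}^T\big\|[g_t(x_{i,t})]_+\big\| .$$ Then $\mathrm{Reg}(T)$ and $\mathrm{CCV}(T)$ are integrable, and there is a constant $C$ that depends only on $n,p,c,\gamma_0,r,R,F,G_1,G_2,w,B,\mu$ such that for all $T\ge1$ $$\mathbf E[\mathrm{Reg}(T)]\le C\,T^{1-c},\qquad \mathbf E[\mathrm{CCV}(T)]\le C\,T^{1-c/2}.$$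 If, moreover, Slater's condition holds, that is, there are $x_s\in\mathbb X$ and $\varsigma_s>0$ with $g_t(x_s)\le-\varsigma_s\mathbf 1$ (componentwise) for all $t\ge1$, then there is a constant $C'$ that depends only on the same quantities and $\varsigma_s$ such that $\mathbf E[\mathrm{CCV}(T)]\le C'\,T^{1-c}$ for all $T\ge1$. -/

import Mathlib

open MeasureTheory ProbabilityTheory Set
open scoped Pointwise

namespace BanditOCO

/-- `ℝᵖ` with the Euclidean norm. -/
abbrev Vec (p : ℕ) : Type := EuclideanSpace ℝ (Fin p)

/-- `y` is a point of `K` of minimal Euclidean distance to `x`. -/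
def IsNearest {p : ℕ} (K : Set (Vec p)) (x y : Vec p) : Prop :=
  y ∈ K ∧ ∀ w ∈ K, ‖x - y‖ ≤ ‖x - w‖

/-- The projection `P_K(x) = argmin_{y ∈ K} ‖x - y‖²` (it is only used for closed convex
nonempty `K`, where a nearest point exists and is unique). -/
noncomputable def proj {p : ℕ} (K : Set (Vec p)) (x : Vec p) : Vec p :=
  Classical.epsilon (IsNearest K x)

theorem proj_isNearest {p : ℕ} {K : Set (Vec p)} (hne : K.Nonempty) (hcl : IsClosed K)
    (x : Vec p) : IsNearest K x (proj K x) := by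
  apply Classical.epsilon_spec (p := IsNearest K x)
  obtain ⟨y, hy, hd⟩ := hcl.exists_infDist_eq_dist hne x
  refine ⟨y, hy, fun w hw => ?_⟩
  rw [← dist_eq_norm, ← dist_eq_norm, ← hd]
  exact Metric.infDist_le_dist_of_mem hw

/-- The clipping `[v]₊`, the projection of `v` onto the nonnegative orthant, that is, the
componentwise positive part. -/
noncomputable def clip {ι : Type} [Fintype ι] (v : EuclideanSpace ℝ ι) : EuclideanSpace ℝ ι :=
  WithLp.toLp 2 fun k => max (v k) 0

/-- The uniform probability distribution on the Euclidean unit sphere of `ℝᵖ`: the normalized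
surface measure. -/
noncomputable def sphereUniform (p : ℕ) : Measure (Metric.sphere (0 : Vec p) 1) :=
  ((volume : Measure (Vec p)).toSphere univ)⁻¹ • (volume : Measure (Vec p)).toSphere

/-- The data of a distributed online problem with `n` agents and decisions in `ℝᵖ`. Iterations
are `t = 1, 2, …`; values at the time index `0`, and of the functions outside of `X`, are never
used. -/
structure Problem (n p : ℕ) where
  /-- the set of admissible decisions -/
  X : Set (Vec p)
  /-- the number of constraints of each agent -/
  m : Fin n → ℕ
  /-- the loss `f i t` of agent `i` at iteration `t` -/
  f : Fin n → ℕ → Vec p → ℝ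
  /-- the constraint function `g i t` of agent `i` at iteration `t` -/
  g : (i : Fin n) → ℕ → Vec p → EuclideanSpace ℝ (Fin (m i))
  /-- the communication graph at iteration `t`: `(graph t).Adj j i` if agent `i` can receive
  information from agent `j` -/
  graph : ℕ → Digraph (Fin n)
  /-- the mixing matrix at iteration `t` -/
  W : ℕ → Matrix (Fin n) (Fin n) ℝ

namespace Problem

variable {n p : ℕ} (Q : Problem n p)

/-- The global loss `f_t = (1/n) ∑ⱼ f_{j,t}`. -/
noncomputable def globalLoss (t : ℕ) (x : Vec p) : ℝ :=
  (1 / (n : ℝ)) * ∑ j, Q.f j t x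

/-- The global constraint function `g_t = col(g_{1,t}, …, g_{n,t})`. -/
noncomputable def globalConstraint (t : ℕ) (x : Vec p) :
    EuclideanSpace ℝ ((i : Fin n) × Fin (Q.m i)) :=
  WithLp.toLp 2 fun k => Q.g k.1 t x k.2

/-- The set of `x ∈ X` with `g_t(x) ≤ 0` for all `t = 1, …, T`. -/
def feasible (T : ℕ) : Set (Vec p) :=
  {x | x ∈ Q.X ∧ ∀ t ∈ Finset.Icc 1 T, ∀ k, Q.globalConstraint t x k ≤ 0}

end Problem

/-- `s` is a subgradient at `x ∈ X` of the function `h` on `X`. -/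
def IsSubgradient {p : ℕ} (X : Set (Vec p)) (h : Vec p → ℝ) (x s : Vec p) : Prop :=
  ∀ y ∈ X, h x + inner ℝ s (y - x) ≤ h y

/-- `D` is a subgradient (a matrix, as a linear map) at `x ∈ X` of the vector-valued function `h`
on `X`: each of its rows is a subgradient of the respective component of `h`. -/
def IsVecSubgradient {p m : ℕ} (X : Set (Vec p)) (h : Vec p → EuclideanSpace ℝ (Fin m))
    (x : Vec p) (D : Vec p →L[ℝ] EuclideanSpace ℝ (Fin m)) : Prop :=
  ∀ y ∈ X, ∀ k, h x k + D (y - x) k ≤ h y k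

/-- `X` is closed and convex, contains the ball of radius `r > 0` and lies in the ball of
radius `R`. -/
structure DomainAssumption {p : ℕ} (X : Set (Vec p)) (r R : ℝ) : Prop where
  closed : IsClosed X
  convex : Convex ℝ X
  r_pos : 0 < r
  ball_subset : Metric.closedBall 0 r ⊆ X
  subset_ball : X ⊆ Metric.closedBall 0 R

/-- The losses are convex and bounded by `F` on `X`, the constraint functions are convex on `X`,
and they have subgradients bounded by `G₁` and `G₂` at all points of `X`. -/
structure FunctionAssumption {n p : ℕ} (Q : Problem n p) (F G₁ G₂ : ℝ) : Prop where
  loss_bound : ∀ i, ∀ t, 1 ≤ t → ∀ x ∈ Q.X, |Q.f i t x| ≤ F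
  loss_convex : ∀ i, ∀ t, 1 ≤ t → ConvexOn ℝ Q.X (Q.f i t)
  constraint_convex : ∀ i, ∀ t, 1 ≤ t → ∀ k, ConvexOn ℝ Q.X fun x => Q.g i t x k
  loss_subgradient : ∀ i, ∀ t, 1 ≤ t → ∀ x ∈ Q.X,
    ∃ s, IsSubgradient Q.X (Q.f i t) x s ∧ ‖s‖ ≤ G₁
  constraint_subgradient : ∀ i, ∀ t, 1 ≤ t → ∀ x ∈ Q.X,
    ∃ D, IsVecSubgradient Q.X (Q.g i t) x D ∧ ‖D‖ ≤ G₂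

/-- The assumption on the communication: the weights are at least `w` along the edges and on the
diagonal and zero elsewhere, the mixing matrices are doubly stochastic, and the union of the graphs
over any `B` consecutive iterations is strongly connected. -/
structure NetworkAssumption {n p : ℕ} (Q : Problem n p) (w : ℝ) (B : ℕ) : Prop where
  w_pos : 0 < w
  w_lt_one : w < 1
  weight_ge : ∀ t, 1 ≤ t → ∀ i j, ((Q.graph t).Adj j i ∨ i = j) → w ≤ Q.W t i j
  weight_zero : ∀ t, 1 ≤ t → ∀ i j, ¬ ((Q.graph t).Adj j i ∨ i = j) → Q.W t i j = 0
  row_sum : ∀ t, 1 ≤ t → ∀ i, ∑ j, Q.W t i j = 1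
  col_sum : ∀ t, 1 ≤ t → ∀ j, ∑ i, Q.W t i j = 1
  B_pos : 0 < B
  connected : ∀ t, 1 ≤ t → ∀ a b : Fin n,
    Relation.ReflTransGen (fun j i => ∃ l < B, (Q.graph (t + l)).Adj j i) a b

/-- The losses are strongly convex with parameter `μ` on `X`. -/
def StronglyConvexLosses {n p : ℕ} (Q : Problem n p) (μ : ℝ) : Prop :=
  ∀ i, ∀ t, 1 ≤ t → ∀ x ∈ Q.X, ∀ y ∈ Q.X, ∀ s, IsSubgradient Q.X (Q.f i t) y s →
    Q.f i t y + inner ℝ (x - y) s + μ / 2 * ‖x - y‖ ^ 2 ≤ Q.f i t x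

/-- Slater's condition with margin `σ`: some point of `X` satisfies `g_t ≤ -σ` at all
iterations. -/
def Slater {n p : ℕ} (Q : Problem n p) (σ : ℝ) : Prop :=
  ∃ xs ∈ Q.X, ∀ t, 1 ≤ t → ∀ k, Q.globalConstraint t xs k ≤ -σ

/-- The parameter sequences of the algorithm. -/
structure Params where
  /-- step sizes -/
  α : ℕ → ℝ
  /-- regularization parameters -/
  γ : ℕ → ℝ
  /-- shrinkage coefficients -/
  ξ : ℕ → ℝ
  /-- exploration parameters -/
  δ : ℕ → ℝ

/-- `α_t = 1 / t^c`, `γ_t = γ₀ / α_t`, `ξ_t = α_t`, `δ_t = r α_t`. -/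
noncomputable def powerParams (c γ₀ r : ℝ) : Params where
  α t := 1 / (t : ℝ) ^ c
  γ t := γ₀ / (1 / (t : ℝ) ^ c)
  ξ t := 1 / (t : ℝ) ^ c
  δ t := r * (1 / (t : ℝ) ^ c)

section Algorithm

variable {n p : ℕ}

/-- The two-point estimator `(p/δ) (h(x + δu) - h(x)) u` of the subgradient of `h` at `x`. -/
noncomputable def gradEst (h : Vec p → ℝ) (δ : ℝ) (x u : Vec p) : Vec p :=
  ((p : ℝ) / δ * (h (x + δ • u) - h x)) • u

/-- The two-point estimator `(p/δ) (h(x + δu) - h(x))ᵀ ⊗ u`, a `p × m` matrix, of the subgradient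
of the vector-valued function `h` at `x`. -/
noncomputable def vecGradEst {m : ℕ} (h : Vec p → EuclideanSpace ℝ (Fin m)) (δ : ℝ) (x u : Vec p) :
    Matrix (Fin p) (Fin m) ℝ :=
  ((p : ℝ) / δ) • Matrix.vecMulVec (fun a => u a) (fun k => (h (x + δ • u) - h x) k)

/-- The consensus step: `x_{i,t} = ∑ⱼ [W_t]ᵢⱼ z_{j,t}`, from `z = z_{·,t}`. -/
noncomputable def consensus (Q : Problem n p) (t : ℕ) (z : Fin n → Vec p) (i : Fin n) : Vec p :=
  ∑ j, Q.W t i j • z j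

/-- The dual variable `q_{i,t+1} = γ_t [g_{i,t}(x_{i,t})]₊`, from `x = x_{i,t}`. -/
noncomputable def dual (Q : Problem n p) (s : Params) (t : ℕ) (i : Fin n) (x : Vec p) :
    EuclideanSpace ℝ (Fin (Q.m i)) :=
  s.γ t • clip (Q.g i t x)

/-- The update direction `ω_{i,t+1}`, the estimator for the loss plus the estimator for the
constraint function applied to `q_{i,t+1}`, from `x = x_{i,t}` and `u = u_{i,t}`. -/
noncomputable def direction (Q : Problem n p) (s : Params) (t : ℕ) (i : Fin n) (x u : Vec p) :
    Vec p :=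
  gradEst (Q.f i t) (s.δ t) x u +
    WithLp.toLp 2 (Matrix.mulVec (vecGradEst (Q.g i t) (s.δ t) x u) fun k => dual Q s t i x k)

/-- The primal update: `z_{i,t+1}`, the projection of `x_{i,t} - α_t ω_{i,t+1}` onto
`(1 - ξ_{t+1}) X`, from `x = x_{i,t}` and `u = u_{i,t}`. -/
noncomputable def primal (Q : Problem n p) (s : Params) (t : ℕ) (i : Fin n) (x u : Vec p) :
    Vec p :=
  proj ((1 - s.ξ (t + 1)) • Q.X) (x - s.α t • direction Q s t i x u)

/-- The sequence `z_{i,t}`, `t ≥ 1`, with initial values `z₁` and sampled directions `u i t`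
(the value at `t = 0` is not used). -/
noncomputable def zSeq (Q : Problem n p) (s : Params) (z₁ : Fin n → Vec p)
    (u : Fin n → ℕ → Metric.sphere (0 : Vec p) 1) : ℕ → Fin n → Vec p
  | 0 => z₁
  | 1 => z₁
  | t + 2 => fun i =>
      primal Q s (t + 1) i (consensus Q (t + 1) (zSeq Q s z₁ u (t + 1)) i) (u i (t + 1))

/-- The decisions `x_{i,t}`, `t ≥ 1`, generated by the algorithm. -/
noncomputable def xSeq (Q : Problem n p) (s : Params) (z₁ : Fin n → Vec p)
    (u : Fin n → ℕ → Metric.sphere (0 : Vec p) 1) (t : ℕ) (i : Fin n) : Vec p :=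
  consensus Q t (zSeq Q s z₁ u t) i

/-- The network regret of the decisions `x t i` up to the horizon `T`. -/
noncomputable def netReg (Q : Problem n p) (T : ℕ) (x : ℕ → Fin n → Vec p) : ℝ :=
  (1 / (n : ℝ)) * ∑ i, (∑ t ∈ Finset.Icc 1 T, Q.globalLoss t (x t i) -
    sInf ((fun y => ∑ t ∈ Finset.Icc 1 T, Q.globalLoss t y) '' Q.feasible T))

/-- The network cumulative constraint violation of the decisions `x t i` up to the horizon `T`. -/
noncomputable def netCCV (Q : Problem n p) (T : ℕ) (x : ℕ → Fin n → Vec p) : ℝ :=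
  (1 / (n : ℝ)) * ∑ i, ∑ t ∈ Finset.Icc 1 T, ‖clip (Q.globalConstraint t (x t i))‖

/-- The random directions `u_{i,t}`, `t ≥ 1`, are independent over agents and iterations and
uniformly distributed on the unit sphere. -/
structure UniformSampling {Ω : Type*} [MeasurableSpace Ω] (P : Measure Ω)
    (u : Fin n → ℕ → Ω → Metric.sphere (0 : Vec p) 1) : Prop where
  measurable : ∀ i, ∀ t, 1 ≤ t → Measurable (u i t)
  law : ∀ i, ∀ t, 1 ≤ t → P.map (u i t) = sphereUniform p
  indep : iIndepFun (fun k : Fin n × ℕ => u k.1 (k.2 + 1)) P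

end Algorithm

/-- All assumptions of the problem with strongly convex losses, without Slater's condition. The
feasible sets are nonempty. -/
structure StandingAssumptions {n p : ℕ} (Q : Problem n p) (r R F G₁ G₂ w : ℝ) (B : ℕ) (μ : ℝ) :
    Prop where
  domain : DomainAssumption Q.X r R
  functions : FunctionAssumption Q F G₁ G₂
  network : NetworkAssumption Q w B
  feasible_nonempty : ∀ T, 1 ≤ T → (Q.feasible T).Nonempty
  strong : StronglyConvexLosses Q μ

end BanditOCO

open BanditOCO

/-! The proof is a one-step inequality for the expected squared distance of the agents to a fixed
comparison point `y` of the domain, summed over time in two ways.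

Two-point estimator. By Stokes' theorem on the unit ball, the mean over the sphere of the estimator
of a convex function, paired with `x - y`, is an average of directional derivatives near `x`.
Convexity bounds these by differences of values, so in expectation the estimator is a subgradient up
to an error of order `δ` (`le_integral_gradEst`). Subtracting a quadratic extends this to strongly
convex functions (`le_integral_gradEst_of_strong`). With the dual variable held fixed, the direction
is the sum of two scalar estimators, for the loss and for `⟨q, g⟩` (`direction_eq`).

One step. As `α_t γ_t = γ₀`, the penalty contributes `-2 γ₀ ‖[g(x)]₊‖²` to the expected squared
distance. The condition on `γ₀` keeps the squared penalty step below a quarter of this gain, and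
Young's inequality does the same for the estimator error. Averaging over the agents with doubly
stochastic weights does not increase the sum of squared distances. Write `V` for the sum over the
agents of the expected squared distances of the `z_{i,t}` to `y`, `Φ` for that of the expected loss
differences, and `S₁`, `S₂` for the sums of the expected violations and their squares, each agent
being charged with its own constraints. If the constraints at `y` are at most `-ρ`, then `V_{t+1} +
2 α Φ + γ₀ S₂ + 2 γ₀ ρ S₁ ≤ (1 - α μ) V_t + K α²` (`sum_integral_norm_zSeq_succ_sub_sq_le`).

Violations. Summing directly, with `Φ` bounded below, gives `∑ S₂ = O(T^{1-c})` for a feasible `y`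
(`ρ = 0`) and `∑ S₁ = O(T^{1-c})` for a Slater point. Without Slater's condition, Young's inequality
gives `∑ S₁ = O(T^{1-c/2})`.

Regret. Dividing by `2 α_t` first, the telescoping leaves the coefficient `t^c - (t-1)^c - μ` at
`V_t`, which is nonpositive except for finitely many `t` depending only on `c` and `μ`. The term `γ₀
S₂ / (2 α_t)` is kept on the left.

Disagreement. Connectivity makes the mixing contract the spread of the agents over `n B` iterations,
so the total spread is at most a constant times `1 + ∑ α + ∑ S₁`. In the constraint violation this
costs no more than `∑ S₁` itself. In the regret, `κ S₁` is split by Young's inequality with weight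
proportional to `α_t`: one half is `O(α_t)`, the other is cancelled by the retained `S₂` term. So
the regret has the rate `T^{1-c}` although `∑ S₁` may not. -/

/-! ### A Lipschitz cutoff of the unit ball -/

section BallCutoff

open Metric Filter Topology
open scoped NNReal

variable {E : Type*} [NormedAddCommGroup E]

/-- A radial cutoff of the unit ball, which approximates its indicator function for large `N`. -/
noncomputable def ballCutoff (N : ℕ) (v : E) : ℝ := 1 - (min ‖v‖ 1) ^ (2 * N)

theorem ballCutoff_eq_zero {N : ℕ} {v : E} (hv : 1 ≤ ‖v‖) : ballCutoff N v = 0 := by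
  simp [ballCutoff, hv]

theorem ballCutoff_nonneg (N : ℕ) (v : E) : 0 ≤ ballCutoff N v := by
  have : (min ‖v‖ 1) ^ (2 * N) ≤ 1 := pow_le_one₀ (by positivity) (min_le_right _ _)
  simp only [ballCutoff]; linarith

theorem lipschitzWith_ballCutoff (N : ℕ) :
    LipschitzWith (2 * N : ℕ) (ballCutoff N : E → ℝ) := by
  refine LipschitzWith.of_dist_le_mul fun x y => ?_
  have hn : LipschitzWith 1 (fun v : E => min ‖v‖ 1) := by
    simpa using lipschitzWith_one_norm.min_const (1 : ℝ)
  have h1 := hn.dist_le_mul x y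
  rw [Real.dist_eq] at h1 ⊢
  have h2 := abs_pow_sub_pow_le (min ‖x‖ 1) (min ‖y‖ 1) (2 * N)
  have h3 : (max |min ‖x‖ 1| |min ‖y‖ 1|) ^ (2 * N - 1) ≤ 1 := by
    refine pow_le_one₀ (by positivity) (max_le ?_ ?_) <;>
    · rw [abs_of_nonneg (by positivity)]; exact min_le_right _ _
  have h4 : |ballCutoff N x - ballCutoff N y| =
      |(min ‖x‖ 1) ^ (2 * N) - (min ‖y‖ 1) ^ (2 * N)| := by
    rw [← abs_neg]; simp only [ballCutoff]; congr 1; ring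
  rw [h4]
  refine h2.trans ?_
  simp only [NNReal.coe_one, one_mul] at h1
  calc |min ‖x‖ 1 - min ‖y‖ 1| * ((2 * N : ℕ) : ℝ) *
        (max |min ‖x‖ 1| |min ‖y‖ 1|) ^ (2 * N - 1)
      ≤ dist x y * ((2 * N : ℕ) : ℝ) * 1 := by gcongr
    _ = _ := by simp; ring

theorem hasCompactSupport_ballCutoff [NormedSpace ℝ E] [FiniteDimensional ℝ E] (N : ℕ) : HasCompactSupport (ballCutoff N : E → ℝ) := by
  refine HasCompactSupport.intro (isCompact_closedBall (0 : E) 1) fun v hv => ?_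
  simp only [mem_closedBall, dist_zero_right, not_le] at hv
  exact ballCutoff_eq_zero hv.le

end BallCutoff

/-! ### Derivative of the cutoff and polar coordinates -/

section Sphere

open Metric Filter Topology
open scoped NNReal

theorem lineDeriv_ballCutoff {E : Type*} [NormedAddCommGroup E] [InnerProductSpace ℝ E] {N : ℕ} {v : E} (hv : ‖v‖ ≠ 1) (b : E) :
    lineDeriv ℝ (ballCutoff N) v b =
      (ball (0 : E) 1).indicator
        (fun v => -(2 * N * ‖v‖ ^ (2 * (N - 1)) * inner ℝ v b)) v := by
  apply HasLineDerivAt.lineDeriv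
  rcases lt_or_gt_of_ne hv with h | h
  · rw [indicator_of_mem (by simpa using h)]
    -- The even exponent makes the cutoff a polynomial in `‖v‖ ^ 2` inside the ball, so it is
    -- differentiable at the origin too.
    have h1 : HasFDerivAt (fun v : E => 1 - (‖v‖ ^ 2) ^ N)
        (-((N * (‖v‖ ^ 2) ^ (N - 1)) • (2 • innerSL ℝ v))) v :=
      ((hasStrictFDerivAt_norm_sq v).hasFDerivAt.pow N |>.const_sub 1).congr_fderiv (by simp)
    have h2 : HasFDerivAt (ballCutoff N : E → ℝ)
        (-((N * (‖v‖ ^ 2) ^ (N - 1)) • (2 • innerSL ℝ v))) v := by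
      refine h1.congr_of_eventuallyEq ?_
      filter_upwards [isOpen_ball.mem_nhds (show v ∈ ball (0 : E) 1 by simpa using h)] with x hx
      have : ‖x‖ ≤ 1 := by simpa using (mem_ball_zero_iff.1 hx).le
      simp [ballCutoff, this, pow_mul]
    have h3 := h2.hasLineDerivAt b
    convert! h3 using 1
    simp [pow_mul]; ring
  · rw [indicator_of_notMem (by simpa using h.le)]
    have h2 : HasFDerivAt (ballCutoff N : E → ℝ) (0 : E →L[ℝ] ℝ) v := by
      refine (hasFDerivAt_const (0 : ℝ) v).congr_of_eventuallyEq ?_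
      filter_upwards [continuous_norm.continuousAt.eventually (lt_mem_nhds h)] with x hx
      exact ballCutoff_eq_zero hx.le
    simpa using h2.hasLineDerivAt b

variable {E : Type*} [NormedAddCommGroup E] [InnerProductSpace ℝ E] [FiniteDimensional ℝ E]
  [MeasurableSpace E] [BorelSpace E] [Nontrivial E] (μ : Measure E) [μ.IsAddHaarMeasure]

/-- Polar coordinates for a product of an angular and a radial function. -/
theorem integral_angular_mul_radial (F : E → ℝ) (ψ : ℝ → ℝ) :
    ∫ v, F (‖v‖⁻¹ • v) * ψ ‖v‖ ∂μ =
      (∫ u : sphere (0 : E) 1, F u ∂μ.toSphere) *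
        ∫ y in Ioi (0 : ℝ), y ^ (Module.finrank ℝ E - 1) * ψ y := by
  calc
    ∫ v, F (‖v‖⁻¹ • v) * ψ ‖v‖ ∂μ
        = ∫ x : ({(0)}ᶜ : Set E), F (‖x.1‖⁻¹ • x.1) * ψ ‖x.1‖ ∂(μ.comap (↑)) := by
      rw [integral_subtype_comap (measurableSet_singleton _).compl
        fun x ↦ F (‖x‖⁻¹ • x) * ψ ‖x‖, restrict_compl_singleton]
    _ = ∫ x, F x.1 * ψ x.2 ∂μ.toSphere.prod (.volumeIoiPow (Module.finrank ℝ E - 1)) := by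
      simpa using μ.measurePreserving_homeomorphUnitSphereProd.integral_comp
        (Homeomorph.measurableEmbedding _) (fun x => F x.1 * ψ x.2)
    _ = (∫ u : sphere (0 : E) 1, F u ∂μ.toSphere) *
          ∫ x : Ioi (0 : ℝ), ψ x ∂.volumeIoiPow (Module.finrank ℝ E - 1) :=
      integral_prod_mul (fun u : sphere (0 : E) 1 => F u) (fun x : Ioi (0 : ℝ) => ψ x)
    _ = _ := by
      simp only [Measure.volumeIoiPow, ENNReal.ofReal]
      rw [integral_withDensity_eq_integral_smul,
        integral_subtype_comap measurableSet_Ioi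
          fun a ↦ Real.toNNReal (a ^ (Module.finrank ℝ E - 1)) • ψ a,
        setIntegral_congr_fun measurableSet_Ioi fun x hx ↦ ?_]
      · rw [NNReal.smul_def, Real.coe_toNNReal _ (pow_nonneg hx.out.le _), smul_eq_mul]
      · exact (measurable_subtype_coe.pow_const _).real_toNNReal

theorem integral_Ioi_mul_indicator (d : ℕ) (ψ : ℝ → ℝ) :
    ∫ y in Ioi (0 : ℝ), y ^ d * (Iio (1 : ℝ)).indicator ψ y = ∫ y in (0 : ℝ)..1, y ^ d * ψ y := by
  have h : (fun y : ℝ => y ^ d * (Iio (1 : ℝ)).indicator ψ y) =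
      (Iio (1 : ℝ)).indicator (fun y => y ^ d * ψ y) := by
    ext y; by_cases hy : y ∈ Iio (1 : ℝ) <;> simp [hy]
  rw [h, setIntegral_indicator measurableSet_Iio, Ioi_inter_Iio,
    intervalIntegral.integral_of_le zero_le_one, integral_Ioc_eq_integral_Ioo]

end Sphere

/-! ### Stokes' inequality for convex functions on the ball -/

section Sphere2
open Metric Filter Topology
open scoped NNReal

/-- Difference quotients of a convex function increase with the step; compare the limit at `0` with
the step `1`. -/
theorem ConvexOn.lineDeriv_le {E : Type*} [NormedAddCommGroup E] [NormedSpace ℝ E] {k : E → ℝ} (hk : ConvexOn ℝ univ k) {v b : E}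
    (h : LineDifferentiableAt ℝ k v b) : lineDeriv ℝ k v b ≤ k (v + b) - k v := by
  refine le_of_tendsto h.hasLineDerivAt.tendsto_slope_zero_right ?_
  filter_upwards [Ioc_mem_nhdsGT zero_lt_one] with t ht
  have h1 := hk.2 (mem_univ v) (mem_univ (v + b)) (sub_nonneg.2 ht.2) ht.1.le (by ring)
  have h2 : (1 - t) • v + t • (v + b) = v + t • b := by module
  rw [h2] at h1
  simp only [smul_eq_mul] at h1 ⊢
  rw [inv_mul_le_iff₀ ht.1]
  linarith

variable {E : Type*} [NormedAddCommGroup E] [InnerProductSpace ℝ E] [FiniteDimensional ℝ E]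
  [MeasurableSpace E] [BorelSpace E] [Nontrivial E] (μ : Measure E) [μ.IsAddHaarMeasure]

theorem integral_ballCutoff {N : ℕ} :
    ∫ v, ballCutoff N v ∂μ = μ.real (ball 0 1) * (2 * N / (2 * N + Module.finrank ℝ E)) := by
  have hd : 0 < Module.finrank ℝ E := Module.finrank_pos
  have h1 : ∀ v : E, ballCutoff N v =
      (fun _ : E => (1 : ℝ)) (‖v‖⁻¹ • v) *
        (Iio (1 : ℝ)).indicator (fun y => 1 - y ^ (2 * N)) ‖v‖ := by
    intro v
    by_cases h : ‖v‖ < 1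
    · simp [h, ballCutoff, h.le]
    · simp [h, ballCutoff_eq_zero (not_lt.1 h)]
  rw [integral_congr_ae (ae_of_all _ h1), integral_angular_mul_radial μ (fun _ => (1 : ℝ)),
    integral_Ioi_mul_indicator]
  have h2 : ∀ y : ℝ, y ^ (Module.finrank ℝ E - 1) * (1 - y ^ (2 * N)) =
      y ^ (Module.finrank ℝ E - 1) - y ^ (Module.finrank ℝ E - 1 + 2 * N) := by
    intro y; rw [pow_add]; ring
  simp_rw [h2]
  rw [intervalIntegral.integral_sub (by simp) (by simp), integral_pow, integral_pow]
  obtain ⟨d, hd'⟩ := Nat.exists_eq_add_of_lt hd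
  simp only [integral_const, smul_eq_mul, mul_one, Measure.toSphere_real_apply_univ]
  simp only [zero_add] at hd'
  rw [hd']
  simp
  have h3 : (d : ℝ) + 1 ≠ 0 := by positivity
  have h4 : (d : ℝ) + 2 * N + 1 ≠ 0 := by positivity
  have h5 : 2 * N + ((d : ℝ) + 1) ≠ 0 := by positivity
  field_simp
  ring

theorem integral_radial_weight {N : ℕ} (hN : 0 < N) (d : ℕ) :
    ∫ y in Ioi (0 : ℝ), y ^ d * (Iio (1 : ℝ)).indicator (fun y => 2 * N * y ^ (2 * N - 1)) y
      = 2 * N / (2 * N + d) := by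
  rw [integral_Ioi_mul_indicator]
  have h2 : ∀ y : ℝ, y ^ d * (2 * N * y ^ (2 * N - 1)) = 2 * N * y ^ (d + (2 * N - 1)) := by
    intro y; rw [pow_add]; ring
  simp_rw [h2]
  rw [intervalIntegral.integral_const_mul, integral_pow]
  have : ((d + (2 * N - 1) : ℕ) : ℝ) = d + (2 * N - 1) := by
    rw [Nat.cast_add, Nat.cast_sub (by omega)]; simp
  rw [this]
  simp
  ring_nf

theorem integral_radial_weight_mul_sub {N : ℕ} (hN : 0 < N) (d : ℕ) :
    ∫ y in Ioi (0 : ℝ), y ^ d *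
      (Iio (1 : ℝ)).indicator (fun y => 2 * N * y ^ (2 * N - 1) * (1 - y)) y
      = 2 * N / (2 * N + d) - 2 * N / (2 * N + d + 1) := by
  rw [integral_Ioi_mul_indicator]
  have h2 : ∀ y : ℝ, y ^ d * (2 * N * y ^ (2 * N - 1) * (1 - y)) =
      2 * N * y ^ (d + (2 * N - 1)) - 2 * N * y ^ (d + (2 * N - 1) + 1) := by
    intro y; rw [pow_succ, pow_add]; ring
  simp_rw [h2]
  rw [intervalIntegral.integral_sub (Continuous.intervalIntegrable (by fun_prop) _ _)
    (Continuous.intervalIntegrable (by fun_prop) _ _), intervalIntegral.integral_const_mul,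
    intervalIntegral.integral_const_mul, integral_pow, integral_pow]
  have : ((d + (2 * N - 1) : ℕ) : ℝ) = d + (2 * N - 1) := by
    rw [Nat.cast_add, Nat.cast_sub (by omega)]; simp
  push_cast
  rw [Nat.cast_sub (by omega)]
  simp
  ring_nf

/-- Integrate `∂_b k` against the cutoff in two ways. Convexity bounds it from above by values of
`k`. Integration by parts moves the derivative to the cutoff, giving a radial weight that
concentrates at the unit sphere as `N` grows; replacing `k v` by `k (v / ‖v‖)` costs `K (1 - ‖v‖)`,
the subtracted term on the left. Differentiability of `k` almost everywhere suffices. -/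
theorem integral_sphere_sub_le {k : E → ℝ} {K : ℝ≥0} (hk : ConvexOn ℝ univ k)
    (hL : LipschitzWith K k) (b : E) {N : ℕ} (hN : 0 < N) :
    (∫ u : sphere (0 : E) 1, k u * inner ℝ (u : E) b ∂μ.toSphere) *
        (2 * N / (2 * N + (Module.finrank ℝ E - 1 : ℕ))) -
      K * ‖b‖ * μ.toSphere.real univ *
        (2 * N / (2 * N + (Module.finrank ℝ E - 1 : ℕ)) -
          2 * N / (2 * N + (Module.finrank ℝ E - 1 : ℕ) + 1)) ≤
      (k b - k 0 + 2 * K) *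
        (μ.real (ball 0 1) * (2 * N / (2 * N + Module.finrank ℝ E))) := by
  have hcut := (lipschitzWith_ballCutoff (E := E) N).continuous
  have hcs := hasCompactSupport_ballCutoff (E := E) N
  have hint : Integrable (ballCutoff N : E → ℝ) μ := hcut.integrable_of_hasCompactSupport hcs
  have upper : ∫ v, lineDeriv ℝ k v b * ballCutoff N v ∂μ ≤
      (k b - k 0 + 2 * K) *
        (μ.real (ball 0 1) * (2 * N / (2 * N + Module.finrank ℝ E))) := by
    rw [← integral_ballCutoff, ← integral_const_mul]
    refine integral_mono_ae ?_ (hint.const_mul _) ?_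
    · exact hint.bdd_mul (aestronglyMeasurable_lineDeriv hL.continuous μ)
        (ae_of_all _ fun x => norm_lineDeriv_le_of_lipschitz ℝ hL)
    · filter_upwards [hL.ae_lineDifferentiableAt (μ := μ) b] with v hv
      by_cases h : ‖v‖ < 1
      · refine mul_le_mul_of_nonneg_right ?_ (ballCutoff_nonneg N v)
        have h1 := hk.lineDeriv_le hv
        have h2 := hL.dist_le_mul (v + b) b
        have h3 := hL.dist_le_mul v 0
        rw [Real.dist_eq, dist_eq_norm] at h2 h3
        simp only [add_sub_cancel_right, sub_zero] at h2 h3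
        have h4 : K * ‖v‖ ≤ (K : ℝ) := mul_le_of_le_one_right K.2 h.le
        linarith [abs_le.1 h2, abs_le.1 h3]
      · simp [ballCutoff_eq_zero (not_lt.1 h)]
  refine le_trans ?_ upper
  -- Integration by parts for Lipschitz functions; from here on only the derivative of the cutoff
  -- occurs.
  rw [hL.integral_lineDeriv_mul_eq (lipschitzWith_ballCutoff (E := E) N) hcs b]
  set w : ℝ → ℝ := fun y => 2 * N * y ^ (2 * N - 1) with hw
  rw [← integral_radial_weight_mul_sub hN, ← integral_radial_weight hN, mul_assoc,
    ← integral_angular_mul_radial μ (fun u => k u * inner ℝ u b)]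
  have herr := integral_angular_mul_radial μ (fun _ => (1 : ℝ))
    ((Iio (1 : ℝ)).indicator fun y => 2 * N * y ^ (2 * N - 1) * (1 - y))
  simp only [integral_const, smul_eq_mul, mul_one] at herr
  rw [← herr]
  have hcongr : ∫ v, lineDeriv ℝ (ballCutoff N) v (-b) * k v ∂μ =
      ∫ v, (ball (0 : E) 1).indicator
        (fun v => 2 * N * ‖v‖ ^ (2 * (N - 1)) * inner ℝ v b * k v) v ∂μ := by
    refine integral_congr_ae ?_
    have hs : μ (sphere 0 1) = 0 := Measure.addHaar_sphere μ 0 1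
    filter_upwards [measure_eq_zero_iff_ae_notMem.1 hs] with v hv
    rw [lineDeriv_ballCutoff (by simpa using hv)]
    by_cases h : v ∈ ball (0 : E) 1 <;> simp [h]
  have hind : ∀ (ψ : ℝ → ℝ) (v : E), (Iio (1 : ℝ)).indicator ψ ‖v‖ =
      (ball (0 : E) 1).indicator (fun v => ψ ‖v‖) v := by
    intro ψ v; by_cases h : ‖v‖ < 1 <;> simp [h]
  have hIc : ∀ h : E → ℝ, Continuous h → Integrable ((ball (0 : E) 1).indicator h) μ := by
    intro h hh
    rw [integrable_indicator_iff measurableSet_ball]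
    exact (hh.continuousOn.integrableOn_compact (isCompact_closedBall (0 : E) 1)).mono_set
      ball_subset_closedBall
  have hErr : Integrable (fun v : E => 1 *
      (Iio (1 : ℝ)).indicator (fun y => 2 * N * y ^ (2 * N - 1) * (1 - y)) ‖v‖) μ := by
    simp only [one_mul, hind]
    exact hIc _ (by fun_prop)
  have hkm := hL.continuous.measurable
  have hMain : Integrable (fun v : E => k (‖v‖⁻¹ • v) * inner ℝ (‖v‖⁻¹ • v) b *
      (Iio (1 : ℝ)).indicator w ‖v‖) μ := by
    have hwI : Integrable (fun v : E => (Iio (1 : ℝ)).indicator w ‖v‖) μ := by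
      simp only [hind]
      exact hIc _ (by fun_prop)
    have hmeas : Measurable (fun v : E => k (‖v‖⁻¹ • v) * inner ℝ (‖v‖⁻¹ • v) b) := by
      have h1 : Measurable (fun v : E => ‖v‖⁻¹ • v) := by fun_prop
      exact (hkm.comp h1).mul ((by fun_prop : Measurable fun u : E => inner ℝ u b).comp h1)
    refine hwI.bdd_mul (c := (|k 0| + K) * ‖b‖) hmeas.aestronglyMeasurable (ae_of_all _ fun v => ?_)
    have hle : ‖‖v‖⁻¹ • v‖ ≤ 1 := by
      rw [norm_smul, norm_inv, norm_norm]; exact inv_mul_le_one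
    rw [norm_mul]
    have h3 := hL.dist_le_mul (‖v‖⁻¹ • v) 0
    rw [Real.dist_eq, dist_zero_right] at h3
    have h4 : |k (‖v‖⁻¹ • v)| ≤ |k 0| + K := by
      have h5 : (K : ℝ) * ‖‖v‖⁻¹ • v‖ ≤ K := mul_le_of_le_one_right K.2 hle
      have h6 := abs_sub_abs_le_abs_sub (k (‖v‖⁻¹ • v)) (k 0)
      linarith
    have h7 : ‖inner ℝ (‖v‖⁻¹ • v) b‖ ≤ ‖b‖ :=
      (norm_inner_le_norm _ _).trans (mul_le_of_le_one_left (norm_nonneg _) hle)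
    exact mul_le_mul h4 h7 (norm_nonneg _) (by positivity)
  rw [hcongr, ← integral_const_mul, ← integral_sub hMain (hErr.const_mul _)]
  have hkc := hL.continuous
  refine integral_mono (hMain.sub (hErr.const_mul _)) (hIc _ (by fun_prop)) fun v => ?_
  simp only [hind, one_mul]
  by_cases h : ‖v‖ < 1
  · have hvb : v ∈ ball (0 : E) 1 := by simpa using h
    simp only [indicator_of_mem hvb]
    rcases eq_or_ne v 0 with rfl | hv0
    · have : 2 * N - 1 ≠ 0 := by omega
      simp [hw, this]
    have hvn : ‖v‖ ≠ 0 := norm_ne_zero_iff.2 hv0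
    set u := ‖v‖⁻¹ • v with hu
    have hvu : v = ‖v‖ • u := by rw [hu, smul_smul, mul_inv_cancel₀ hvn, one_smul]
    have hun : ‖u‖ = 1 := by rw [hu, norm_smul, norm_inv, norm_norm, inv_mul_cancel₀ hvn]
    have hku : |k u - k v| ≤ K * (1 - ‖v‖) := by
      have := hL.dist_le_mul u v
      rw [Real.dist_eq, dist_eq_norm] at this
      have h2 : u - v = (1 - ‖v‖) • u := by
        rw [sub_smul, one_smul, ← hvu]
      rwa [h2, norm_smul, hun, mul_one, Real.norm_eq_abs,
        abs_of_nonneg (sub_nonneg.2 h.le)] at this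
    have hub : |inner ℝ u b| ≤ ‖b‖ := by
      simpa [hun] using abs_real_inner_le_norm u b
    have hin : inner ℝ v b = ‖v‖ * inner ℝ u b := by
      conv_lhs => rw [hvu, real_inner_smul_left]
    have hw' : 2 * (N : ℝ) * ‖v‖ ^ (2 * (N - 1)) * inner ℝ v b = w ‖v‖ * inner ℝ u b := by
      rw [hin, hw]
      have : 2 * N - 1 = 2 * (N - 1) + 1 := by omega
      simp only [this, pow_succ]; ring
    have hwn : 0 ≤ w ‖v‖ := by positivity
    have key : (k u - k v) * inner ℝ u b ≤ K * (1 - ‖v‖) * ‖b‖ := by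
      calc _ ≤ |(k u - k v) * inner ℝ u b| := le_abs_self _
        _ = |k u - k v| * |inner ℝ u b| := abs_mul _ _
        _ ≤ _ := by gcongr
    have := mul_le_mul_of_nonneg_right key hwn
    rw [hw']
    have hww : 2 * (N : ℝ) * ‖v‖ ^ (2 * N - 1) = w ‖v‖ := rfl
    rw [hww]
    nlinarith
  · have hvb : v ∉ ball (0 : E) 1 := by simpa using h
    simp [hvb]

/-- Half of Stokes' theorem on the unit ball for a convex function: the flux of `k • b` through the
unit sphere is at most the integral over the ball of `k (v + b) - k v`. -/
theorem integral_sphere_mul_inner_le {k : E → ℝ} {K : ℝ≥0} (hk : ConvexOn ℝ univ k)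
    (hL : LipschitzWith K k) (b : E) :
    ∫ u : sphere (0 : E) 1, k u * inner ℝ (u : E) b ∂μ.toSphere ≤
      μ.real (ball 0 1) * (k b - k 0 + 2 * K) := by
  have hr : ∀ d : ℝ, Tendsto (fun N : ℕ => 2 * (N : ℝ) / (2 * N + d)) atTop (𝓝 1) := by
    intro d
    have h1 : Tendsto (fun N : ℕ => 2 * (N : ℝ) + d) atTop atTop :=
      tendsto_atTop_add_const_right _ _
        (tendsto_natCast_atTop_atTop.const_mul_atTop (by norm_num))
    have h2 : Tendsto (fun N : ℕ => 1 - d / (2 * (N : ℝ) + d)) atTop (𝓝 (1 - 0)) :=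
      (tendsto_const_nhds.div_atTop h1).const_sub 1
    rw [sub_zero] at h2
    refine h2.congr' ?_
    filter_upwards [h1.eventually_gt_atTop 0] with N hN
    field_simp
    ring
  have hr1 := hr (Module.finrank ℝ E - 1 : ℕ)
  have hr2 := hr ((Module.finrank ℝ E - 1 : ℕ) + 1)
  have hr3 := hr (Module.finrank ℝ E)
  simp only [← add_assoc] at hr2
  -- As `N → ∞` all the ratios tend to `1`, so the radial error, a difference of two of them,
  -- vanishes.
  have hlim := le_of_tendsto_of_tendsto
    ((hr1.const_mul (∫ u : sphere (0 : E) 1, k u * inner ℝ (u : E) b ∂μ.toSphere)).sub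
      ((hr1.sub hr2).const_mul (K * ‖b‖ * μ.toSphere.real univ)))
    ((hr3.const_mul (μ.real (ball (0 : E) 1))).const_mul (k b - k 0 + 2 * K))
    (by filter_upwards [eventually_gt_atTop 0] with N hN
        exact integral_sphere_sub_le μ hk hL b hN)
  simp only [mul_one, sub_self, mul_zero, sub_zero] at hlim
  linarith

end Sphere2

/-! ### The two-point estimator in expectation -/

section GradEst
open Metric Filter Topology
open scoped NNReal

instance isProbabilityMeasure_sphereUniform (p : ℕ) [NeZero p] :
    IsProbabilityMeasure (sphereUniform p) := by
  have : Nontrivial (Vec p) := inferInstance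
  refine ⟨?_⟩
  rw [sphereUniform, Measure.smul_apply, smul_eq_mul]
  refine ENNReal.inv_mul_cancel ?_ (measure_ne_top _ _)
  rw [Measure.measure_univ_ne_zero]
  exact Measure.toSphere_ne_zero _

/-- The surface measure of the sphere is `p` times the volume of the ball; this explains the factor
`p` in the estimator. -/
theorem integral_sphereUniform_mul_inner_le {p : ℕ} [NeZero p] {k : Vec p → ℝ} {K : ℝ≥0}
    (hk : ConvexOn ℝ univ k) (hL : LipschitzWith K k) (b : Vec p) :
    p * ∫ u, k u * inner ℝ (u : Vec p) b ∂sphereUniform p ≤ k b - k 0 + 2 * K := by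
  have h := integral_sphere_mul_inner_le volume hk hL b
  have hv : 0 < (volume : Measure (Vec p)).real (ball 0 1) :=
    ENNReal.toReal_pos (isOpen_ball.measure_ne_zero _ (by simp)) measure_ball_lt_top.ne
  have hp : (0 : ℝ) < p := Nat.cast_pos.2 (NeZero.pos p)
  rw [sphereUniform, integral_smul_measure, ENNReal.toReal_inv, ← Measure.real,
    Measure.toSphere_real_apply_univ, finrank_euclideanSpace_fin, smul_eq_mul]
  rw [mul_inv, mul_assoc, mul_inv_cancel_left₀ hp.ne', inv_mul_le_iff₀ hv]
  exact h

/-- Stokes' inequality for `v ↦ h (x + δ v) - h x`, which is `L δ`-Lipschitz, with `b = (y - x) /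
δ`, so that `b` is mapped to `y`. -/
theorem LipschitzWith.le_integral_gradEst {p : ℕ} [NeZero p] {h : Vec p → ℝ} {L : ℝ≥0}
    (hL : LipschitzWith L h) (hh : ConvexOn ℝ univ h) {δ : ℝ} (hδ : 0 < δ) (x y : Vec p) :
    h x - h y - 2 * L * δ ≤ ∫ u, inner ℝ (gradEst h δ x u) (x - y) ∂sphereUniform p := by
  lift δ to ℝ≥0 using hδ.le
  have hδ' : (δ : ℝ) ≠ 0 := hδ.ne'
  have hk : ConvexOn ℝ univ fun v : Vec p => h (x + (δ : ℝ) • v) - h x := by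
    refine ⟨convex_univ, fun v _ w _ a b ha hb hab => ?_⟩
    have h1 := hh.2 (mem_univ (x + (δ : ℝ) • v)) (mem_univ (x + (δ : ℝ) • w)) ha hb hab
    have h2 : a • (x + (δ : ℝ) • v) + b • (x + (δ : ℝ) • w) = x + (δ : ℝ) • (a • v + b • w) := by
      have : x = (a + b) • x := by rw [hab, one_smul]
      conv_rhs => rw [this]
      module
    rw [h2] at h1
    simp only [smul_eq_mul] at h1 ⊢
    linear_combination h1 + h x * hab
  have hkL : LipschitzWith (L * δ) fun v : Vec p => h (x + (δ : ℝ) • v) - h x := by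
    refine LipschitzWith.of_dist_le_mul fun v w => ?_
    have h1 := hL.dist_le_mul (x + (δ : ℝ) • v) (x + (δ : ℝ) • w)
    rw [dist_add_left, dist_smul₀, Real.norm_of_nonneg hδ.le] at h1
    simpa [Real.dist_eq, mul_assoc] using h1
  have h3 := integral_sphereUniform_mul_inner_le hk hkL ((δ : ℝ)⁻¹ • (y - x))
  simp only [smul_inv_smul₀ hδ', smul_zero, add_zero, sub_self, sub_zero, NNReal.coe_mul,
    add_sub_cancel] at h3
  have h4 : ∀ u : sphere (0 : Vec p) 1, inner ℝ (gradEst h δ x u) (x - y) =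
      -p * ((h (x + (δ : ℝ) • (u : Vec p)) - h x) * inner ℝ (u : Vec p) ((δ : ℝ)⁻¹ • (y - x))) := by
    intro u
    rw [gradEst, real_inner_smul_left, real_inner_smul_right, ← neg_sub y x, inner_neg_right]
    ring
  rw [integral_congr_ae (ae_of_all _ h4), integral_const_mul]
  linarith

/-- One half of the isotropy `p E[u uᵀ] = 1`, which is all that is needed. The estimator of a linear
function does not depend on `δ`, so the error of the convex estimate, taken at `y = 0`, can be sent
to zero. -/
theorem inner_le_integral_inner_mul_inner {p : ℕ} [NeZero p] (a b : Vec p) :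
    inner ℝ a b ≤
      p * ∫ u : sphere (0 : Vec p) 1, inner ℝ a (u : Vec p) * inner ℝ (u : Vec p) b
        ∂sphereUniform p := by
  have hL : LipschitzWith ‖a‖₊ fun v : Vec p => inner ℝ a v := by
    have := (innerSL ℝ a).lipschitz
    rwa [show ‖innerSL ℝ a‖₊ = ‖a‖₊ from NNReal.eq (innerSL_apply_norm ℝ a)] at this
  have hc : ConvexOn ℝ univ fun v : Vec p => inner ℝ a v :=
    ((innerSL ℝ a).toLinearMap.convexOn convex_univ)
  have h1 : ∀ δ > 0, inner ℝ a b - 2 * ‖a‖ * δ ≤ p * ∫ u : sphere (0 : Vec p) 1,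
      inner ℝ a (u : Vec p) * inner ℝ (u : Vec p) b ∂sphereUniform p := by
    intro δ hδ
    have h2 := hL.le_integral_gradEst hc hδ b 0
    have h3 : ∀ u : sphere (0 : Vec p) 1,
        inner ℝ (gradEst (fun v => inner ℝ a v) δ b u) (b - 0) =
        p * (inner ℝ a (u : Vec p) * inner ℝ (u : Vec p) b) := by
      intro u
      rw [gradEst, real_inner_smul_left, inner_add_right, real_inner_smul_right, sub_zero]
      field_simp
      ring
    rw [integral_congr_ae (ae_of_all _ h3), integral_const_mul] at h2
    simpa using h2
  refine le_of_forall_pos_le_add fun ε hε => ?_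
  have h2 := h1 (ε / (2 * ‖a‖ + 1)) (by positivity)
  have h3 : 2 * ‖a‖ * (ε / (2 * ‖a‖ + 1)) ≤ ε := by
    rw [← mul_div_assoc, div_le_iff₀ (by positivity)]
    nlinarith [norm_nonneg a]
  linarith

/-- A function with subgradients of norm at most `L` at all points of a nonempty set extends to a
convex `L`-Lipschitz function on the whole space, the supremum of the supporting affine
functions. -/
theorem exists_convex_lipschitz_extension {p : ℕ} {X : Set (Vec p)} (hX : X.Nonempty)
    {h : Vec p → ℝ} {L : ℝ≥0} (hs : ∀ x ∈ X, ∃ s, IsSubgradient X h x s ∧ ‖s‖ ≤ L) :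
    ∃ e : Vec p → ℝ, ConvexOn ℝ univ e ∧ LipschitzWith L e ∧ EqOn e h X := by
  choose! s hs hsL using hs
  have : Nonempty X := hX.to_subtype
  have hub : ∀ (x : X) (v w : Vec p),
      h x + inner ℝ (s x) (v - x) ≤ h x + inner ℝ (s x) (w - x) + L * ‖v - w‖ := by
    intro x v w
    have h1 : inner ℝ (s x) (v - x) = inner ℝ (s x) (w - (x : Vec p)) + inner ℝ (s x) (v - w) := by
      rw [← inner_add_right]; congr 1; abel
    have h2 : inner ℝ (s x) (v - w) ≤ L * ‖v - w‖ :=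
      (real_inner_le_norm _ _).trans (by gcongr; exact hsL x x.2)
    linarith
  have hbdd : ∀ v : Vec p, BddAbove (range fun x : X => h x + inner ℝ (s x) (v - x)) := by
    intro v
    obtain ⟨x₀, hx₀⟩ := hX
    refine ⟨h x₀ + L * ‖v - x₀‖, ?_⟩
    rintro _ ⟨x, rfl⟩
    exact (hub x v x₀).trans (by gcongr; exact hs x x.2 x₀ hx₀)
  refine ⟨fun v => ⨆ x : X, h x + inner ℝ (s x) (v - x), ⟨convex_univ, ?_⟩, ?_, ?_⟩
  · intro v _ w _ a b ha hb hab
    refine ciSup_le fun x => ?_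
    have h1 := le_ciSup (hbdd v) x
    have h2 := le_ciSup (hbdd w) x
    have h3 : a • v + b • w - (x : Vec p) = a • (v - x) + b • (w - x) := by
      have : (x : Vec p) = (a + b) • (x : Vec p) := by rw [hab, one_smul]
      conv_lhs => rw [this]
      module
    have h4 := add_le_add (mul_le_mul_of_nonneg_left h1 ha) (mul_le_mul_of_nonneg_left h2 hb)
    rw [h3, inner_add_right, real_inner_smul_right, real_inner_smul_right]
    simp only [smul_eq_mul] at h4 ⊢
    linear_combination h4 - h x * hab
  · refine LipschitzWith.of_le_add_mul L fun v w => ciSup_le fun x => ?_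
    refine (hub x v w).trans ?_
    rw [dist_eq_norm]
    gcongr
    exact le_ciSup (hbdd w) x
  · intro v hv
    refine le_antisymm (ciSup_le fun x => hs x x.2 v hv) ?_
    simpa using le_ciSup (hbdd v) ⟨v, hv⟩

variable {p : ℕ} {X : Set (Vec p)} {h : Vec p → ℝ} {L : ℝ} {δ : ℝ} {x y : Vec p}

theorem gradEst_congr {e : Vec p → ℝ} (he : EqOn e h X) (hx : x ∈ X) {u : Vec p}
    (hu : x + δ • u ∈ X) : gradEst h δ x u = gradEst e δ x u := by
  rw [gradEst, gradEst, he hx, he hu]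

theorem nonneg_of_subgradient (hx : x ∈ X)
    (hs : ∀ x ∈ X, ∃ s, IsSubgradient X h x s ∧ ‖s‖ ≤ L) : 0 ≤ L := by
  obtain ⟨s, -, h⟩ := hs x hx
  exact (norm_nonneg s).trans h

variable [NeZero p]

/-- The estimator is in expectation an approximate subgradient of a convex function. -/
theorem le_integral_gradEst (hs : ∀ x ∈ X, ∃ s, IsSubgradient X h x s ∧ ‖s‖ ≤ L) (hδ : 0 < δ)
    (hx : x ∈ X) (hy : y ∈ X) (hu : ∀ u ∈ sphere (0 : Vec p) 1, x + δ • u ∈ X) :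
    h x - h y - 2 * L * δ ≤ ∫ u, inner ℝ (gradEst h δ x u) (x - y) ∂sphereUniform p := by
  lift L to ℝ≥0 using nonneg_of_subgradient hx hs
  obtain ⟨e, hc, hL, he⟩ := exists_convex_lipschitz_extension ⟨x, hx⟩ hs
  have := hL.le_integral_gradEst hc hδ x y
  rw [he hx, he hy] at this
  refine this.trans_eq (integral_congr_ae (ae_of_all _ fun u => ?_))
  simp only [gradEst_congr he hx (hu u u.2)]

/-- The estimator is in expectation an approximate strong subgradient of a strongly convex
function. -/
theorem le_integral_gradEst_of_strong {m R : ℝ}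
    (hs : ∀ x ∈ X, ∃ s, IsSubgradient X h x s ∧ ‖s‖ ≤ L) (hm : 0 ≤ m)
    (hstrong : ∀ x ∈ X, ∀ y ∈ X, ∀ s, IsSubgradient X h y s →
      h y + inner ℝ (x - y) s + m / 2 * ‖x - y‖ ^ 2 ≤ h x)
    (hXR : X ⊆ closedBall 0 R) (hδ : 0 < δ)
    (hx : x ∈ X) (hy : y ∈ X) (hu : ∀ u ∈ sphere (0 : Vec p) 1, x + δ • u ∈ X) :
    h x - h y + m / 2 * ‖x - y‖ ^ 2 - (2 * (L + m * R) + p * m * R) * δ ≤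
      ∫ u, inner ℝ (gradEst h δ x u) (x - y) ∂sphereUniform p := by
  have hn : ∀ z ∈ X, ‖z‖ ≤ R := fun z hz => by simpa using hXR hz
  -- Subtracting `m / 2 * ‖z‖ ^ 2` leaves a function with bounded subgradients `s - m • z`, to which
  -- the convex case applies; the estimator of the quadratic is computed explicitly.
  have hs' : ∀ x ∈ X, ∃ s, IsSubgradient X (fun z => h z - m / 2 * ‖z‖ ^ 2) x s ∧
      ‖s‖ ≤ L + m * R := by
    intro z hz
    obtain ⟨s, h1, h2⟩ := hs z hz
    refine ⟨s - m • z, fun v hv => ?_, ?_⟩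
    · have h3 := hstrong v hv z hz s h1
      have h4 : v = z + (v - z) := by abel
      have h5 : ‖v‖ ^ 2 = ‖z‖ ^ 2 + 2 * inner ℝ z (v - z) + ‖v - z‖ ^ 2 := by
        conv_lhs => rw [h4]
        exact norm_add_sq_real _ _
      rw [inner_sub_left, real_inner_smul_left, real_inner_comm]
      simp only [h5]
      linarith
    · refine (norm_sub_le _ _).trans ?_
      rw [norm_smul, Real.norm_of_nonneg hm]
      gcongr
      exact hn z hz
  have hLR := nonneg_of_subgradient hx hs'
  lift (L + m * R) to ℝ≥0 using hLR with L' hL'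
  obtain ⟨e, hc, hL, he⟩ := exists_convex_lipschitz_extension ⟨x, hx⟩ hs'
  have h1 := hL.le_integral_gradEst hc hδ x y
  rw [he hx, he hy] at h1
  have hpt : ∀ u : sphere (0 : Vec p) 1, inner ℝ (gradEst e δ x u) (x - y) +
      (m * p) * (inner ℝ x (u : Vec p) * inner ℝ (u : Vec p) (x - y)) - p * m * R * δ ≤
      inner ℝ (gradEst h δ x u) (x - y) := by
    intro u
    have hxu : ‖x + δ • (u : Vec p)‖ ^ 2 = ‖x‖ ^ 2 + 2 * δ * inner ℝ x (u : Vec p) + δ ^ 2 := by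
      rw [norm_add_sq_real, real_inner_smul_right, norm_smul, norm_eq_of_mem_sphere,
        Real.norm_of_nonneg hδ.le]
      ring
    have h2 : inner ℝ (gradEst h δ x u) (x - y) = inner ℝ (gradEst e δ x u) (x - y) +
        (m * p) * (inner ℝ x (u : Vec p) * inner ℝ (u : Vec p) (x - y)) +
        p * m / 2 * δ * inner ℝ (u : Vec p) (x - y) := by
      rw [gradEst, gradEst, real_inner_smul_left, real_inner_smul_left, he hx, he (hu u u.2)]
      simp only [hxu]
      field_simp
      ring
    -- The part of the quadratic of second order in `δ` leaves `p m δ / 2 * ⟨u, x - y⟩`, which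
    -- becomes the error `p m R δ`.
    have h3 : -(2 * R) ≤ inner ℝ (u : Vec p) (x - y) := by
      have h4 := (abs_le.1 (abs_real_inner_le_norm (u : Vec p) (x - y))).1
      rw [norm_eq_of_mem_sphere, one_mul] at h4
      have := norm_sub_le x y
      linarith [hn x hx, hn y hy]
    have h5 := mul_le_mul_of_nonneg_left h3 (by positivity : 0 ≤ p * m / 2 * δ)
    rw [h2]
    linarith
  have hint : ∀ F : sphere (0 : Vec p) 1 → ℝ, Continuous F → Integrable F (sphereUniform p) :=
    fun F hF => hF.integrable_of_hasCompactSupport (HasCompactSupport.of_compactSpace F)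
  have hec := hL.continuous
  have hge : Continuous fun u : sphere (0 : Vec p) 1 => inner ℝ (gradEst e δ x u) (x - y) := by
    unfold gradEst; fun_prop
  have hi : Continuous fun u : sphere (0 : Vec p) 1 =>
    (m * p) * (inner ℝ x (u : Vec p) * inner ℝ (u : Vec p) (x - y)) := by fun_prop
  have hih : Integrable (fun u : sphere (0 : Vec p) 1 => inner ℝ (gradEst h δ x u) (x - y))
      (sphereUniform p) := by
    have hc' : Continuous fun u : sphere (0 : Vec p) 1 =>
        inner ℝ (gradEst (fun z => e z + m / 2 * ‖z‖ ^ 2) δ x u) (x - y) := by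
      unfold gradEst; fun_prop
    refine (hint _ hc').congr (ae_of_all _ fun u => ?_)
    have : EqOn (fun z => e z + m / 2 * ‖z‖ ^ 2) h X := fun z hz => by simp [he hz]
    simp only [gradEst_congr this hx (hu u u.2)]
  have h6 := integral_mono (((hint _ hge).add (hint _ hi)).sub (integrable_const _)) hih hpt
  rw [integral_sub' ((hint _ hge).add (hint _ hi)) (integrable_const _),
    integral_add' (hint _ hge) (hint _ hi), integral_const_mul] at h6
  simp only [integral_const, probReal_univ, smul_eq_mul, one_mul] at h6
  have h7 := mul_le_mul_of_nonneg_left (inner_le_integral_inner_mul_inner x (x - y)) hm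
  have h8 : m / 2 * ‖x - y‖ ^ 2 + m / 2 * ‖x‖ ^ 2 - m / 2 * ‖y‖ ^ 2 = m * inner ℝ x (x - y) := by
    rw [norm_sub_sq_real, inner_sub_right, real_inner_self_eq_norm_sq]; ring
  linarith

end GradEst

/-! ### Contraction of the disagreement -/

section Consensus

variable {n : ℕ} {E : Type*} [NormedAddCommGroup E] [NormedSpace ℝ E]

/-- Convex combinations of points with pairwise distances at most `d`, all of whose weights are at
least `η`, are close to each other. -/
theorem norm_sum_smul_sub_sum_smul_le {a b : Fin n → ℝ} {η d : ℝ} {z : Fin n → E}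
    (ha : ∀ j, η ≤ a j) (hb : ∀ j, η ≤ b j) (ha1 : ∑ j, a j = 1) (hb1 : ∑ j, b j = 1)
    (hz : ∀ j k, ‖z j - z k‖ ≤ d) :
    ‖∑ j, a j • z j - ∑ j, b j • z j‖ ≤ (1 - n * η) * d := by
  have ha2 : ∑ j, (a j - η) = 1 - n * η := by simp [Finset.sum_sub_distrib, ha1]
  have hb2 : ∑ j, (b j - η) = 1 - n * η := by simp [Finset.sum_sub_distrib, hb1]
  have hm : 0 ≤ 1 - n * η := ha2 ▸ Finset.sum_nonneg fun j _ => sub_nonneg.2 (ha j)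
  have hab : ∑ j, a j • z j - ∑ j, b j • z j =
      ∑ j, (a j - η) • z j - ∑ j, (b j - η) • z j := by
    simp only [sub_smul, Finset.sum_sub_distrib]
    abel
  rw [hab]
  rcases hm.eq_or_lt with h0 | hpos
  · have ha0 : ∀ j, a j - η = 0 := fun j =>
      (Finset.sum_eq_zero_iff_of_nonneg fun j _ => sub_nonneg.2 (ha j)).1 (ha2.trans h0.symm) j
        (Finset.mem_univ j)
    have hb0 : ∀ j, b j - η = 0 := fun j =>
      (Finset.sum_eq_zero_iff_of_nonneg fun j _ => sub_nonneg.2 (hb j)).1 (hb2.trans h0.symm) j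
        (Finset.mem_univ j)
    simp [ha0, hb0, ← h0]
  -- After removal of the common mass `η` at each index, both weight vectors have total mass `1 - n
  -- η`. Their product coupling, which carries this mass squared, writes the difference as a
  -- combination of differences `z j - z k`.
  · have hexp : (1 - n * η) • (∑ j, (a j - η) • z j - ∑ j, (b j - η) • z j) =
        ∑ j, ∑ k, ((a j - η) * (b k - η)) • (z j - z k) := by
      simp only [smul_sub, Finset.sum_sub_distrib]
      congr 1
      · rw [← hb2, Finset.smul_sum]
        refine Finset.sum_congr rfl fun j _ => ?_
        rw [← Finset.sum_smul, ← Finset.mul_sum, smul_smul, mul_comm]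
      · rw [Finset.sum_comm, ← ha2, Finset.smul_sum]
        refine Finset.sum_congr rfl fun j _ => ?_
        rw [← Finset.sum_smul, ← Finset.sum_mul, smul_smul]
    have hle : ‖(1 - n * η) • (∑ j, (a j - η) • z j - ∑ j, (b j - η) • z j)‖ ≤
        (1 - n * η) * ((1 - n * η) * d) := by
      rw [hexp]
      calc _ ≤ ∑ j, ∑ k, (a j - η) * (b k - η) * d := by
            refine norm_sum_le_of_le _ fun j _ => norm_sum_le_of_le _ fun k _ => ?_
            have h1 := mul_nonneg (sub_nonneg.2 (ha j)) (sub_nonneg.2 (hb k))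
            rw [norm_smul, Real.norm_of_nonneg h1]
            exact mul_le_mul_of_nonneg_left (hz j k) h1
        _ = _ := by
            simp only [← Finset.sum_mul, ← Finset.mul_sum, ha2, hb2]
            ring
    rw [norm_smul, Real.norm_of_nonneg hm] at hle
    exact le_of_mul_le_mul_left hle hpos

/-- The product `W (t + l - 1) * ⋯ * W t`. -/
def transition (W : ℕ → Matrix (Fin n) (Fin n) ℝ) (t : ℕ) : ℕ → Matrix (Fin n) (Fin n) ℝ
  | 0 => 1
  | l + 1 => W (t + l) * transition W t l

variable {p : ℕ} {Q : Problem n p} {w : ℝ} {B : ℕ}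

theorem BanditOCO.NetworkAssumption.weight_nonneg (hQ : NetworkAssumption Q w B) {t : ℕ}
    (ht : 1 ≤ t) (i j : Fin n) : 0 ≤ Q.W t i j := by
  by_cases h : (Q.graph t).Adj j i ∨ i = j
  · exact hQ.w_pos.le.trans (hQ.weight_ge t ht i j h)
  · exact (hQ.weight_zero t ht i j h).ge

theorem transition_nonneg (hQ : NetworkAssumption Q w B) {t : ℕ} (ht : 1 ≤ t) (l : ℕ)
    (i j : Fin n) : 0 ≤ transition Q.W t l i j := by
  induction l generalizing i with
  | zero => rw [transition, Matrix.one_apply]; split_ifs <;> simp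
  | succ l ih =>
    rw [transition, Matrix.mul_apply]
    exact Finset.sum_nonneg fun k _ => mul_nonneg (hQ.weight_nonneg (by omega) i k) (ih k)

theorem transition_row_sum (hQ : NetworkAssumption Q w B) {t : ℕ} (ht : 1 ≤ t) (l : ℕ)
    (i : Fin n) : ∑ j, transition Q.W t l i j = 1 := by
  induction l generalizing i with
  | zero => simp [transition, Matrix.one_apply]
  | succ l ih =>
    simp only [transition, Matrix.mul_apply]
    rw [Finset.sum_comm]
    simp only [← Finset.mul_sum, ih, mul_one]
    exact hQ.row_sum _ (by omega) i

theorem pow_succ_le_transition (hQ : NetworkAssumption Q w B) {t : ℕ} (ht : 1 ≤ t) {l : ℕ}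
    {i j b : Fin n} (hij : (Q.graph (t + l)).Adj j i ∨ i = j)
    (h : w ^ l ≤ transition Q.W t l j b) : w ^ (l + 1) ≤ transition Q.W t (l + 1) i b := by
  rw [transition, Matrix.mul_apply, pow_succ']
  calc w * w ^ l ≤ Q.W (t + l) i j * transition Q.W t l j b :=
        mul_le_mul (hQ.weight_ge _ (by omega) i j hij) h (pow_nonneg hQ.w_pos.le _)
          (hQ.weight_nonneg (by omega) i j)
    _ ≤ _ := Finset.single_le_sum (f := fun k => Q.W (t + l) i k * transition Q.W t l k b)
        (fun k _ => mul_nonneg (hQ.weight_nonneg (by omega) i k) (transition_nonneg hQ ht l k b))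
        (Finset.mem_univ j)

theorem pow_add_le_transition (hQ : NetworkAssumption Q w B) {t : ℕ} (ht : 1 ≤ t) {l : ℕ}
    {i b : Fin n} (h : w ^ l ≤ transition Q.W t l i b) (m : ℕ) :
    w ^ (l + m) ≤ transition Q.W t (l + m) i b := by
  induction m with
  | zero => exact h
  | succ m ih => exact pow_succ_le_transition hQ ht (Or.inr rfl) ih

theorem exists_edge_out {α : Type*} {r : α → α → Prop} {a b : α} (h : Relation.ReflTransGen r a b)
    {S : Set α} (ha : a ∈ S) (hb : b ∉ S) : ∃ j ∈ S, ∃ i ∉ S, r j i := by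
  by_contra! hcon
  refine hb ?_
  clear hb
  induction h with
  | refl => exact ha
  | tail _ hr ih =>
    by_contra hS
    exact hcon _ ih _ hS hr

/-- While some agent is not reached from `b`, the union graph over the next `B` iterations has an
edge leaving the set of reached agents. The self-loops preserve what has been reached before and
after that edge is used, so each block of `B` iterations reaches at least one more agent. -/
theorem card_reached (hQ : NetworkAssumption Q w B) {t : ℕ} (ht : 1 ≤ t) (b : Fin n) (m : ℕ) :
    (∀ i, w ^ (m * B) ≤ transition Q.W t (m * B) i b) ∨
      m + 1 ≤ ({i | w ^ (m * B) ≤ transition Q.W t (m * B) i b} : Finset (Fin n)).card := by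
  induction m with
  | zero =>
    right
    simp only [zero_mul, pow_zero, transition, zero_add, Finset.one_le_card]
    exact ⟨b, by simp⟩
  | succ m ih =>
    by_cases hall : ∀ i, w ^ (m * B) ≤ transition Q.W t (m * B) i b
    · left
      intro i
      rw [Nat.succ_mul]
      exact pow_add_le_transition hQ ht (hall i) B
    · right
      have hcard := ih.resolve_left hall
      have hb : b ∈ {i | w ^ (m * B) ≤ transition Q.W t (m * B) i b} := by
        have h0 : w ^ 0 ≤ transition Q.W t 0 b b := by simp [transition]
        simpa using pow_add_le_transition hQ ht h0 (m * B)
      push Not at hall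
      obtain ⟨a, ha⟩ := hall
      obtain ⟨j, hj, i, hi, l, hl, hadj⟩ := exists_edge_out
        (hQ.connected (t + m * B) (by omega) b a) hb (not_le.2 ha)
      have hnew : w ^ ((m + 1) * B) ≤ transition Q.W t ((m + 1) * B) i b := by
        have h1 := pow_succ_le_transition hQ ht (Or.inl (by rwa [add_assoc] at hadj))
          (pow_add_le_transition hQ ht hj l)
        have h2 := pow_add_le_transition hQ ht h1 (B - l - 1)
        have h3 : m * B + l + 1 + (B - l - 1) = (m + 1) * B := by rw [Nat.succ_mul]; omega
        rwa [h3] at h2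
      refine Nat.succ_le_of_lt (hcard.trans_lt (Finset.card_lt_card ?_))
      refine (Finset.ssubset_iff_of_subset fun k hk => ?_).2 ⟨i, by simpa using hnew, by simpa using hi⟩
      simp only [Finset.mem_filter, Finset.mem_univ, true_and] at hk ⊢
      rw [Nat.succ_mul]
      exact pow_add_le_transition hQ ht hk B

/-- Over `n * B` iterations the agents influence each other with weight at least `w ^ (n * B)`. -/
theorem pow_le_transition (hQ : NetworkAssumption Q w B) {t : ℕ} (ht : 1 ≤ t) (i b : Fin n) :
    w ^ (n * B) ≤ transition Q.W t (n * B) i b := by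
  refine (card_reached hQ ht b n).resolve_right (fun h => ?_) i
  have := Finset.card_le_univ ({i | w ^ (n * B) ≤ transition Q.W t (n * B) i b} : Finset (Fin n))
  simp only [Fintype.card_fin] at this
  omega

/-- Averaging with row-stochastic weights does not enlarge earlier perturbations, so they only add
up. -/
theorem norm_sub_transition_le (hQ : NetworkAssumption Q w B) {z : ℕ → Fin n → E} {e : ℕ → ℝ}
    (hz : ∀ t, 1 ≤ t → ∀ i, ‖z (t + 1) i - ∑ j, Q.W t i j • z t j‖ ≤ e t) {t : ℕ} (ht : 1 ≤ t)
    (l : ℕ) (i : Fin n) :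
    ‖z (t + l) i - ∑ j, transition Q.W t l i j • z t j‖ ≤ ∑ s ∈ Finset.range l, e (t + s) := by
  induction l generalizing i with
  | zero => simp [transition, Matrix.one_apply]
  | succ l ih =>
    have h1 : ∑ j, transition Q.W t (l + 1) i j • z t j =
        ∑ k, Q.W (t + l) i k • ∑ j, transition Q.W t l k j • z t j := by
      simp only [transition, Matrix.mul_apply, Finset.sum_smul, Finset.smul_sum, smul_smul]
      exact Finset.sum_comm
    have h2 : z (t + l + 1) i - ∑ j, transition Q.W t (l + 1) i j • z t j =
        (z (t + l + 1) i - ∑ k, Q.W (t + l) i k • z (t + l) k) +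
          ∑ k, Q.W (t + l) i k • (z (t + l) k - ∑ j, transition Q.W t l k j • z t j) := by
      rw [h1]
      simp only [smul_sub, Finset.sum_sub_distrib]
      abel
    rw [← add_assoc, h2, Finset.sum_range_succ, add_comm (∑ s ∈ _, _)]
    refine (norm_add_le _ _).trans (add_le_add (hz _ (by omega) i) ?_)
    calc _ ≤ ∑ k, Q.W (t + l) i k * ∑ s ∈ Finset.range l, e (t + s) := by
          refine norm_sum_le_of_le _ fun k _ => ?_
          have := hQ.weight_nonneg (t := t + l) (by omega) i k
          rw [norm_smul, Real.norm_of_nonneg this]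
          exact mul_le_mul_of_nonneg_left (ih k) this
      _ = _ := by rw [← Finset.sum_mul, hQ.row_sum _ (by omega) i, one_mul]

theorem norm_sub_le_diam_range {E : Type*} [SeminormedAddCommGroup E] (z : Fin n → E) (i j : Fin n) :
    ‖z i - z j‖ ≤ Metric.diam (range z) := by
  rw [← dist_eq_norm]
  exact Metric.dist_le_diam_of_mem (finite_range z).isBounded (mem_range_self i) (mem_range_self j)

theorem diam_range_le {E : Type*} [SeminormedAddCommGroup E] {z : Fin n → E} {d : ℝ} (hd : 0 ≤ d) (h : ∀ i j, ‖z i - z j‖ ≤ d) :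
    Metric.diam (range z) ≤ d := by
  refine Metric.diam_le_of_forall_dist_le hd ?_
  rintro _ ⟨i, rfl⟩ _ ⟨j, rfl⟩
  rw [dist_eq_norm]
  exact h i j

theorem norm_consensus_sub_le (hQ : NetworkAssumption Q w B) {t : ℕ} (ht : 1 ≤ t)
    (z : Fin n → Vec p) (i j : Fin n) :
    ‖consensus Q t z i - consensus Q t z j‖ ≤ Metric.diam (range z) := by
  simpa [consensus] using norm_sum_smul_sub_sum_smul_le (η := 0) (hQ.weight_nonneg ht i)
    (hQ.weight_nonneg ht j) (hQ.row_sum t ht i) (hQ.row_sum t ht j) (norm_sub_le_diam_range z)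

/-- After `n B` iterations all transition weights are at least `w ^ (n B)`, so the unperturbed
positions contract; each agent deviates from them by at most the accumulated perturbation, whence
the factor `2`. -/
theorem diam_range_add_le (hQ : NetworkAssumption Q w B) {z : ℕ → Fin n → E} {e : ℕ → ℝ}
    (he : ∀ t, 0 ≤ e t)
    (hz : ∀ t, 1 ≤ t → ∀ i, ‖z (t + 1) i - ∑ j, Q.W t i j • z t j‖ ≤ e t) {t : ℕ} (ht : 1 ≤ t)
    (i₀ : Fin n) :
    Metric.diam (range (z (t + n * B))) ≤ (1 - n * w ^ (n * B)) * Metric.diam (range (z t)) +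
      2 * ∑ s ∈ Finset.range (n * B), e (t + s) := by
  have hc := fun i j => norm_sum_smul_sub_sum_smul_le (pow_le_transition hQ ht i)
    (pow_le_transition hQ ht j) (transition_row_sum hQ ht (n * B) i)
    (transition_row_sum hQ ht (n * B) j) (norm_sub_le_diam_range (z t))
  refine diam_range_le ?_ fun i j => ?_
  · exact add_nonneg ((norm_nonneg _).trans (hc i₀ i₀))
      (mul_nonneg zero_le_two (Finset.sum_nonneg fun s _ => he _))
  · have h1 := norm_sub_transition_le hQ hz ht (n * B) i
    have h2 := norm_sub_transition_le hQ hz ht (n * B) j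
    set a := ∑ k, transition Q.W t (n * B) i k • z t k
    set b := ∑ k, transition Q.W t (n * B) j k • z t k
    have h3 : z (t + n * B) i - z (t + n * B) j =
        (z (t + n * B) i - a) + (a - b) - (z (t + n * B) j - b) := by abel
    rw [h3]
    have h4 := norm_sub_le ((z (t + n * B) i - a) + (a - b)) (z (t + n * B) j - b)
    have h5 := norm_add_le (z (t + n * B) i - a) (a - b)
    linarith [hc i j]

/-- The disagreement of the agents is bounded by the perturbations of the consensus iteration. -/
theorem sum_diam_range_le (hn : 0 < n) (hQ : NetworkAssumption Q w B) {z : ℕ → Fin n → E}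
    {e : ℕ → ℝ} {R : ℝ} (he : ∀ t, 0 ≤ e t)
    (hz : ∀ t, 1 ≤ t → ∀ i, ‖z (t + 1) i - ∑ j, Q.W t i j • z t j‖ ≤ e t)
    (hR : ∀ t, 1 ≤ t → Metric.diam (range (z t)) ≤ R) (T : ℕ) :
    ∑ t ∈ Finset.Icc 1 T, Metric.diam (range (z t)) ≤
      (n * B : ℕ) / (n * w ^ (n * B)) * (R + 2 * ∑ t ∈ Finset.Icc 1 T, e t) := by
  set N := n * B with hN
  set D : ℕ → ℝ := fun t => Metric.diam (range (z t)) with hD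
  set S := ∑ t ∈ Finset.Icc 1 T, D t with hS
  set V := ∑ t ∈ Finset.Icc 1 T, e t with hSe
  have hDn : ∀ t, 0 ≤ D t := fun t => Metric.diam_nonneg
  have hSn : 0 ≤ S := Finset.sum_nonneg fun t _ => hDn t
  have hen : 0 ≤ V := Finset.sum_nonneg fun t _ => he t
  have hR0 : 0 ≤ R := (hDn 1).trans (hR 1 le_rfl)
  have hη : 0 < n * w ^ N := mul_pos (Nat.cast_pos.2 hn) (pow_pos hQ.w_pos N)
  have hlam : 0 ≤ 1 - n * w ^ N := by
    have h1 := Finset.sum_le_sum fun j (_ : j ∈ Finset.univ) =>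
      pow_le_transition hQ le_rfl (⟨0, hn⟩ : Fin n) j
    rw [transition_row_sum hQ le_rfl] at h1
    simp only [Finset.sum_const, Finset.card_univ, Fintype.card_fin, nsmul_eq_mul] at h1
    linarith
  -- The first `N` terms are bounded by `R`; every later one is compared with the term `N`
  -- iterations before. Solving for `S` then gives the bound. In the double sum, each perturbation
  -- is counted at most `N` times.
  have hmain : S ≤ N * R + (1 - n * w ^ N) * S + 2 * (N * V) := by
    rcases le_total T N with h | h
    · have h1 : S ≤ T * R := by
        have := Finset.sum_le_sum fun t (ht : t ∈ Finset.Icc 1 T) => hR t (Finset.mem_Icc.1 ht).1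
        simpa using this
      have h2 : (T : ℝ) * R ≤ N * R := by gcongr
      have h3 := mul_nonneg hlam hSn
      have h4 : 0 ≤ N * V := by positivity
      linarith
    · obtain ⟨m, rfl⟩ := Nat.exists_eq_add_of_le h
      have hIcc : ∀ k, Finset.Icc 1 k = Finset.Ico 1 (k + 1) := fun k => rfl
      have hsplit : S = ∑ t ∈ Finset.Icc 1 N, D t + ∑ t ∈ Finset.Icc 1 m, D (t + N) := by
        rw [hS, hIcc, hIcc, hIcc, Finset.sum_Ico_add' D 1 (m + 1) N,
          Finset.sum_congr (show Finset.Ico (1 + N) (m + 1 + N) = Finset.Ico (N + 1) (N + m + 1) by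
            congr 1 <;> omega) fun _ _ => rfl]
        exact (Finset.sum_Ico_consecutive D (by omega) (by omega)).symm
      have h1 : ∑ t ∈ Finset.Icc 1 N, D t ≤ N * R := by
        have := Finset.sum_le_sum fun t (ht : t ∈ Finset.Icc 1 N) => hR t (Finset.mem_Icc.1 ht).1
        simpa using this
      have h2 : ∑ t ∈ Finset.Icc 1 m, D (t + N) ≤ (1 - n * w ^ N) * ∑ t ∈ Finset.Icc 1 m, D t +
          2 * ∑ t ∈ Finset.Icc 1 m, ∑ s ∈ Finset.range N, e (t + s) := by
        rw [Finset.mul_sum, Finset.mul_sum, ← Finset.sum_add_distrib]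
        exact Finset.sum_le_sum fun t ht =>
          diam_range_add_le hQ he hz (Finset.mem_Icc.1 ht).1 ⟨0, hn⟩
      have h3 : ∑ t ∈ Finset.Icc 1 m, D t ≤ S :=
        Finset.sum_le_sum_of_subset_of_nonneg (Finset.Icc_subset_Icc le_rfl (by omega))
          fun t _ _ => hDn t
      have h4 : ∑ t ∈ Finset.Icc 1 m, ∑ s ∈ Finset.range N, e (t + s) ≤ N * V := by
        rw [Finset.sum_comm]
        have : ∀ s ∈ Finset.range N, ∑ t ∈ Finset.Icc 1 m, e (t + s) ≤ V := by
          intro s hs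
          have hs' := Finset.mem_range.1 hs
          rw [hIcc, Finset.sum_Ico_add' e 1 (m + 1) s]
          refine Finset.sum_le_sum_of_subset_of_nonneg (fun t ht => ?_) fun t _ _ => he t
          simp only [Finset.mem_Ico, Finset.mem_Icc] at ht ⊢
          omega
        simpa using Finset.sum_le_sum this
      have h5 := mul_le_mul_of_nonneg_left h3 hlam
      linarith
  rw [div_mul_eq_mul_div, le_div_iff₀ hη]
  linarith

end Consensus

/-! ### Projections and shrunken domains -/

section Geometry

variable {p : ℕ} {X K : Set (Vec p)} {r R : ℝ}

theorem inner_sub_proj_le_zero (hne : K.Nonempty) (hcl : IsClosed K) (hconv : Convex ℝ K)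
    (x : Vec p) {y : Vec p} (hy : y ∈ K) : inner ℝ (x - proj K x) (y - proj K x) ≤ 0 := by
  obtain ⟨hmem, hmin⟩ := proj_isNearest hne hcl x
  refine (norm_eq_iInf_iff_real_inner_le_zero hconv hmem).1 ?_ y hy
  have : Nonempty K := hne.to_subtype
  refine le_antisymm (le_ciInf fun w => hmin w w.2) ?_
  exact ciInf_le ⟨0, by rintro _ ⟨w, rfl⟩; exact norm_nonneg _⟩ (⟨proj K x, hmem⟩ : K)

theorem proj_eq_self (hcl : IsClosed K) {x : Vec p} (hx : x ∈ K) : proj K x = x := by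
  have h := (proj_isNearest ⟨x, hx⟩ hcl x).2 x hx
  rw [sub_self, norm_zero] at h
  exact (sub_eq_zero.1 (norm_le_zero_iff.1 h)).symm

theorem lipschitzWith_proj (hne : K.Nonempty) (hcl : IsClosed K) (hconv : Convex ℝ K) :
    LipschitzWith 1 (proj K) := by
  refine LipschitzWith.of_dist_le_mul fun x y => ?_
  rw [NNReal.coe_one, one_mul, dist_eq_norm, dist_eq_norm]
  have h1 := inner_sub_proj_le_zero hne hcl hconv x (proj_isNearest hne hcl y).1
  have h2 := inner_sub_proj_le_zero hne hcl hconv y (proj_isNearest hne hcl x).1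
  set a := proj K x
  set b := proj K y
  have h3 : ‖a - b‖ ^ 2 ≤ inner ℝ (x - y) (a - b) := by
    have : inner ℝ (x - y) (a - b) =
        ‖a - b‖ ^ 2 - inner ℝ (x - a) (b - a) - inner ℝ (y - b) (a - b) := by
      rw [← real_inner_self_eq_norm_sq, ← neg_sub a b, inner_neg_right, sub_neg_eq_add,
        ← inner_add_left, ← inner_sub_left]
      congr 1
      abel
    linarith
  have h4 := real_inner_le_norm (x - y) (a - b)
  by_contra! hlt
  nlinarith [norm_nonneg (x - y), norm_nonneg (a - b)]

namespace BanditOCO.DomainAssumption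

variable (hX : DomainAssumption X r R)
include hX

theorem zero_mem : (0 : Vec p) ∈ X := hX.ball_subset (by simpa using hX.r_pos.le)

theorem norm_le {x : Vec p} (hx : x ∈ X) : ‖x‖ ≤ R := by simpa using hX.subset_ball hx

theorem R_nonneg : 0 ≤ R := by simpa using hX.norm_le hX.zero_mem

theorem norm_sub_le {x y : Vec p} (hx : x ∈ X) (hy : y ∈ X) : ‖x - y‖ ≤ 2 * R := by
  linarith [_root_.norm_sub_le x y, hX.norm_le hx, hX.norm_le hy]

theorem isCompact : IsCompact X :=
  (isCompact_closedBall (0 : Vec p) R).of_isClosed_subset hX.closed hX.subset_ball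

theorem isClosed_shrink (ξ : ℝ) : IsClosed ((1 - ξ) • X) :=
  (hX.isCompact.smul (1 - ξ)).isClosed

theorem convex_shrink (ξ : ℝ) : Convex ℝ ((1 - ξ) • X) := hX.convex.smul _

theorem zero_mem_shrink (ξ : ℝ) : (0 : Vec p) ∈ (1 - ξ) • X :=
  ⟨0, hX.zero_mem, by simp⟩

theorem shrink_subset {ξ ξ' : ℝ} (h : ξ' ≤ ξ) (h' : ξ ≤ 1) : (1 - ξ) • X ⊆ (1 - ξ') • X := by
  rintro _ ⟨x, hx, rfl⟩
  rcases (sub_nonneg.2 h').eq_or_lt with h0 | hpos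
  · simpa [← h0] using hX.zero_mem_shrink ξ'
  · have hpos' : 0 < 1 - ξ' := by linarith
    refine ⟨((1 - ξ) / (1 - ξ')) • x, ?_, ?_⟩
    · have hle : (1 - ξ) / (1 - ξ') ≤ 1 := by rw [div_le_one hpos']; linarith
      exact hX.convex.smul_mem_of_zero_mem hX.zero_mem hx ⟨by positivity, hle⟩
    · simp only [smul_smul, mul_div_cancel₀ _ hpos'.ne']

theorem shrink_subset_self {ξ : ℝ} (h₀ : 0 ≤ ξ) (h₁ : ξ ≤ 1) : (1 - ξ) • X ⊆ X := by
  simpa using hX.shrink_subset h₀ h₁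

/-- The choice `δ = r ξ` makes the query point a convex combination of a point of `X` and `r • u`,
which lies in the inscribed ball. -/
theorem add_smul_mem {ξ : ℝ} (h₀ : 0 ≤ ξ) (h₁ : ξ ≤ 1) {x u : Vec p} (hx : x ∈ (1 - ξ) • X)
    (hu : u ∈ Metric.sphere (0 : Vec p) 1) : x + (r * ξ) • u ∈ X := by
  obtain ⟨x', hx', rfl⟩ := hx
  have hru : r • u ∈ X := by
    refine hX.ball_subset ?_
    rw [mem_closedBall_zero_iff, norm_smul, mem_sphere_zero_iff_norm.1 hu,
      Real.norm_of_nonneg hX.r_pos.le, mul_one]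
  have := hX.convex hx' hru (sub_nonneg.2 h₁) h₀ (by ring)
  rwa [smul_smul, mul_comm ξ r] at this

theorem proj_mem (ξ : ℝ) (v : Vec p) : proj ((1 - ξ) • X) v ∈ (1 - ξ) • X :=
  (proj_isNearest ⟨0, hX.zero_mem_shrink ξ⟩ (hX.isClosed_shrink ξ) v).1

theorem lipschitzWith_proj_shrink (ξ : ℝ) : LipschitzWith 1 (proj ((1 - ξ) • X)) :=
  lipschitzWith_proj ⟨0, hX.zero_mem_shrink ξ⟩ (hX.isClosed_shrink ξ) (hX.convex_shrink ξ)

theorem lipschitzWith_proj : LipschitzWith 1 (proj X) :=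
  _root_.lipschitzWith_proj ⟨0, hX.zero_mem⟩ hX.closed hX.convex

theorem norm_proj_sub_le (ξ : ℝ) {x v : Vec p} (hx : x ∈ (1 - ξ) • X) :
    ‖proj ((1 - ξ) • X) v - x‖ ≤ ‖v - x‖ := by
  have h := (hX.lipschitzWith_proj_shrink ξ).dist_le_mul v x
  rwa [proj_eq_self (hX.isClosed_shrink ξ) hx, NNReal.coe_one, one_mul, dist_eq_norm,
    dist_eq_norm] at h

/-- Projecting onto a shrunken set increases the distance to a point of the set only slightly. -/
theorem norm_proj_sub_sq_le (ξ : ℝ) {v y : Vec p} (hy : y ∈ X) :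
    ‖proj ((1 - ξ) • X) v - y‖ ^ 2 ≤ ‖v - y‖ ^ 2 + ξ ^ 2 * R ^ 2 := by
  have h1 := inner_sub_proj_le_zero ⟨0, hX.zero_mem_shrink ξ⟩ (hX.isClosed_shrink ξ)
    (hX.convex_shrink ξ) v (smul_mem_smul_set (a := 1 - ξ) hy)
  set z := proj ((1 - ξ) • X) v
  have h2 : ‖v - y‖ ^ 2 = ‖v - z‖ ^ 2 + 2 * inner ℝ (v - z) (z - y) + ‖z - y‖ ^ 2 := by
    rw [← norm_add_sq_real, sub_add_sub_cancel]
  have h3 : inner ℝ (v - z) (z - y) =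
      -inner ℝ (v - z) ((1 - ξ) • y - z) - inner ℝ (v - z) (ξ • y) := by
    rw [← inner_neg_right, ← inner_sub_right]
    congr 1
    module
  -- The variational inequality is available at `(1 - ξ) • y` only. The defect `2 ξ ⟨v - z, y⟩` is
  -- absorbed by the term `‖v - z‖ ^ 2` of the projection, so the loss is quadratic in `ξ`.
  have h4 : 0 ≤ ‖(v - z) - ξ • y‖ ^ 2 := sq_nonneg _
  rw [norm_sub_sq_real, norm_smul, mul_pow, Real.norm_eq_abs, sq_abs] at h4
  have h5 : ξ ^ 2 * ‖y‖ ^ 2 ≤ ξ ^ 2 * R ^ 2 := by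
    gcongr
    exact hX.norm_le hy
  linarith

end BanditOCO.DomainAssumption

end Geometry

/-! ### Lipschitz bounds and positive parts -/

section Subgradients

variable {p : ℕ} {X : Set (Vec p)} {h : Vec p → ℝ} {L : ℝ}

theorem sub_le_mul_norm_of_subgradient (hs : ∀ x ∈ X, ∃ s, IsSubgradient X h x s ∧ ‖s‖ ≤ L)
    {x y : Vec p} (hx : x ∈ X) (hy : y ∈ X) : h x - h y ≤ L * ‖x - y‖ := by
  obtain ⟨s, hs1, hs2⟩ := hs x hx
  have h1 := hs1 y hy
  have h2 := (abs_le.1 (abs_real_inner_le_norm s (y - x))).1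
  rw [norm_sub_rev y x] at h2
  have h3 : ‖s‖ * ‖x - y‖ ≤ L * ‖x - y‖ := by gcongr
  linarith

theorem abs_sub_le_mul_norm_of_subgradient
    (hs : ∀ x ∈ X, ∃ s, IsSubgradient X h x s ∧ ‖s‖ ≤ L)
    {x y : Vec p} (hx : x ∈ X) (hy : y ∈ X) : |h x - h y| ≤ L * ‖x - y‖ := by
  refine abs_sub_le_iff.2 ⟨sub_le_mul_norm_of_subgradient hs hx hy, ?_⟩
  rw [norm_sub_rev]
  exact sub_le_mul_norm_of_subgradient hs hy hx

theorem continuousOn_of_subgradient (hs : ∀ x ∈ X, ∃ s, IsSubgradient X h x s ∧ ‖s‖ ≤ L) :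
    ContinuousOn h X := by
  refine LipschitzOnWith.continuousOn (K := L.toNNReal) (LipschitzOnWith.of_dist_le_mul ?_)
  intro x hx y hy
  rw [Real.coe_toNNReal _ (nonneg_of_subgradient hx hs), Real.dist_eq, dist_eq_norm]
  exact abs_sub_le_mul_norm_of_subgradient hs hx hy

theorem norm_gradEst_le (hs : ∀ x ∈ X, ∃ s, IsSubgradient X h x s ∧ ‖s‖ ≤ L) {δ : ℝ} (hδ : 0 < δ)
    {x u : Vec p} (hx : x ∈ X) (hu : ‖u‖ = 1) (hxu : x + δ • u ∈ X) :
    ‖gradEst h δ x u‖ ≤ p * L := by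
  have h1 := abs_sub_le_mul_norm_of_subgradient hs hxu hx
  rw [add_sub_cancel_left, norm_smul, hu, Real.norm_of_nonneg hδ.le, mul_one] at h1
  rw [gradEst, norm_smul, hu, mul_one, norm_mul, norm_div, Real.norm_of_nonneg hδ.le,
    Real.norm_natCast, Real.norm_eq_abs]
  calc (p : ℝ) / δ * |h (x + δ • u) - h x| ≤ p / δ * (L * δ) := by gcongr
    _ = p * L := by field_simp

variable {m : ℕ} {g : Vec p → EuclideanSpace ℝ (Fin m)} {G : ℝ}

theorem inner_eq_sum_mul {ι : Type*} [Fintype ι] (a b : EuclideanSpace ℝ ι) :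
    inner ℝ a b = ∑ k, a k * b k := by
  simp [PiLp.inner_apply, mul_comm]

/-- A nonnegative combination of the components has subgradients. -/
theorem exists_subgradient_inner
    (hs : ∀ x ∈ X, ∃ D, IsVecSubgradient X g x D ∧ ‖D‖ ≤ G) {q : EuclideanSpace ℝ (Fin m)}
    (hq : ∀ k, 0 ≤ q k) :
    ∀ x ∈ X, ∃ s, IsSubgradient X (fun y => inner ℝ q (g y)) x s ∧ ‖s‖ ≤ G * ‖q‖ := by
  intro x hx
  obtain ⟨D, h1, h2⟩ := hs x hx
  refine ⟨ContinuousLinearMap.adjoint D q, fun y hy => ?_, ?_⟩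
  · rw [ContinuousLinearMap.adjoint_inner_left, ← inner_add_right, inner_eq_sum_mul]
    beta_reduce
    rw [inner_eq_sum_mul]
    exact Finset.sum_le_sum fun k _ => mul_le_mul_of_nonneg_left (h1 y hy k) (hq k)
  · refine ((ContinuousLinearMap.adjoint D).le_opNorm q).trans ?_
    rw [LinearIsometryEquiv.norm_map]
    gcongr

theorem exists_subgradient_apply
    (hs : ∀ x ∈ X, ∃ D, IsVecSubgradient X g x D ∧ ‖D‖ ≤ G) (k : Fin m) :
    ∀ x ∈ X, ∃ s, IsSubgradient X (fun y => g y k) x s ∧ ‖s‖ ≤ G := by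
  have := exists_subgradient_inner hs (q := EuclideanSpace.single k 1)
    (fun j => by simp only [PiLp.single_apply]; split_ifs <;> simp)
  simpa [inner_eq_sum_mul, PiLp.single_apply] using this

theorem continuousOn_of_vecSubgradient
    (hs : ∀ x ∈ X, ∃ D, IsVecSubgradient X g x D ∧ ‖D‖ ≤ G) : ContinuousOn g X := by
  have h1 : ContinuousOn (fun x => WithLp.toLp 2 fun k => g x k) X :=
    (PiLp.continuous_toLp 2 _).comp_continuousOn
      (continuousOn_pi.2 fun k => continuousOn_of_subgradient (exists_subgradient_apply hs k))
  exact h1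

theorem clip_nonneg {ι : Type} [Fintype ι] (v : EuclideanSpace ℝ ι) (k : ι) : 0 ≤ clip v k :=
  le_max_right _ _

theorem inner_clip_self {ι : Type} [Fintype ι] (v : EuclideanSpace ℝ ι) :
    inner ℝ (clip v) v = ‖clip v‖ ^ 2 := by
  rw [← real_inner_self_eq_norm_sq, inner_eq_sum_mul, inner_eq_sum_mul]
  refine Finset.sum_congr rfl fun k _ => ?_
  simp only [clip]
  rcases le_total (v k) 0 with h | h <;> simp [h]

theorem inner_clip_le {ι : Type} [Fintype ι] (a v : EuclideanSpace ℝ ι) :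
    inner ℝ (clip a) v ≤ ‖clip a‖ * ‖clip v‖ := by
  refine le_trans ?_ (real_inner_le_norm _ _)
  rw [inner_eq_sum_mul, inner_eq_sum_mul]
  exact Finset.sum_le_sum fun k _ => mul_le_mul_of_nonneg_left (le_max_left _ _) (clip_nonneg a k)

theorem continuous_clip {ι : Type} [Fintype ι] :
    Continuous (clip : EuclideanSpace ℝ ι → EuclideanSpace ℝ ι) := by
  unfold clip
  fun_prop

/-- Test `g` against `q = [g x]₊`: `⟨q, g x⟩ = ‖q‖ ^ 2` while `⟨q, g y⟩ ≤ ‖q‖ * ‖[g y]₊‖`, and `⟨q,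
g⟩` has subgradients bounded by `G * ‖q‖`. Cancelling `‖q‖` gives a bound free of the number of
constraints. -/
theorem norm_clip_le_add (hs : ∀ x ∈ X, ∃ D, IsVecSubgradient X g x D ∧ ‖D‖ ≤ G) {x y : Vec p}
    (hx : x ∈ X) (hy : y ∈ X) : ‖clip (g x)‖ ≤ ‖clip (g y)‖ + G * ‖x - y‖ := by
  have h1 := sub_le_mul_norm_of_subgradient
    (exists_subgradient_inner hs (clip_nonneg (g x))) hx hy
  rw [inner_clip_self] at h1
  have h2 := inner_clip_le (g x) (g y)
  by_contra! hlt
  have h3 : 0 ≤ ‖clip (g y)‖ + G * ‖x - y‖ := by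
    obtain ⟨D, -, hD⟩ := hs x hx
    have : 0 ≤ G := (norm_nonneg D).trans hD
    positivity
  nlinarith

theorem norm_clip_le_sum_abs {ι : Type} [Fintype ι] (v : EuclideanSpace ℝ ι) :
    ‖clip v‖ ≤ ∑ k, clip v k := by
  refine le_of_sq_le_sq ?_ (Finset.sum_nonneg fun k _ => clip_nonneg v k)
  rw [EuclideanSpace.norm_sq_eq, sq, Finset.sum_mul]
  refine Finset.sum_le_sum fun k _ => ?_
  rw [Real.norm_eq_abs, sq_abs, sq]
  exact mul_le_mul_of_nonneg_left (Finset.single_le_sum (fun j _ => clip_nonneg v j)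
    (Finset.mem_univ k)) (clip_nonneg v k)

/-- Slater's condition gives a multiple of the `ℓ¹` norm of the positive part, which dominates the
Euclidean norm with constant `1`. -/
theorem inner_clip_le_neg_mul {ι : Type} [Fintype ι] (a : EuclideanSpace ℝ ι)
    {v : EuclideanSpace ℝ ι} {σ : ℝ} (hσ : 0 ≤ σ) (hv : ∀ k, v k ≤ -σ) :
    inner ℝ (clip a) v ≤ -(σ * ‖clip a‖) := by
  have h1 : inner ℝ (clip a) v ≤ ∑ k, clip a k * -σ := by
    rw [inner_eq_sum_mul]
    exact Finset.sum_le_sum fun k _ => mul_le_mul_of_nonneg_left (hv k) (clip_nonneg a k)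
  rw [← Finset.sum_mul] at h1
  nlinarith [norm_clip_le_sum_abs a]

theorem norm_clip_globalConstraint_le {n : ℕ} (Q : Problem n p) (t : ℕ) (x : Vec p) :
    ‖clip (Q.globalConstraint t x)‖ ≤ ∑ i, ‖clip (Q.g i t x)‖ := by
  refine le_of_sq_le_sq ?_ (Finset.sum_nonneg fun k _ => norm_nonneg _)
  have h1 : ‖clip (Q.globalConstraint t x)‖ ^ 2 = ∑ i, ‖clip (Q.g i t x)‖ ^ 2 := by
    simp only [EuclideanSpace.norm_sq_eq, Fintype.sum_sigma]
    rfl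
  rw [h1, sq, Finset.sum_mul]
  refine Finset.sum_le_sum fun k _ => ?_
  rw [sq]
  exact mul_le_mul_of_nonneg_left (Finset.single_le_sum (f := fun i => ‖clip (Q.g i t x)‖)
    (fun j _ => norm_nonneg _) (Finset.mem_univ k)) (norm_nonneg _)

end Subgradients

/-! ### One iteration of one agent -/

section Step

/-- The step sizes `t ^ (-c)`. -/
noncomputable def stepSize (c : ℝ) (t : ℕ) : ℝ := 1 / (t : ℝ) ^ c

section StepSize

variable {c : ℝ} {t : ℕ}

theorem stepSize_pos (ht : 1 ≤ t) : 0 < stepSize c t := by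
  have : (0 : ℝ) < t := by exact_mod_cast ht
  unfold stepSize
  positivity

theorem stepSize_le_one (hc : 0 < c) (ht : 1 ≤ t) : stepSize c t ≤ 1 := by
  have h1 : (1 : ℝ) ≤ t := by exact_mod_cast ht
  have := Real.one_le_rpow h1 hc.le
  rw [stepSize, div_le_one (by positivity)]
  exact this

theorem stepSize_succ_le (hc : 0 < c) (ht : 1 ≤ t) : stepSize c (t + 1) ≤ stepSize c t := by
  have h1 : (1 : ℝ) ≤ t := by exact_mod_cast ht
  unfold stepSize
  gcongr
  simp

end StepSize

variable {n p : ℕ} {Q : Problem n p} {c γ₀ r R F G₁ G₂ w μ : ℝ} {B : ℕ}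

theorem powerParams_gamma (t : ℕ) : (powerParams c γ₀ r).γ t = γ₀ / stepSize c t := rfl

theorem powerParams_delta (t : ℕ) : (powerParams c γ₀ r).δ t = r * stepSize c t := rfl

/-- With `q` frozen at its value at `x`, the matrix estimator applied to `q` is the scalar estimator
of `⟨q, g⟩`. As `q ≥ 0`, this function inherits subgradients from `g`. -/
theorem direction_eq (Q : Problem n p) (s : Params) (t : ℕ) (i : Fin n) (x u : Vec p) :
    direction Q s t i x u = gradEst (Q.f i t) (s.δ t) x u +
      gradEst (fun y => inner ℝ (dual Q s t i x) (Q.g i t y)) (s.δ t) x u := by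
  rw [direction]
  congr 1
  ext a
  simp only [vecGradEst, gradEst, Matrix.mulVec, dotProduct, Matrix.smul_apply,
    Matrix.vecMulVec_apply, smul_eq_mul, PiLp.smul_apply, ← inner_sub_right]
  rw [inner_eq_sum_mul, Finset.mul_sum, Finset.sum_mul]
  exact Finset.sum_congr rfl fun k _ => by ring

theorem norm_dual {s : Params} {t : ℕ} (hγ : 0 ≤ s.γ t) (i : Fin n) (x : Vec p) :
    ‖dual Q s t i x‖ = s.γ t * ‖clip (Q.g i t x)‖ := by
  rw [dual, norm_smul, Real.norm_of_nonneg hγ]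

theorem dual_nonneg {s : Params} {t : ℕ} (hγ : 0 ≤ s.γ t) (i : Fin n) (x : Vec p)
    (k : Fin (Q.m i)) : 0 ≤ dual Q s t i x k :=
  mul_nonneg hγ (clip_nonneg _ k)

variable {t : ℕ} {i : Fin n} {x y : Vec p}

theorem exists_subgradient_dual (hF : FunctionAssumption Q F G₁ G₂) {s : Params} (ht : 1 ≤ t)
    (hγ : 0 ≤ s.γ t) (i : Fin n) (x : Vec p) :
    ∀ z ∈ Q.X, ∃ v, IsSubgradient Q.X (fun y => inner ℝ (dual Q s t i x) (Q.g i t y)) z v ∧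
      ‖v‖ ≤ G₂ * (s.γ t * ‖clip (Q.g i t x)‖) := by
  rw [← norm_dual hγ]
  exact exists_subgradient_inner (hF.constraint_subgradient i t ht) (dual_nonneg hγ i x)

theorem norm_direction_le (hF : FunctionAssumption Q F G₁ G₂) {s : Params} (ht : 1 ≤ t)
    (hγ : 0 ≤ s.γ t) (hδ : 0 < s.δ t) (hx : x ∈ Q.X) {u : Vec p} (hu : ‖u‖ = 1)
    (hxu : x + s.δ t • u ∈ Q.X) :
    ‖direction Q s t i x u‖ ≤ p * G₁ + p * G₂ * (s.γ t * ‖clip (Q.g i t x)‖) := by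
  rw [direction_eq]
  refine (norm_add_le _ _).trans (add_le_add ?_ ?_)
  · exact norm_gradEst_le (hF.loss_subgradient i t ht) hδ hx hu hxu
  · rw [mul_assoc]
    exact norm_gradEst_le (exists_subgradient_dual hF ht hγ i x) hδ hx hu hxu

theorem integrable_inner_gradEst [NeZero p] {X : Set (Vec p)} {h : Vec p → ℝ} {L δ : ℝ}
    (hs : ∀ x ∈ X, ∃ s, IsSubgradient X h x s ∧ ‖s‖ ≤ L)
    (hu : ∀ u ∈ Metric.sphere (0 : Vec p) 1, x + δ • u ∈ X) (v : Vec p) :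
    Integrable (fun u : Metric.sphere (0 : Vec p) 1 => inner ℝ (gradEst h δ x u) v)
      (sphereUniform p) := by
  have h1 : Continuous fun u : Metric.sphere (0 : Vec p) 1 => h (x + δ • (u : Vec p)) :=
    (continuousOn_of_subgradient hs).comp_continuous (by fun_prop) fun u => hu u u.2
  have h2 : Continuous fun u : Metric.sphere (0 : Vec p) 1 => inner ℝ (gradEst h δ x u) v :=
    (((h1.sub continuous_const).const_mul _).smul continuous_subtype_val).inner continuous_const
  exact h2.integrable_of_hasCompactSupport (HasCompactSupport.of_compactSpace _)

/-- The accumulated constant of the expected progress of one iteration. -/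
noncomputable def progressConst (p : ℕ) (γ₀ r R G₁ G₂ μ : ℝ) : ℝ :=
  2 * p ^ 2 * G₁ ^ 2 + R ^ 2 + 2 * r * (2 * (G₁ + μ * R) + p * μ * R) + 8 * γ₀ * G₂ ^ 2 * r ^ 2

variable (hS : StandingAssumptions Q r R F G₁ G₂ w B μ) (hc : 0 < c) (hγ₀ : 0 < γ₀)
  (ht : 1 ≤ t) (hx : x ∈ (1 - stepSize c t) • Q.X)
include hS hc ht

theorem mem_X_of_mem_shrink (hx : x ∈ (1 - stepSize c t) • Q.X) : x ∈ Q.X :=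
  hS.domain.shrink_subset_self (stepSize_pos ht).le (stepSize_le_one hc ht) hx

include hγ₀ hx

/-- Since `α_t γ_t = γ₀`, the penalty part of the step is proportional to the violation and does not
carry a factor `α_t`. -/
theorem stepSize_mul_norm_direction_le {u : Vec p} (hu : u ∈ Metric.sphere (0 : Vec p) 1) :
    ‖stepSize c t • direction Q (powerParams c γ₀ r) t i x u‖ ≤
      p * G₁ * stepSize c t + p * G₂ * γ₀ * ‖clip (Q.g i t x)‖ := by
  have ha := stepSize_pos (c := c) ht
  have h := norm_direction_le (i := i) (s := powerParams c γ₀ r) hS.functions ht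
    (div_nonneg hγ₀.le ha.le) (mul_pos hS.domain.r_pos ha) (mem_X_of_mem_shrink hS hc ht hx)
    (mem_sphere_zero_iff_norm.1 hu)
    (hS.domain.add_smul_mem ha.le (stepSize_le_one hc ht) hx hu)
  rw [powerParams_gamma] at h
  rw [norm_smul, Real.norm_of_nonneg ha.le]
  refine (mul_le_mul_of_nonneg_left h ha.le).trans_eq ?_
  field_simp

/-- The sets `(1 - ξ_t) • X` grow with `t`, so `x` is fixed by the projection onto the next one and
nonexpansiveness bounds the move. -/
theorem norm_primal_sub_le {u : Vec p} (hu : u ∈ Metric.sphere (0 : Vec p) 1) :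
    ‖primal Q (powerParams c γ₀ r) t i x u - x‖ ≤
      p * G₁ * stepSize c t + p * G₂ * γ₀ * ‖clip (Q.g i t x)‖ := by
  have hx' : x ∈ (1 - stepSize c (t + 1)) • Q.X :=
    hS.domain.shrink_subset (stepSize_succ_le hc ht) (stepSize_le_one hc ht) hx
  refine (hS.domain.norm_proj_sub_le _ hx').trans ?_
  rw [sub_sub_cancel_left, norm_neg]
  exact stepSize_mul_norm_direction_le hS hc hγ₀ ht hx hu

theorem norm_primal_sub_sq_le (hγ : γ₀ * (4 * ((p : ℝ) ^ 2 + 1) * G₂ ^ 2) ≤ 1) (hy : y ∈ Q.X)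
    {u : Vec p} (hu : u ∈ Metric.sphere (0 : Vec p) 1) :
    ‖primal Q (powerParams c γ₀ r) t i x u - y‖ ^ 2 ≤ ‖x - y‖ ^ 2 -
      2 * stepSize c t * inner ℝ (direction Q (powerParams c γ₀ r) t i x u) (x - y) +
      (2 * p ^ 2 * G₁ ^ 2 + R ^ 2) * stepSize c t ^ 2 + γ₀ / 2 * ‖clip (Q.g i t x)‖ ^ 2 := by
  have h1 := hS.domain.norm_proj_sub_sq_le (stepSize c (t + 1)) (y := y)
    (v := x - stepSize c t • direction Q (powerParams c γ₀ r) t i x u) hy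
  have h2 := stepSize_mul_norm_direction_le (i := i) hS hc hγ₀ ht hx hu
  have h3 : stepSize c (t + 1) ^ 2 * R ^ 2 ≤ stepSize c t ^ 2 * R ^ 2 := by
    have := stepSize_succ_le hc ht
    have := stepSize_pos (c := c) (show 1 ≤ t + 1 by omega)
    gcongr
  set a := stepSize c t
  set d := direction Q (powerParams c γ₀ r) t i x u
  set G := ‖clip (Q.g i t x)‖
  have h4 : ‖x - a • d - y‖ ^ 2 = ‖x - y‖ ^ 2 - 2 * a * inner ℝ d (x - y) + ‖a • d‖ ^ 2 := by
    rw [sub_right_comm, norm_sub_sq_real, real_inner_smul_right, real_inner_comm]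
    ring
  have h5 : ‖a • d‖ ^ 2 ≤ 2 * (p * G₁ * a) ^ 2 + 2 * (p * G₂ * γ₀ * G) ^ 2 := by
    have h6 := pow_le_pow_left₀ (norm_nonneg _) h2 2
    linarith [sq_nonneg (p * G₁ * a - p * G₂ * γ₀ * G)]
  -- Here the smallness of `γ₀` enters.
  have h7 : 2 * (p * G₂ * γ₀ * G) ^ 2 ≤ γ₀ / 2 * G ^ 2 := by
    have h8 : γ₀ * (4 * (p : ℝ) ^ 2 * G₂ ^ 2) ≤ 1 := by
      have : 0 ≤ γ₀ * (4 * G₂ ^ 2) := by positivity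
      linarith
    have := mul_le_mul_of_nonneg_right h8 (by positivity : 0 ≤ γ₀ / 2 * G ^ 2)
    linarith
  have h9 : primal Q (powerParams c γ₀ r) t i x u = proj ((1 - stepSize c (t + 1)) • Q.X)
    (x - a • d) := rfl
  rw [h9]
  linarith

/-- The expected direction at `x` is an approximate subgradient of the penalized loss. -/
theorem le_integral_inner_direction [NeZero p] (hμ : 0 ≤ μ) (hy : y ∈ Q.X) :
    Integrable (fun u : Metric.sphere (0 : Vec p) 1 =>
      inner ℝ (direction Q (powerParams c γ₀ r) t i x u) (x - y)) (sphereUniform p) ∧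
    stepSize c t * (Q.f i t x - Q.f i t y + μ / 2 * ‖x - y‖ ^ 2 -
        (2 * (G₁ + μ * R) + p * μ * R) * (r * stepSize c t)) +
      γ₀ * (‖clip (Q.g i t x)‖ ^ 2 - inner ℝ (clip (Q.g i t x)) (Q.g i t y)) -
      2 * (G₂ * (γ₀ * ‖clip (Q.g i t x)‖)) * (r * stepSize c t) ≤
    stepSize c t * ∫ u : Metric.sphere (0 : Vec p) 1,
      inner ℝ (direction Q (powerParams c γ₀ r) t i x u) (x - y) ∂sphereUniform p := by
  have ha := stepSize_pos (c := c) ht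
  have hxX := mem_X_of_mem_shrink hS hc ht hx
  have hδ : 0 < r * stepSize c t := mul_pos hS.domain.r_pos ha
  have hu : ∀ u ∈ Metric.sphere (0 : Vec p) 1, x + (r * stepSize c t) • u ∈ Q.X := fun u hu =>
    hS.domain.add_smul_mem ha.le (stepSize_le_one hc ht) hx hu
  have hγn : 0 ≤ (powerParams c γ₀ r).γ t := div_nonneg hγ₀.le ha.le
  have hsf := hS.functions.loss_subgradient i t ht
  have hsg := exists_subgradient_dual hS.functions ht hγn i x
  have hif := integrable_inner_gradEst hsf hu (x - y)
  have hig := integrable_inner_gradEst hsg hu (x - y)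
  have h1 := le_integral_gradEst_of_strong hsf hμ (hS.strong i t ht) hS.domain.subset_ball hδ hxX
    hy hu
  have h2 := le_integral_gradEst hsg hδ hxX hy hu
  simp only [direction_eq, inner_add_left, powerParams_delta]
  refine ⟨hif.add hig, ?_⟩
  rw [integral_add hif hig]
  have h3 := mul_le_mul_of_nonneg_left (add_le_add h1 h2) ha.le
  refine le_trans (le_of_eq ?_) h3
  simp only [dual, real_inner_smul_left, inner_clip_self, powerParams_gamma]
  field_simp
  ring

/-- The expected progress of one iteration towards `y`. -/
theorem integral_norm_primal_sub_sq_le [NeZero p] (hμ : 0 ≤ μ)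
    (hγ : γ₀ * (4 * ((p : ℝ) ^ 2 + 1) * G₂ ^ 2) ≤ 1) (hy : y ∈ Q.X)
    (hint : Integrable (fun u : Metric.sphere (0 : Vec p) 1 =>
      ‖primal Q (powerParams c γ₀ r) t i x u - y‖ ^ 2) (sphereUniform p)) :
    ∫ u : Metric.sphere (0 : Vec p) 1, ‖primal Q (powerParams c γ₀ r) t i x u - y‖ ^ 2
        ∂sphereUniform p ≤
      (1 - stepSize c t * μ) * ‖x - y‖ ^ 2 - 2 * stepSize c t * (Q.f i t x - Q.f i t y) -
      γ₀ * ‖clip (Q.g i t x)‖ ^ 2 + 2 * γ₀ * inner ℝ (clip (Q.g i t x)) (Q.g i t y) +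
      progressConst p γ₀ r R G₁ G₂ μ * stepSize c t ^ 2 := by
  obtain ⟨hi, h1⟩ := le_integral_inner_direction (i := i) hS hc hγ₀ ht hx hμ hy
  have h2 := integral_mono hint ((((integrable_const (‖x - y‖ ^ 2)).sub
    (hi.const_mul (2 * stepSize c t))).add
    (integrable_const ((2 * p ^ 2 * G₁ ^ 2 + R ^ 2) * stepSize c t ^ 2))).add
    (integrable_const (γ₀ / 2 * ‖clip (Q.g i t x)‖ ^ 2)))
    (fun u => norm_primal_sub_sq_le hS hc hγ₀ ht hx hγ hy u.2)
  rw [integral_add' (((integrable_const _).sub (hi.const_mul _)).add (integrable_const _))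
    (integrable_const _), integral_add' ((integrable_const _).sub (hi.const_mul _))
    (integrable_const _), integral_sub' (integrable_const _) (hi.const_mul _),
    integral_const_mul] at h2
  simp only [integral_const, probReal_univ, one_smul] at h2
  -- Of the gain `2 γ₀ ‖[g]₊‖ ^ 2`, one quarter pays for the squared step and one quarter, by
  -- Young's inequality, for the estimator error of the penalty; `γ₀ ‖[g]₊‖ ^ 2` remains.
  have h3 : 4 * (G₂ * (γ₀ * ‖clip (Q.g i t x)‖)) * (r * stepSize c t) ≤
      γ₀ / 2 * ‖clip (Q.g i t x)‖ ^ 2 + 8 * γ₀ * G₂ ^ 2 * r ^ 2 * stepSize c t ^ 2 := by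
    have := mul_nonneg hγ₀.le (sq_nonneg (‖clip (Q.g i t x)‖ - 4 * G₂ * r * stepSize c t))
    linarith
  unfold progressConst
  linarith

end Step

/-! ### Measurability and independence -/

section Random

variable {n p : ℕ} {Q : Problem n p} {c γ₀ r R F G₁ G₂ w μ : ℝ} {B : ℕ}

/-- The problem whose functions are extended continuously from `X` to the whole space. -/
noncomputable def BanditOCO.Problem.extend (Q : Problem n p) : Problem n p :=
  { Q with
    f := fun i t x => Q.f i t (proj Q.X x)
    g := fun i t x => Q.g i t (proj Q.X x) }

/-- The functions are arbitrary outside `X`, so the update need not be measurable as a map on the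
whole space. All queries stay in `X`, where the continuous extension gives the same update. -/
theorem primal_extend_eq (hX : IsClosed Q.X) (s : Params) (t : ℕ) (i : Fin n) {x u : Vec p}
    (hx : x ∈ Q.X) (hxu : x + s.δ t • u ∈ Q.X) :
    primal Q.extend s t i x u = primal Q s t i x u := by
  have h1 := proj_eq_self hX hx
  have h2 := proj_eq_self hX hxu
  simp only [primal, direction, vecGradEst, gradEst, dual, BanditOCO.Problem.extend, h1, h2]
  rfl

theorem continuous_loss_proj (hS : StandingAssumptions Q r R F G₁ G₂ w B μ) {t : ℕ} (ht : 1 ≤ t)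
    (i : Fin n) : Continuous fun x => Q.f i t (proj Q.X x) :=
  (continuousOn_of_subgradient (hS.functions.loss_subgradient i t ht)).comp_continuous
    hS.domain.lipschitzWith_proj.continuous
    fun x => (proj_isNearest ⟨0, hS.domain.zero_mem⟩ hS.domain.closed x).1

theorem continuous_constraint_proj (hS : StandingAssumptions Q r R F G₁ G₂ w B μ) {t : ℕ}
    (ht : 1 ≤ t) (i : Fin n) : Continuous fun x => Q.g i t (proj Q.X x) :=
  (continuousOn_of_vecSubgradient (hS.functions.constraint_subgradient i t ht)).comp_continuous
    hS.domain.lipschitzWith_proj.continuous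
    fun x => (proj_isNearest ⟨0, hS.domain.zero_mem⟩ hS.domain.closed x).1

theorem continuous_primal_extend (hS : StandingAssumptions Q r R F G₁ G₂ w B μ) (s : Params)
    {t : ℕ} (ht : 1 ≤ t) (i : Fin n) :
    Continuous fun z : Vec p × Vec p => primal Q.extend s t i z.1 z.2 := by
  have hf := continuous_loss_proj hS ht i
  have hg := continuous_constraint_proj hS ht i
  have hx : Continuous fun z : Vec p × Vec p => z.1 + s.δ t • z.2 := by fun_prop
  have h1 : Continuous fun z : Vec p × Vec p =>
      gradEst (Q.extend.f i t) (s.δ t) z.1 z.2 :=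
    (((hf.comp hx).sub (hf.comp continuous_fst)).const_mul _).smul continuous_snd
  have h2 : Continuous fun z : Vec p × Vec p =>
      gradEst (fun y => inner ℝ (dual Q.extend s t i z.1) (Q.extend.g i t y)) (s.δ t) z.1 z.2 := by
    have hq : Continuous fun z : Vec p × Vec p => dual Q.extend s t i z.1 :=
      ((continuous_clip.comp hg).comp continuous_fst).const_smul (s.γ t)
    have h3 : Continuous fun z : Vec p × Vec p =>
        inner ℝ (dual Q.extend s t i z.1) (Q.extend.g i t (z.1 + s.δ t • z.2)) :=
      Continuous.inner (𝕜 := ℝ) hq (hg.comp hx)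
    have h4 : Continuous fun z : Vec p × Vec p =>
        inner ℝ (dual Q.extend s t i z.1) (Q.extend.g i t z.1) :=
      Continuous.inner (𝕜 := ℝ) hq (hg.comp continuous_fst)
    exact ((h3.sub h4).const_mul _).smul continuous_snd
  have h3 : Continuous fun z : Vec p × Vec p => direction Q.extend s t i z.1 z.2 := by
    simp only [direction_eq]
    exact h1.add h2
  exact (hS.domain.lipschitzWith_proj_shrink _).continuous.comp
    (continuous_fst.sub (h3.const_smul (s.α t)))

theorem zSeq_succ (Q : Problem n p) (s : Params) (z₁ : Fin n → Vec p)
    (u : Fin n → ℕ → Metric.sphere (0 : Vec p) 1) {t : ℕ} (ht : 1 ≤ t) (i : Fin n) :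
    zSeq Q s z₁ u (t + 1) i = primal Q s t i (xSeq Q s z₁ u t i) (u i t) := by
  obtain ⟨t, rfl⟩ := Nat.exists_eq_add_of_le' ht
  rfl

theorem measurable_consensus (Q : Problem n p) (t : ℕ) {Ω : Type*} {mΩ : MeasurableSpace Ω}
    {z : Ω → Fin n → Vec p} (hz : ∀ j, Measurable fun ω => z ω j) (i : Fin n) :
    Measurable fun ω => consensus Q t (z ω) i := by
  unfold consensus
  fun_prop

variable (hS : StandingAssumptions Q r R F G₁ G₂ w B μ) (hc : 0 < c) {z₁ : Fin n → Vec p}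
  (hz : ∀ i, z₁ i ∈ (1 - (powerParams c γ₀ r).ξ 1) • Q.X) {t : ℕ} (ht : 1 ≤ t)
include hS hz ht

theorem zSeq_mem (u : Fin n → ℕ → Metric.sphere (0 : Vec p) 1) (i : Fin n) :
    zSeq Q (powerParams c γ₀ r) z₁ u t i ∈ (1 - stepSize c t) • Q.X := by
  obtain ⟨t, rfl⟩ := Nat.exists_eq_add_of_le' ht
  cases t with
  | zero => exact hz i
  | succ t =>
    rw [zSeq_succ _ _ _ _ (by omega)]
    exact hS.domain.proj_mem _ _

theorem xSeq_mem_shrink (u : Fin n → ℕ → Metric.sphere (0 : Vec p) 1) (i : Fin n) :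
    xSeq Q (powerParams c γ₀ r) z₁ u t i ∈ (1 - stepSize c t) • Q.X :=
  (hS.domain.convex_shrink _).sum_mem (fun j _ => hS.network.weight_nonneg ht i j)
    (hS.network.row_sum t ht i) fun j _ => zSeq_mem hS hz ht u j

include hc

theorem xSeq_mem (u : Fin n → ℕ → Metric.sphere (0 : Vec p) 1) (i : Fin n) :
    xSeq Q (powerParams c γ₀ r) z₁ u t i ∈ Q.X :=
  mem_X_of_mem_shrink hS hc ht (xSeq_mem_shrink hS hz ht u i)

theorem zSeq_mem_X (u : Fin n → ℕ → Metric.sphere (0 : Vec p) 1) (i : Fin n) :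
    zSeq Q (powerParams c γ₀ r) z₁ u t i ∈ Q.X :=
  mem_X_of_mem_shrink hS hc ht (zSeq_mem hS hz ht u i)

omit hz in
theorem primal_extend_eq_of_mem_shrink {x u : Vec p} (hx : x ∈ (1 - stepSize c t) • Q.X)
    (hu : u ∈ Metric.sphere (0 : Vec p) 1) (i : Fin n) :
    primal Q.extend (powerParams c γ₀ r) t i x u = primal Q (powerParams c γ₀ r) t i x u :=
  primal_extend_eq hS.domain.closed _ t i (mem_X_of_mem_shrink hS hc ht hx)
    (hS.domain.add_smul_mem (stepSize_pos ht).le (stepSize_le_one hc ht) hx hu)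

/-- Only directions before time `t` are required to be measurable, and `mΩ` is arbitrary, so that
the statement also applies to the σ-algebra generated by the past directions. -/
theorem measurable_zSeq {Ω : Type*} {mΩ : MeasurableSpace Ω}
    {u : Fin n → ℕ → Ω → Metric.sphere (0 : Vec p) 1}
    (hu : ∀ j s, 1 ≤ s → s < t → Measurable (u j s)) (i : Fin n) :
    Measurable fun ω => zSeq Q (powerParams c γ₀ r) z₁ (fun i t => u i t ω) t i := by
  induction t, ht using Nat.le_induction generalizing i with
  | base => exact measurable_const
  | succ t ht ih =>
    have h1 : ∀ j, Measurable fun ω => zSeq Q (powerParams c γ₀ r) z₁ (fun i t => u i t ω) t j :=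
      fun j => ih (fun j s h1 h2 => hu j s h1 (by omega)) j
    have h2 : Measurable fun ω => xSeq Q (powerParams c γ₀ r) z₁ (fun i t => u i t ω) t i :=
      measurable_consensus Q t h1 i
    have h3 := (continuous_primal_extend hS (powerParams c γ₀ r) ht i).measurable.comp
      (h2.prodMk (measurable_subtype_coe.comp (hu i t ht (by omega))))
    convert! h3 using 2 with ω
    rw [zSeq_succ _ _ _ _ ht]
    exact (primal_extend_eq_of_mem_shrink hS hc ht (xSeq_mem_shrink hS hz ht _ i)
      (u i t ω).2 i).symm

theorem measurable_xSeq {Ω : Type*} {mΩ : MeasurableSpace Ω}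
    {u : Fin n → ℕ → Ω → Metric.sphere (0 : Vec p) 1}
    (hu : ∀ j s, 1 ≤ s → s < t → Measurable (u j s)) (i : Fin n) :
    Measurable fun ω => xSeq Q (powerParams c γ₀ r) z₁ (fun i t => u i t ω) t i :=
  measurable_consensus Q t (measurable_zSeq hS hc hz ht hu) i

omit hS hz ht hc in
theorem BanditOCO.DomainAssumption.integrable_comp {X : Set (Vec p)} (hX : DomainAssumption X r R)
    {φ : Vec p → ℝ} (hφ : ContinuousOn φ X) {Ω : Type*} [MeasurableSpace Ω] {P : Measure Ω}
    [IsFiniteMeasure P] {Y : Ω → Vec p} (hY : Measurable Y) (hYX : ∀ ω, Y ω ∈ X) :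
    Integrable (fun ω => φ (Y ω)) P := by
  obtain ⟨M, hM⟩ := hX.isCompact.exists_bound_of_continuousOn hφ
  have hcont : Continuous fun x => φ (proj X x) := hφ.comp_continuous
    hX.lipschitzWith_proj.continuous fun x => (proj_isNearest ⟨0, hX.zero_mem⟩ hX.closed x).1
  have hm : Measurable fun ω => φ (Y ω) := by
    convert! hcont.measurable.comp hY using 2 with ω
    simp [proj_eq_self hX.closed (hYX ω)]
  exact Integrable.of_bound hm.aestronglyMeasurable M (ae_of_all _ fun ω => hM _ (hYX ω))

variable {Ω : Type*} [MeasurableSpace Ω] {P : Measure Ω}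
  {u : Fin n → ℕ → Ω → Metric.sphere (0 : Vec p) 1} (hu : UniformSampling P u)
include hu

theorem indepFun_xSeq (i : Fin n) :
    IndepFun (fun ω => xSeq Q (powerParams c γ₀ r) z₁ (fun i t => u i t ω) t i) (u i t) P := by
  rw [IndepFun_iff_Indep]
  have hm : ∀ k : Fin n × ℕ, Measurable (u k.1 (k.2 + 1)) := fun k => hu.measurable _ _ (by omega)
  -- The index `(j, s)` stands for the direction at time `s + 1`, so `S` collects the times before
  -- `t` and `T` is the single direction `u i t`.
  have h := indep_iSup_of_disjoint (fun k => (hm k).comap_le) hu.indep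
    (S := {k | k.2 + 1 < t}) (T := {(i, t - 1)}) (by simp; omega)
  refine indep_of_indep_of_le_left (indep_of_indep_of_le_right h ?_) ?_
  · refine le_iSup₂_of_le (i, t - 1) rfl ?_
    simp only [Nat.sub_add_cancel ht, le_refl]
  · refine Measurable.comap_le ?_
    refine measurable_xSeq (mΩ := ⨆ k ∈ {k : Fin n × ℕ | k.2 + 1 < t}, MeasurableSpace.comap (u k.1 (k.2 + 1)) inferInstance)
      hS hc hz ht (fun j s h1 h2 => ?_) i
    obtain ⟨s, rfl⟩ := Nat.exists_eq_add_of_le' h1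
    have h3 : MeasurableSpace.comap (u j (s + 1)) inferInstance ≤
        ⨆ k ∈ {k : Fin n × ℕ | k.2 + 1 < t},
          MeasurableSpace.comap (u k.1 (k.2 + 1)) inferInstance :=
      le_iSup₂_of_le (f := fun (k : Fin n × ℕ) (_ : k ∈ {k : Fin n × ℕ | k.2 + 1 < t}) =>
        MeasurableSpace.comap (u k.1 (k.2 + 1)) inferInstance) (j, s) h2 le_rfl
    exact (comap_measurable _).mono h3 le_rfl

variable [IsProbabilityMeasure P]

omit hS hc hz in
-- Fubini for the product law of `Y` and `u i t`, in place of conditioning on the past.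
theorem integral_comp_of_indep {Y : Ω → Vec p} (hY : Measurable Y) {i : Fin n}
    (hind : IndepFun Y (u i t) P) {H : Vec p → Metric.sphere (0 : Vec p) 1 → ℝ}
    (hH : Continuous (Function.uncurry H)) {M : ℝ} (hM : ∀ x v, ‖H x v‖ ≤ M) :
    ∫ ω, H (Y ω) (u i t ω) ∂P = ∫ ω, ∫ v, H (Y ω) v ∂sphereUniform p ∂P := by
  have hum := hu.measurable i t ht
  have hlaw := hu.law i t ht
  have : IsProbabilityMeasure (P.map (u i t)) := Measure.isProbabilityMeasure_map hum.aemeasurable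
  have : IsProbabilityMeasure (P.map Y) := Measure.isProbabilityMeasure_map hY.aemeasurable
  have h1 := (indepFun_iff_map_prod_eq_prod_map_map hY.aemeasurable hum.aemeasurable).1 hind
  have hint : Integrable (Function.uncurry H) ((P.map Y).prod (P.map (u i t))) :=
    Integrable.of_bound hH.aestronglyMeasurable M (ae_of_all _ fun z => hM z.1 z.2)
  calc ∫ ω, H (Y ω) (u i t ω) ∂P
      = ∫ z, Function.uncurry H z ∂(P.map fun ω => (Y ω, u i t ω)) :=
        (integral_map (hY.prodMk hum).aemeasurable hH.aestronglyMeasurable).symm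
    _ = ∫ x, ∫ v, H x v ∂(P.map (u i t)) ∂(P.map Y) := by rw [h1, integral_prod _ hint]; rfl
    _ = ∫ ω, ∫ v, H (Y ω) v ∂(P.map (u i t)) ∂P :=
        integral_map hY.aemeasurable hint.integral_prod_left.aestronglyMeasurable
    _ = _ := by rw [hlaw]

end Random

/-! ### The one-step inequality in expectation -/

section ExpectedProgress

/-- Jensen's inequality uses the row sums; exchanging the sums over agents uses the column sums. -/
theorem norm_consensus_sub_sq_le {n p : ℕ} {Q : Problem n p} {w : ℝ} {B t : ℕ}
    (hQ : NetworkAssumption Q w B) (ht : 1 ≤ t) (z : Fin n → Vec p) (y : Vec p) :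
    ∑ i, ‖consensus Q t z i - y‖ ^ 2 ≤ ∑ i, ‖z i - y‖ ^ 2 := by
  have hconv : ConvexOn ℝ univ fun v : Vec p => ‖v‖ ^ 2 :=
    convexOn_univ_norm.pow (fun _ _ => norm_nonneg _) 2
  have h1 : ∀ i, ‖consensus Q t z i - y‖ ^ 2 ≤ ∑ j, Q.W t i j * ‖z j - y‖ ^ 2 := by
    intro i
    have h2 := hconv.map_sum_le (t := Finset.univ) (w := Q.W t i) (p := fun j => z j - y)
      (fun j _ => hQ.weight_nonneg ht i j) (hQ.row_sum t ht i) fun _ _ => mem_univ _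
    have h3 : ∑ j, Q.W t i j • (z j - y) = consensus Q t z i - y := by
      simp only [smul_sub, Finset.sum_sub_distrib, ← Finset.sum_smul, hQ.row_sum t ht i, one_smul,
        consensus]
    rw [h3] at h2
    exact h2
  refine (Finset.sum_le_sum fun i _ => h1 i).trans_eq ?_
  rw [Finset.sum_comm]
  simp only [← Finset.sum_mul, hQ.col_sum t ht, one_mul]

theorem integral_le_of_le_combination {Ω : Type*} [MeasurableSpace Ω] {P : Measure Ω}
    [IsProbabilityMeasure P] {φ a b d e : Ω → ℝ} {k₁ k₂ k₃ k₄ k₅ β : ℝ} (hφ : Integrable φ P)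
    (ha : Integrable a P) (hb : Integrable b P) (hd : Integrable d P) (he : Integrable e P)
    (h : ∀ ω, φ ω ≤ k₁ * a ω - k₂ * (b ω - β) - k₃ * d ω - k₄ * e ω + k₅) :
    ∫ ω, φ ω ∂P ≤ k₁ * ∫ ω, a ω ∂P - k₂ * (∫ ω, b ω ∂P - β) - k₃ * ∫ ω, d ω ∂P -
      k₄ * ∫ ω, e ω ∂P + k₅ := by
  have h1 := ha.const_mul k₁
  have h2 := hb.const_mul k₂
  have h3 := hd.const_mul k₃
  have h4 := he.const_mul k₄
  have h5 := integral_mono hφ ((((h1.sub h2).sub h3).sub h4).add (integrable_const (k₂ * β + k₅)))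
    fun ω => by
      have := h ω
      simp only [Pi.add_apply, Pi.sub_apply]
      linarith
  rw [integral_add' (((h1.sub h2).sub h3).sub h4) (integrable_const _),
    integral_sub' ((h1.sub h2).sub h3) h4, integral_sub' (h1.sub h2) h3,
    integral_sub' h1 h2] at h5
  simp only [integral_const_mul, integral_const, probReal_univ, one_smul] at h5
  linarith

theorem continuous_integral_sphereUniform {p : ℕ} [NeZero p]
    {H : Vec p → Metric.sphere (0 : Vec p) 1 → ℝ} (hH : Continuous (Function.uncurry H)) {M : ℝ}
    (hM : ∀ x v, ‖H x v‖ ≤ M) : Continuous fun x => ∫ v, H x v ∂sphereUniform p := by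
  refine continuous_of_dominated (bound := fun _ => M)
    (fun x => (hH.comp (Continuous.prodMk_right x)).aestronglyMeasurable)
    (fun x => Filter.Eventually.of_forall fun v => hM x v) (integrable_const _)
    (Filter.Eventually.of_forall fun v => hH.comp (Continuous.prodMk_left v))

variable {n p : ℕ} [NeZero p] {Q : Problem n p} {c γ₀ r R F G₁ G₂ w μ : ℝ} {B : ℕ}
  (hS : StandingAssumptions Q r R F G₁ G₂ w B μ) (hc : 0 < c) (hγ₀ : 0 < γ₀) (hμ : 0 ≤ μ)
  (hγ : γ₀ * (4 * ((p : ℝ) ^ 2 + 1) * G₂ ^ 2) ≤ 1) {z₁ : Fin n → Vec p}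
  (hz : ∀ i, z₁ i ∈ (1 - (powerParams c γ₀ r).ξ 1) • Q.X) {t : ℕ} (ht : 1 ≤ t)
  {Ω : Type*} [MeasurableSpace Ω] {P : Measure Ω}
  {u : Fin n → ℕ → Ω → Metric.sphere (0 : Vec p) 1} (hu : UniformSampling P u)
include hS hc hz ht hu

omit [NeZero p] in
theorem integrable_comp_xSeq [IsFiniteMeasure P] {φ : Vec p → ℝ} (hφ : ContinuousOn φ Q.X)
    (i : Fin n) :
    Integrable (fun ω => φ (xSeq Q (powerParams c γ₀ r) z₁ (fun i t => u i t ω) t i)) P :=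
  hS.domain.integrable_comp hφ
    (measurable_xSeq hS hc hz ht (fun j s h _ => hu.measurable j s h) i)
    fun _ => xSeq_mem hS hc hz ht _ i

omit [NeZero p] in
theorem integrable_comp_zSeq [IsFiniteMeasure P] {φ : Vec p → ℝ} (hφ : ContinuousOn φ Q.X)
    (i : Fin n) :
    Integrable (fun ω => φ (zSeq Q (powerParams c γ₀ r) z₁ (fun i t => u i t ω) t i)) P :=
  hS.domain.integrable_comp hφ
    (measurable_zSeq hS hc hz ht (fun j s h _ => hu.measurable j s h) i)
    fun _ => zSeq_mem_X hS hc hz ht _ i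

variable [IsProbabilityMeasure P]
include hγ₀ hμ hγ

/-- Average over the fresh direction with the decision fixed, then over the decision. The margin `ρ`
treats feasible comparison points (`ρ = 0`) and Slater points together. -/
theorem integral_norm_zSeq_succ_sub_sq_le {y : Vec p} (hy : y ∈ Q.X) {ρ : ℝ} (hρ : 0 ≤ ρ)
    (i : Fin n) (hyg : ∀ k, Q.g i t y k ≤ -ρ) :
    ∫ ω, ‖zSeq Q (powerParams c γ₀ r) z₁ (fun i t => u i t ω) (t + 1) i - y‖ ^ 2 ∂P ≤
      (1 - stepSize c t * μ) *
        ∫ ω, ‖xSeq Q (powerParams c γ₀ r) z₁ (fun i t => u i t ω) t i - y‖ ^ 2 ∂P -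
      2 * stepSize c t *
        (∫ ω, Q.f i t (xSeq Q (powerParams c γ₀ r) z₁ (fun i t => u i t ω) t i) ∂P - Q.f i t y) -
      γ₀ * ∫ ω, ‖clip (Q.g i t (xSeq Q (powerParams c γ₀ r) z₁ (fun i t => u i t ω) t i))‖ ^ 2 ∂P -
      2 * γ₀ * ρ *
        ∫ ω, ‖clip (Q.g i t (xSeq Q (powerParams c γ₀ r) z₁ (fun i t => u i t ω) t i))‖ ∂P +
      progressConst p γ₀ r R G₁ G₂ μ * stepSize c t ^ 2 := by
  set s := powerParams c γ₀ r
  set Y : Ω → Vec p := fun ω => xSeq Q s z₁ (fun i t => u i t ω) t i with hYdef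
  have hY : Measurable Y := measurable_xSeq hS hc hz ht (fun j s h _ => hu.measurable j s h) i
  have hYm : ∀ ω, Y ω ∈ (1 - stepSize c t) • Q.X := fun ω => xSeq_mem_shrink hS hz ht _ i
  have hf : ContinuousOn (Q.f i t) Q.X :=
    continuousOn_of_subgradient (hS.functions.loss_subgradient i t ht)
  have hg : ContinuousOn (fun x => ‖clip (Q.g i t x)‖) Q.X := (continuous_clip.comp_continuousOn
    (continuousOn_of_vecSubgradient (hS.functions.constraint_subgradient i t ht))).norm
  have hgi : Integrable (fun ω => ‖clip (Q.g i t (Y ω))‖) P :=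
    integrable_comp_xSeq hS hc hz ht hu hg i
  have hgi2 : Integrable (fun ω => ‖clip (Q.g i t (Y ω))‖ ^ 2) P :=
    integrable_comp_xSeq hS hc hz ht hu (hg.pow 2) i
  have hfi : Integrable (fun ω => Q.f i t (Y ω)) P := integrable_comp_xSeq hS hc hz ht hu hf i
  have hni : Integrable (fun ω => ‖Y ω - y‖ ^ 2) P :=
    integrable_comp_xSeq (φ := fun x => ‖x - y‖ ^ 2) hS hc hz ht hu (by fun_prop) i
  set H : Vec p → Metric.sphere (0 : Vec p) 1 → ℝ := fun x v =>
    ‖primal Q.extend s t i x v - y‖ ^ 2 with hHdef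
  have hH : Continuous (Function.uncurry H) := by
    have h1 := (continuous_primal_extend hS s ht i).comp
      (continuous_fst.prodMk (continuous_subtype_val.comp continuous_snd) :
        Continuous fun z : Vec p × Metric.sphere (0 : Vec p) 1 => (z.1, (z.2 : Vec p)))
    exact (h1.sub continuous_const).norm.pow 2
  have hHb : ∀ x v, ‖H x v‖ ≤ (2 * R) ^ 2 := by
    intro x v
    have h1 : primal Q.extend s t i x v ∈ Q.X :=
      hS.domain.shrink_subset_self (stepSize_pos (c := c) (show 1 ≤ t + 1 by omega)).le
        (stepSize_le_one hc (by omega)) (hS.domain.proj_mem _ _)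
    rw [Real.norm_of_nonneg (sq_nonneg _)]
    exact pow_le_pow_left₀ (norm_nonneg _) (hS.domain.norm_sub_le h1 hy) 2
  have hHeq : ∀ x ∈ (1 - stepSize c t) • Q.X, ∀ v : Metric.sphere (0 : Vec p) 1,
      H x v = ‖primal Q s t i x v - y‖ ^ 2 := by
    intro x hx v
    rw [hHdef]
    simp only [s, primal_extend_eq_of_mem_shrink hS hc ht hx v.2 i]
  have hHint : ∀ x, Integrable (H x) (sphereUniform p) := fun x =>
    Integrable.of_bound (hH.comp (Continuous.prodMk_right x)).aestronglyMeasurable _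
      (ae_of_all _ (hHb x))
  have hstep : ∀ x ∈ (1 - stepSize c t) • Q.X, ∫ v, H x v ∂sphereUniform p ≤
      (1 - stepSize c t * μ) * ‖x - y‖ ^ 2 - 2 * stepSize c t * (Q.f i t x - Q.f i t y) -
      γ₀ * ‖clip (Q.g i t x)‖ ^ 2 - 2 * γ₀ * ρ * ‖clip (Q.g i t x)‖ +
      progressConst p γ₀ r R G₁ G₂ μ * stepSize c t ^ 2 := by
    intro x hx
    have h1 : (H x) = fun v : Metric.sphere (0 : Vec p) 1 => ‖primal Q s t i x v - y‖ ^ 2 :=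
      funext (hHeq x hx)
    have h2 := hHint x
    rw [h1] at h2
    rw [h1]
    have h3 := integral_norm_primal_sub_sq_le hS hc hγ₀ ht hx hμ hγ hy h2
    have h4 := mul_le_mul_of_nonneg_left (inner_clip_le_neg_mul (Q.g i t x) hρ hyg)
      (by positivity : 0 ≤ 2 * γ₀)
    linarith
  have hleft : ∀ ω, ‖zSeq Q s z₁ (fun i t => u i t ω) (t + 1) i - y‖ ^ 2 = H (Y ω) (u i t ω) := by
    intro ω
    rw [hHeq _ (hYm ω), zSeq_succ _ _ _ _ ht]
  rw [integral_congr_ae (ae_of_all _ hleft), integral_comp_of_indep ht hu hY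
    (indepFun_xSeq hS hc hz ht hu i) hH hHb]
  have hHouter : Integrable (fun ω => ∫ v, H (Y ω) v ∂sphereUniform p) P := by
    have hcont := continuous_integral_sphereUniform hH hHb
    exact integrable_comp_xSeq (φ := fun x => ∫ v, H x v ∂sphereUniform p) hS hc hz ht hu
      hcont.continuousOn i
  exact integral_le_of_le_combination hHouter hni hfi hgi2 hgi fun ω => hstep _ (hYm ω)

/-- The expected progress of all agents in one iteration. -/
theorem sum_integral_norm_zSeq_succ_sub_sq_le (hμ1 : μ ≤ 1) {y : Vec p} (hy : y ∈ Q.X) {ρ : ℝ}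
    (hρ : 0 ≤ ρ) (hyg : ∀ i k, Q.g i t y k ≤ -ρ) :
    ∑ i, ∫ ω, ‖zSeq Q (powerParams c γ₀ r) z₁ (fun i t => u i t ω) (t + 1) i - y‖ ^ 2 ∂P +
      2 * stepSize c t * ∑ i,
        (∫ ω, Q.f i t (xSeq Q (powerParams c γ₀ r) z₁ (fun i t => u i t ω) t i) ∂P - Q.f i t y) +
      γ₀ * ∑ i,
        ∫ ω, ‖clip (Q.g i t (xSeq Q (powerParams c γ₀ r) z₁ (fun i t => u i t ω) t i))‖ ^ 2 ∂P +
      2 * γ₀ * ρ * ∑ i,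
        ∫ ω, ‖clip (Q.g i t (xSeq Q (powerParams c γ₀ r) z₁ (fun i t => u i t ω) t i))‖ ∂P ≤
      (1 - stepSize c t * μ) *
        ∑ i, ∫ ω, ‖zSeq Q (powerParams c γ₀ r) z₁ (fun i t => u i t ω) t i - y‖ ^ 2 ∂P +
      n * progressConst p γ₀ r R G₁ G₂ μ * stepSize c t ^ 2 := by
  have h1 := Finset.sum_le_sum fun i (_ : i ∈ Finset.univ) =>
    integral_norm_zSeq_succ_sub_sq_le hS hc hγ₀ hμ hγ hz ht hu hy hρ i (hyg i)
  simp only [Finset.sum_add_distrib, Finset.sum_sub_distrib, ← Finset.mul_sum] at h1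
  simp only [Finset.sum_const, Finset.card_univ, Fintype.card_fin, nsmul_eq_mul] at h1
  have h2 : ∑ i, ∫ ω, ‖xSeq Q (powerParams c γ₀ r) z₁ (fun i t => u i t ω) t i - y‖ ^ 2 ∂P ≤
      ∑ i, ∫ ω, ‖zSeq Q (powerParams c γ₀ r) z₁ (fun i t => u i t ω) t i - y‖ ^ 2 ∂P := by
    have hx := fun i => integrable_comp_xSeq (φ := fun x => ‖x - y‖ ^ 2) hS hc hz ht hu
      (by fun_prop) i
    have hz' := fun i => integrable_comp_zSeq (φ := fun x => ‖x - y‖ ^ 2) hS hc hz ht hu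
      (by fun_prop) i
    rw [← integral_finsetSum _ fun i _ => hx i, ← integral_finsetSum _ fun i _ => hz' i]
    exact integral_mono (integrable_finsetSum _ fun i _ => hx i)
      (integrable_finsetSum _ fun i _ => hz' i)
      fun ω => norm_consensus_sub_sq_le hS.network ht _ y
  -- Needed to pass from `x` to `z` under this factor; it is the reason for assuming `μ ≤ 1`.
  have h3 : 0 ≤ 1 - stepSize c t * μ := by
    have := mul_le_one₀ (stepSize_le_one hc ht) hμ hμ1
    linarith
  have h4 := mul_le_mul_of_nonneg_left h2 h3
  simp only [Finset.sum_sub_distrib]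
  linarith

end ExpectedProgress

/-! ### Summation of the one-step inequality -/

section Rates

variable {c : ℝ}

theorem stepSize_nonneg (c : ℝ) (t : ℕ) : 0 ≤ stepSize c t := by
  unfold stepSize
  positivity

theorem stepSize_sq_le (hc : 0 < c) {t : ℕ} (ht : 1 ≤ t) : stepSize c t ^ 2 ≤ stepSize c t := by
  rw [sq]
  exact mul_le_of_le_one_right (stepSize_nonneg c t) (stepSize_le_one hc ht)

/-- Bernoulli's inequality for the increments of a power. -/
theorem rpow_le_rpow_succ_sub {a : ℝ} (h₀ : 0 ≤ a) (h₁ : a ≤ 1) (t : ℕ) :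
    (t : ℝ) ^ a ≤ ((t + 1 : ℕ) : ℝ) ^ a - a * ((t + 1 : ℕ) : ℝ) ^ (a - 1) := by
  have hpos : (0 : ℝ) < ((t + 1 : ℕ) : ℝ) := by positivity
  have h1 := rpow_one_add_le_one_add_mul_self (s := -(1 / ((t + 1 : ℕ) : ℝ))) (by
    rw [neg_le_neg_iff, div_le_one hpos]; push_cast; linarith [(Nat.cast_nonneg t : (0 : ℝ) ≤ t)])
    h₀ h₁
  have h2 : (t : ℝ) = ((t + 1 : ℕ) : ℝ) * (1 + -(1 / ((t + 1 : ℕ) : ℝ))) := by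
    field_simp
    push_cast
    ring
  have h3 : 0 ≤ 1 + -(1 / ((t + 1 : ℕ) : ℝ)) := by
    have : 0 ≤ ((t + 1 : ℕ) : ℝ) * (1 + -(1 / ((t + 1 : ℕ) : ℝ))) := by rw [← h2]; positivity
    exact nonneg_of_mul_nonneg_right this hpos
  conv_lhs => rw [h2]
  rw [Real.mul_rpow hpos.le h3, Real.rpow_sub_one hpos.ne']
  refine (mul_le_mul_of_nonneg_left h1 (by positivity)).trans_eq ?_
  field_simp
  ring

theorem rpow_succ_sub_rpow_le (hc₁ : c ≤ 1) (t : ℕ) :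
    ((t + 1 : ℕ) : ℝ) ^ c - (t : ℝ) ^ c ≤ ((t + 1 : ℕ) : ℝ) ^ (c - 1) := by
  have hpos : (0 : ℝ) < ((t + 1 : ℕ) : ℝ) := by positivity
  have h1 : (t : ℝ) ≤ ((t + 1 : ℕ) : ℝ) := by push_cast; linarith
  have h2 : ((t + 1 : ℕ) : ℝ) ^ (c - 1) * t ≤ (t : ℝ) ^ c := by
    rcases Nat.eq_zero_or_pos t with rfl | ht
    · simpa using Real.rpow_nonneg le_rfl c
    · have ht' : (0 : ℝ) < t := Nat.cast_pos.2 ht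
      have h3 : ((t + 1 : ℕ) : ℝ) ^ (c - 1) ≤ (t : ℝ) ^ (c - 1) :=
        Real.rpow_le_rpow_of_nonpos ht' h1 (by linarith)
      refine (mul_le_mul_of_nonneg_right h3 ht'.le).trans_eq ?_
      rw [← Real.rpow_add_one ht'.ne', sub_add_cancel]
  have h4 : ((t + 1 : ℕ) : ℝ) ^ c = ((t + 1 : ℕ) : ℝ) ^ (c - 1) * (t + 1) := by
    rw [← Nat.cast_add_one, ← Real.rpow_add_one hpos.ne', sub_add_cancel]
  rw [h4]
  linarith

theorem sum_stepSize_le (hc₀ : 0 < c) (hc₁ : c < 1) (T : ℕ) :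
    ∑ t ∈ Finset.Icc 1 T, stepSize c t ≤ (T : ℝ) ^ (1 - c) / (1 - c) := by
  have h1 : 0 < 1 - c := by linarith
  induction T with
  | zero => simp [Real.zero_rpow h1.ne']
  | succ T ih =>
    rw [Finset.sum_Icc_succ_top (by omega)]
    have h2 := rpow_le_rpow_succ_sub h1.le (by linarith : 1 - c ≤ 1) T
    have h3 : stepSize c (T + 1) = ((T + 1 : ℕ) : ℝ) ^ (1 - c - 1) := by
      rw [stepSize, show 1 - c - 1 = -c by ring, Real.rpow_neg (by positivity), one_div]
    rw [h3]
    rw [le_div_iff₀ h1] at ih ⊢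
    linarith

/-- From some time on the increments of `t ^ c` are at most `μ`. -/
theorem exists_forall_rpow_succ_sub_le (hc₁ : c < 1) {μ : ℝ} (hμ : 0 < μ) :
    ∃ t₀ : ℕ, ∀ t : ℕ, t₀ ≤ t → ((t + 1 : ℕ) : ℝ) ^ c - (t : ℝ) ^ c ≤ μ := by
  have h1 : Filter.Tendsto (fun t : ℕ => (t : ℝ) ^ (-(1 - c))) Filter.atTop (nhds 0) :=
    (tendsto_rpow_neg_atTop (by linarith)).comp tendsto_natCast_atTop_atTop
  obtain ⟨t₀, h⟩ := Filter.eventually_atTop.1 (h1.eventually (gt_mem_nhds hμ))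
  refine ⟨t₀, fun t ht => (rpow_succ_sub_rpow_le hc₁.le t).trans ?_⟩
  have := (h (t + 1) (by omega)).le
  rwa [neg_sub] at this

variable {V Φ S₁ S₂ : ℕ → ℝ} {M N K γ₀ ρ μ : ℝ}

/-- The violations are summable at the rate of the step sizes. -/
theorem sum_violation_le (hc : 0 < c) (hμ : 0 ≤ μ) (hK : 0 ≤ K)
    (hV : ∀ t, 1 ≤ t → 0 ≤ V t) (hVM : ∀ t, 1 ≤ t → V t ≤ M) (hΦ : ∀ t, 1 ≤ t → -N ≤ Φ t)
    (T : ℕ) (h : ∀ t, 1 ≤ t → t ≤ T → V (t + 1) + 2 * stepSize c t * Φ t + γ₀ * S₂ t + 2 * γ₀ * ρ * S₁ t ≤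
      (1 - stepSize c t * μ) * V t + K * stepSize c t ^ 2) :
    γ₀ * ∑ t ∈ Finset.Icc 1 T, S₂ t + 2 * γ₀ * ρ * ∑ t ∈ Finset.Icc 1 T, S₁ t ≤
      M + (2 * N + K) * ∑ t ∈ Finset.Icc 1 T, stepSize c t := by
  suffices γ₀ * ∑ t ∈ Finset.Icc 1 T, S₂ t + 2 * γ₀ * ρ * ∑ t ∈ Finset.Icc 1 T, S₁ t ≤
      M - V (T + 1) + (2 * N + K) * ∑ t ∈ Finset.Icc 1 T, stepSize c t by
    linarith [hV (T + 1) (by omega)]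
  induction T with
  | zero => simpa using hVM 1 le_rfl
  | succ T ih =>
    have ih := ih fun t h₁ h₂ => h t h₁ (by omega)
    simp only [Finset.sum_Icc_succ_top (show 1 ≤ T + 1 by omega)]
    have h1 := h (T + 1) (by omega) le_rfl
    have h2 := mul_le_mul_of_nonneg_left (hΦ (T + 1) (by omega)) (stepSize_nonneg c (T + 1))
    have h3 := mul_le_mul_of_nonneg_left (stepSize_sq_le hc (show 1 ≤ T + 1 by omega)) hK
    have h4 := mul_nonneg (mul_nonneg (stepSize_nonneg c (T + 1)) hμ) (hV (T + 1) (by omega))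
    linarith

/-- With strong convexity the loss differences are summable at the rate of the step sizes. -/
theorem sum_loss_le (hc₀ : 0 < c) {t₀ : ℕ} (hM : 0 ≤ M) (hc₁ : c ≤ 1)
    (ht₀ : ∀ t : ℕ, t₀ ≤ t → ((t + 1 : ℕ) : ℝ) ^ c - (t : ℝ) ^ c ≤ μ) (hμ : 0 ≤ μ)
    (hV : ∀ t, 1 ≤ t → 0 ≤ V t) (hVM : ∀ t, 1 ≤ t → V t ≤ M)
    (T : ℕ) (h : ∀ t, 1 ≤ t → t ≤ T → V (t + 1) + 2 * stepSize c t * Φ t + γ₀ * S₂ t ≤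
      (1 - stepSize c t * μ) * V t + K * stepSize c t ^ 2) :
    ∑ t ∈ Finset.Icc 1 T, (Φ t + γ₀ / (2 * stepSize c t) * S₂ t) ≤
      M * t₀ / 2 + K / 2 * ∑ t ∈ Finset.Icc 1 T, stepSize c t := by
  -- The induction keeps the telescoping potential `T ^ c / 2 * V (T + 1)`. The number `min T t₀`
  -- counts the early iterations at which the increment of `t ^ c` may exceed `μ`, each costing at
  -- most `M / 2`.
  suffices ∑ t ∈ Finset.Icc 1 T, (Φ t + γ₀ / (2 * stepSize c t) * S₂ t) ≤
      M * (min T t₀ : ℕ) / 2 - (T : ℝ) ^ c / 2 * V (T + 1) +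
        K / 2 * ∑ t ∈ Finset.Icc 1 T, stepSize c t by
    have h1 : M * (min T t₀ : ℕ) ≤ M * t₀ := by
      gcongr
      exact min_le_right _ _
    have h2 : 0 ≤ (T : ℝ) ^ c / 2 * V (T + 1) := mul_nonneg (by positivity) (hV _ (by omega))
    linarith
  induction T with
  | zero => simp [Real.zero_rpow hc₀.ne']
  | succ T ih =>
    have ih := ih fun t h₁ h₂ => h t h₁ (by omega)
    simp only [Finset.sum_Icc_succ_top (show 1 ≤ T + 1 by omega)]
    have ha := stepSize_pos (c := c) (show 1 ≤ T + 1 by omega)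
    have hVn := hV (T + 1) (by omega)
    have h1 : (Φ (T + 1) + γ₀ / (2 * stepSize c (T + 1)) * S₂ (T + 1)) ≤
        (1 / stepSize c (T + 1) - μ) / 2 * V (T + 1) -
          1 / stepSize c (T + 1) / 2 * V (T + 1 + 1) + K / 2 * stepSize c (T + 1) := by
      have h2 := div_le_div_of_nonneg_right (h (T + 1) (by omega) le_rfl)
        (by positivity : 0 ≤ 2 * stepSize c (T + 1))
      have h3 : (V (T + 1 + 1) + 2 * stepSize c (T + 1) * Φ (T + 1) + γ₀ * S₂ (T + 1)) /
          (2 * stepSize c (T + 1)) = 1 / stepSize c (T + 1) / 2 * V (T + 1 + 1) +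
            (Φ (T + 1) + γ₀ / (2 * stepSize c (T + 1)) * S₂ (T + 1)) := by
        field_simp
        ring
      have h4 : ((1 - stepSize c (T + 1) * μ) * V (T + 1) + K * stepSize c (T + 1) ^ 2) /
          (2 * stepSize c (T + 1)) = (1 / stepSize c (T + 1) - μ) / 2 * V (T + 1) +
            K / 2 * stepSize c (T + 1) := by
        field_simp
      rw [h3, h4] at h2
      linarith
    have h5 : 1 / stepSize c (T + 1) = ((T + 1 : ℕ) : ℝ) ^ c := by
      rw [stepSize, one_div_one_div]
    rw [h5] at h1
    have h6 : (((T + 1 : ℕ) : ℝ) ^ c - (T : ℝ) ^ c - μ) * V (T + 1) ≤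
        M * ((min (T + 1) t₀ : ℕ) - (min T t₀ : ℕ)) := by
      rcases le_or_gt t₀ T with hle | hlt
      · rw [min_eq_right hle, min_eq_right (by omega : t₀ ≤ T + 1), sub_self, mul_zero]
        exact mul_nonpos_of_nonpos_of_nonneg (by linarith [ht₀ T hle]) hVn
      · rw [min_eq_left (by omega : T ≤ t₀), min_eq_left (by omega : T + 1 ≤ t₀)]
        have h7 : ((T + 1 : ℕ) : ℝ) ^ (c - 1) ≤ 1 :=
          Real.rpow_le_one_of_one_le_of_nonpos (by push_cast; linarith [Nat.cast_nonneg (α := ℝ) T])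
            (by linarith)
        have h8 : ((T + 1 : ℕ) : ℝ) ^ c - (T : ℝ) ^ c - μ ≤ 1 := by
          linarith [rpow_succ_sub_rpow_le hc₁ T]
        have h9 := mul_le_mul_of_nonneg_right h8 hVn
        push_cast at h9 ⊢
        linarith [hVM (T + 1) (by omega)]
    linarith

end Rates

/-! ### Bounds for every sequence of directions -/

section Pathwise

/-- The constant in the bound of the disagreement of the agents. -/
noncomputable def disagreementConst (n B : ℕ) (w : ℝ) : ℝ := (n * B : ℕ) / (n * w ^ (n * B))

theorem disagreementConst_nonneg {n B : ℕ} {w : ℝ} (hw : 0 ≤ w) : 0 ≤ disagreementConst n B w := by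
  unfold disagreementConst
  positivity

variable {n p : ℕ} {Q : Problem n p} {c γ₀ r R F G₁ G₂ w μ : ℝ} {B : ℕ}
  (hS : StandingAssumptions Q r R F G₁ G₂ w B μ)
include hS

theorem BanditOCO.StandingAssumptions.G₁_nonneg (hn : 0 < n) : 0 ≤ G₁ :=
  nonneg_of_subgradient hS.domain.zero_mem (hS.functions.loss_subgradient ⟨0, hn⟩ 1 le_rfl)

theorem BanditOCO.StandingAssumptions.G₂_nonneg (hn : 0 < n) : 0 ≤ G₂ := by
  obtain ⟨D, -, h⟩ := hS.functions.constraint_subgradient ⟨0, hn⟩ 1 le_rfl 0 hS.domain.zero_mem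
  exact (norm_nonneg D).trans h

theorem BanditOCO.StandingAssumptions.F_nonneg (hn : 0 < n) : 0 ≤ F :=
  (abs_nonneg _).trans (hS.functions.loss_bound ⟨0, hn⟩ 1 le_rfl 0 hS.domain.zero_mem)

variable (hn : 0 < n) (hc : 0 < c) (hγ₀ : 0 < γ₀) {z₁ : Fin n → Vec p}
  (hz : ∀ i, z₁ i ∈ (1 - (powerParams c γ₀ r).ξ 1) • Q.X)
include hn hc hγ₀ hz

/-- The consensus bound, with the distance moved by the primal update as perturbation; the sum over
agents makes it uniform in the agent. -/
theorem sum_diam_zSeq_le (u : Fin n → ℕ → Metric.sphere (0 : Vec p) 1) (T : ℕ) :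
    ∑ t ∈ Finset.Icc 1 T, Metric.diam (range (zSeq Q (powerParams c γ₀ r) z₁ u t)) ≤
      disagreementConst n B w * (2 * R + 2 * (n * (p * G₁) * ∑ t ∈ Finset.Icc 1 T, stepSize c t +
        p * G₂ * γ₀ * ∑ t ∈ Finset.Icc 1 T, ∑ i,
          ‖clip (Q.g i t (xSeq Q (powerParams c γ₀ r) z₁ u t i))‖)) := by
  have hG₁ := hS.G₁_nonneg hn
  have hG₂ := hS.G₂_nonneg hn
  set e : ℕ → ℝ := fun t => n * (p * G₁) * stepSize c t + p * G₂ * γ₀ *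
    ∑ i, ‖clip (Q.g i t (xSeq Q (powerParams c γ₀ r) z₁ u t i))‖ with he
  have h := sum_diam_range_le (z := zSeq Q (powerParams c γ₀ r) z₁ u) (e := e) (R := 2 * R) hn
    hS.network (fun t => ?_) (fun t ht i => ?_) (fun t ht => ?_) T
  · refine h.trans_eq ?_
    simp only [he, Finset.sum_add_distrib, ← Finset.mul_sum]
    rfl
  · have := stepSize_nonneg c t
    positivity
  · rw [zSeq_succ _ _ _ _ ht]
    refine (norm_primal_sub_le hS hc hγ₀ ht (xSeq_mem_shrink hS hz ht u i) (u i t).2).trans ?_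
    have h1 : p * G₁ * stepSize c t ≤ n * (p * G₁) * stepSize c t := by
      have h2 : (1 : ℝ) ≤ n := by exact_mod_cast hn
      have h3 : 0 ≤ p * G₁ * stepSize c t := mul_nonneg (by positivity) (stepSize_nonneg c t)
      nlinarith
    have h4 : ‖clip (Q.g i t (xSeq Q (powerParams c γ₀ r) z₁ u t i))‖ ≤
        ∑ i, ‖clip (Q.g i t (xSeq Q (powerParams c γ₀ r) z₁ u t i))‖ :=
      Finset.single_le_sum (f := fun i =>
        ‖clip (Q.g i t (xSeq Q (powerParams c γ₀ r) z₁ u t i))‖) (fun _ _ => norm_nonneg _)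
        (Finset.mem_univ i)
    exact add_le_add h1 (mul_le_mul_of_nonneg_left h4 (by positivity))
  · exact diam_range_le (mul_nonneg zero_le_two hS.domain.R_nonneg) fun i j =>
      hS.domain.norm_sub_le (zSeq_mem_X hS hc hz ht u i) (zSeq_mem_X hS hc hz ht u j)

omit hγ₀ in
-- The algorithm controls the constraints of agent `j` at the decision of `j` only; at the decision
-- of `i` they differ by at most `G₂` times the spread.
theorem netCCV_le (u : Fin n → ℕ → Metric.sphere (0 : Vec p) 1) (T : ℕ) :
    netCCV Q T (xSeq Q (powerParams c γ₀ r) z₁ u) ≤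
      ∑ t ∈ Finset.Icc 1 T, ∑ i, ‖clip (Q.g i t (xSeq Q (powerParams c γ₀ r) z₁ u t i))‖ +
        n * G₂ *
          ∑ t ∈ Finset.Icc 1 T, Metric.diam (range (zSeq Q (powerParams c γ₀ r) z₁ u t)) := by
  have hn' : (0 : ℝ) < n := Nat.cast_pos.2 hn
  have h1 : ∀ i : Fin n, ∀ t ∈ Finset.Icc 1 T,
      ‖clip (Q.globalConstraint t (xSeq Q (powerParams c γ₀ r) z₁ u t i))‖ ≤
      ∑ i, ‖clip (Q.g i t (xSeq Q (powerParams c γ₀ r) z₁ u t i))‖ +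
        n * G₂ * Metric.diam (range (zSeq Q (powerParams c γ₀ r) z₁ u t)) := by
    intro i t ht
    have ht' := (Finset.mem_Icc.1 ht).1
    refine (norm_clip_globalConstraint_le Q t _).trans ?_
    have h2 : ∀ j, ‖clip (Q.g j t (xSeq Q (powerParams c γ₀ r) z₁ u t i))‖ ≤
        ‖clip (Q.g j t (xSeq Q (powerParams c γ₀ r) z₁ u t j))‖ +
          G₂ * Metric.diam (range (zSeq Q (powerParams c γ₀ r) z₁ u t)) := fun j =>
      (norm_clip_le_add (hS.functions.constraint_subgradient j t ht') (xSeq_mem hS hc hz ht' u i)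
        (xSeq_mem hS hc hz ht' u j)).trans (add_le_add le_rfl (mul_le_mul_of_nonneg_left
          (norm_consensus_sub_le hS.network ht' _ i j) (hS.G₂_nonneg hn)))
    refine (Finset.sum_le_sum fun j _ => h2 j).trans_eq ?_
    rw [Finset.sum_add_distrib]
    simp [mul_assoc]
  have h3 := Finset.sum_le_sum fun i (_ : i ∈ Finset.univ) => Finset.sum_le_sum (h1 i)
  rw [netCCV, one_div, inv_mul_le_iff₀ hn']
  refine h3.trans_eq ?_
  simp [Finset.sum_add_distrib, ← Finset.mul_sum, mul_add]

omit hγ₀ in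
theorem sum_globalLoss_le (u : Fin n → ℕ → Metric.sphere (0 : Vec p) 1) (T : ℕ) :
    (1 / (n : ℝ)) * ∑ i, ∑ t ∈ Finset.Icc 1 T,
        Q.globalLoss t (xSeq Q (powerParams c γ₀ r) z₁ u t i) ≤
      (1 / (n : ℝ)) * ∑ t ∈ Finset.Icc 1 T, ∑ j,
          Q.f j t (xSeq Q (powerParams c γ₀ r) z₁ u t j) +
        G₁ * ∑ t ∈ Finset.Icc 1 T, Metric.diam (range (zSeq Q (powerParams c γ₀ r) z₁ u t)) := by
  have hn' : (0 : ℝ) < n := Nat.cast_pos.2 hn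
  have h1 : ∀ i : Fin n, ∀ t ∈ Finset.Icc 1 T,
      Q.globalLoss t (xSeq Q (powerParams c γ₀ r) z₁ u t i) ≤
      (1 / (n : ℝ)) * ∑ j, Q.f j t (xSeq Q (powerParams c γ₀ r) z₁ u t j) +
        G₁ * Metric.diam (range (zSeq Q (powerParams c γ₀ r) z₁ u t)) := by
    intro i t ht
    have ht' := (Finset.mem_Icc.1 ht).1
    have h2 : ∀ j, Q.f j t (xSeq Q (powerParams c γ₀ r) z₁ u t i) ≤
        Q.f j t (xSeq Q (powerParams c γ₀ r) z₁ u t j) +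
          G₁ * Metric.diam (range (zSeq Q (powerParams c γ₀ r) z₁ u t)) := fun j => by
      have h3 := sub_le_mul_norm_of_subgradient (hS.functions.loss_subgradient j t ht')
        (xSeq_mem hS hc hz ht' u i) (xSeq_mem hS hc hz ht' u j)
      have h4 : _ ≤ _ := mul_le_mul_of_nonneg_left
        (norm_consensus_sub_le hS.network ht' (zSeq Q (powerParams c γ₀ r) z₁ u t) i j)
        (hS.G₁_nonneg hn)
      simp only [xSeq] at h3 h4 ⊢
      linarith
    have h5 := Finset.sum_le_sum fun j (_ : j ∈ Finset.univ) => h2 j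
    rw [Finset.sum_add_distrib] at h5
    simp only [Finset.sum_const, Finset.card_univ, Fintype.card_fin, nsmul_eq_mul] at h5
    rw [Problem.globalLoss, one_div, inv_mul_le_iff₀ hn']
    refine h5.trans_eq ?_
    field_simp
  have h3 := Finset.sum_le_sum fun i (_ : i ∈ Finset.univ) => Finset.sum_le_sum (h1 i)
  have h4 := mul_le_mul_of_nonneg_left h3 (by positivity : 0 ≤ 1 / (n : ℝ))
  refine h4.trans_eq ?_
  simp only [Finset.sum_add_distrib, ← Finset.mul_sum, Finset.sum_const, Finset.card_univ,
    Fintype.card_fin, nsmul_eq_mul]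
  field_simp

end Pathwise

/-! ### Expected violation and regret in terms of the step sizes -/

section ExpectedBounds

/-- The expected sum over the agents of the `k`-th power of their own constraint violations. -/
noncomputable def expViolation {n p : ℕ} (Q : Problem n p) (s : Params) (z₁ : Fin n → Vec p)
    {Ω : Type*} [MeasurableSpace Ω] (P : Measure Ω)
    (u : Fin n → ℕ → Ω → Metric.sphere (0 : Vec p) 1) (k t : ℕ) : ℝ :=
  ∑ i, ∫ ω, ‖clip (Q.g i t (xSeq Q s z₁ (fun i t => u i t ω) t i))‖ ^ k ∂P

theorem expViolation_nonneg {n p : ℕ} (Q : Problem n p) (s : Params) (z₁ : Fin n → Vec p)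
    {Ω : Type*} [MeasurableSpace Ω] (P : Measure Ω)
    (u : Fin n → ℕ → Ω → Metric.sphere (0 : Vec p) 1) (k t : ℕ) :
    0 ≤ expViolation Q s z₁ P u k t :=
  Finset.sum_nonneg fun _ _ => integral_nonneg fun _ => by positivity

theorem progressConst_nonneg {p : ℕ} {γ₀ r R G₁ G₂ μ : ℝ} (hγ₀ : 0 ≤ γ₀) (hr : 0 ≤ r)
    (hR : 0 ≤ R) (hG₁ : 0 ≤ G₁) (hμ : 0 ≤ μ) : 0 ≤ progressConst p γ₀ r R G₁ G₂ μ := by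
  unfold progressConst
  positivity

theorem continuousOn_norm_clip {n p : ℕ} {Q : Problem n p} {r R F G₁ G₂ w μ : ℝ} {B : ℕ}
    (hS : StandingAssumptions Q r R F G₁ G₂ w B μ) {t : ℕ} (ht : 1 ≤ t) (i : Fin n) :
    ContinuousOn (fun x => ‖clip (Q.g i t x)‖) Q.X :=
  (continuous_clip.comp_continuousOn
    (continuousOn_of_vecSubgradient (hS.functions.constraint_subgradient i t ht))).norm

theorem continuousOn_norm_clip_globalConstraint {n p : ℕ} {Q : Problem n p}
    {r R F G₁ G₂ w μ : ℝ} {B : ℕ} (hS : StandingAssumptions Q r R F G₁ G₂ w B μ) {t : ℕ}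
    (ht : 1 ≤ t) : ContinuousOn (fun x => ‖clip (Q.globalConstraint t x)‖) Q.X := by
  refine (continuous_clip.comp_continuousOn ?_).norm
  exact (PiLp.continuous_toLp 2 _).comp_continuousOn (continuousOn_pi.2 fun k =>
    continuousOn_of_subgradient
      (exists_subgradient_apply (hS.functions.constraint_subgradient k.1 t ht) k.2))

theorem continuousOn_globalLoss {n p : ℕ} {Q : Problem n p} {r R F G₁ G₂ w μ : ℝ} {B : ℕ}
    (hS : StandingAssumptions Q r R F G₁ G₂ w B μ) {t : ℕ} (ht : 1 ≤ t) :
    ContinuousOn (Q.globalLoss t) Q.X :=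
  continuousOn_const.mul (continuousOn_finsetSum _ fun j _ =>
    continuousOn_of_subgradient (hS.functions.loss_subgradient j t ht))

theorem integral_le_of_le_affine {Ω : Type*} [MeasurableSpace Ω] {P : Measure Ω}
    [IsProbabilityMeasure P] {φ a b : Ω → ℝ} {k₁ k₂ k₃ k₄ k₅ : ℝ} (hφ : Integrable φ P)
    (ha : Integrable a P) (hb : Integrable b P)
    (h : ∀ ω, φ ω ≤ a ω + k₁ * (k₂ * (k₃ + 2 * (k₄ + k₅ * b ω)))) :
    ∫ ω, φ ω ∂P ≤ ∫ ω, a ω ∂P + k₁ * (k₂ * (k₃ + 2 * (k₄ + k₅ * ∫ ω, b ω ∂P))) := by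
  have h1 := hb.const_mul (k₁ * k₂ * 2 * k₅)
  have h2 := integral_mono hφ
    ((ha.add h1).add (integrable_const (k₁ * k₂ * k₃ + k₁ * k₂ * 2 * k₄))) fun ω => by
      have := h ω
      simp only [Pi.add_apply]
      linarith
  rw [integral_add' (ha.add h1) (integrable_const _), integral_add' ha h1] at h2
  simp only [integral_const_mul, integral_const, probReal_univ, one_smul] at h2
  linarith

variable {n p : ℕ} [NeZero p] {Q : Problem n p} {c γ₀ r R F G₁ G₂ w μ : ℝ} {B : ℕ}
  (hS : StandingAssumptions Q r R F G₁ G₂ w B μ) (hn : 0 < n) (hc : 0 < c) (hγ₀ : 0 < γ₀)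
  {z₁ : Fin n → Vec p} (hz : ∀ i, z₁ i ∈ (1 - (powerParams c γ₀ r).ξ 1) • Q.X)
  {Ω : Type*} [MeasurableSpace Ω] {P : Measure Ω} [IsProbabilityMeasure P]
  {u : Fin n → ℕ → Ω → Metric.sphere (0 : Vec p) 1} (hu : UniformSampling P u)
include hS hc hz hu

omit [NeZero p] in
theorem integrable_netReg (T : ℕ) :
    Integrable (fun ω => netReg Q T (xSeq Q (powerParams c γ₀ r) z₁ fun i t => u i t ω)) P :=
  (integrable_finsetSum _ fun i _ => (integrable_finsetSum _ fun _ ht =>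
    integrable_comp_xSeq hS hc hz (Finset.mem_Icc.1 ht).1 hu
      (continuousOn_globalLoss hS (Finset.mem_Icc.1 ht).1) i).sub (integrable_const _)).const_mul _

omit [NeZero p] in
theorem integrable_netCCV (T : ℕ) :
    Integrable (fun ω => netCCV Q T (xSeq Q (powerParams c γ₀ r) z₁ fun i t => u i t ω)) P :=
  (integrable_finsetSum _ fun i _ => integrable_finsetSum _ fun _ ht =>
    integrable_comp_xSeq hS hc hz (Finset.mem_Icc.1 ht).1 hu
      (continuousOn_norm_clip_globalConstraint hS (Finset.mem_Icc.1 ht).1) i).const_mul _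

omit [NeZero p] in
theorem integrable_norm_clip_pow {t : ℕ} (ht : 1 ≤ t) (k : ℕ) (i : Fin n) :
    Integrable (fun ω => ‖clip (Q.g i t (xSeq Q (powerParams c γ₀ r) z₁
      (fun i t => u i t ω) t i))‖ ^ k) P :=
  integrable_comp_xSeq hS hc hz ht hu ((continuousOn_norm_clip hS ht i).pow k) i

omit [NeZero p] in
theorem integral_sum_norm_clip (T : ℕ) :
    Integrable (fun ω => ∑ t ∈ Finset.Icc 1 T, ∑ i,
      ‖clip (Q.g i t (xSeq Q (powerParams c γ₀ r) z₁ (fun i t => u i t ω) t i))‖) P ∧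
    ∫ ω, ∑ t ∈ Finset.Icc 1 T, ∑ i,
      ‖clip (Q.g i t (xSeq Q (powerParams c γ₀ r) z₁ (fun i t => u i t ω) t i))‖ ∂P =
      ∑ t ∈ Finset.Icc 1 T, expViolation Q (powerParams c γ₀ r) z₁ P u 1 t := by
  have h1 : ∀ t ∈ Finset.Icc 1 T, ∀ i, Integrable (fun ω =>
      ‖clip (Q.g i t (xSeq Q (powerParams c γ₀ r) z₁ (fun i t => u i t ω) t i))‖) P :=
    fun t ht i => by
      simpa using integrable_norm_clip_pow hS hc hz hu (Finset.mem_Icc.1 ht).1 1 i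
  refine ⟨integrable_finsetSum _ fun t ht => integrable_finsetSum _ fun i _ => h1 t ht i, ?_⟩
  rw [integral_finsetSum _ fun t ht => integrable_finsetSum _ fun i _ => h1 t ht i]
  refine Finset.sum_congr rfl fun t ht => ?_
  rw [integral_finsetSum _ fun i _ => h1 t ht i]
  simp [expViolation]

omit [NeZero p] in
-- Young's inequality `G ≤ θ / 2 + G ^ 2 / (2 θ)`. The weight is `T ^ (-c / 2)` for the constraint
-- violation and proportional to `α_t` for the regret.
theorem expViolation_one_le {t : ℕ} (ht : 1 ≤ t) {θ : ℝ} (hθ : 0 < θ) :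
    expViolation Q (powerParams c γ₀ r) z₁ P u 1 t ≤
      n * θ / 2 + expViolation Q (powerParams c γ₀ r) z₁ P u 2 t / (2 * θ) := by
  have h1 : ∀ i, ∫ ω, ‖clip (Q.g i t (xSeq Q (powerParams c γ₀ r) z₁
      (fun i t => u i t ω) t i))‖ ^ 1 ∂P ≤
      θ / 2 + (∫ ω, ‖clip (Q.g i t (xSeq Q (powerParams c γ₀ r) z₁
        (fun i t => u i t ω) t i))‖ ^ 2 ∂P) / (2 * θ) := by
    intro i
    have h2 := (integrable_norm_clip_pow hS hc hz hu ht 2 i).div_const (2 * θ)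
    have h3 := integral_mono (integrable_norm_clip_pow hS hc hz hu ht 1 i)
      ((integrable_const (θ / 2)).add h2) fun ω => by
        set G := ‖clip (Q.g i t (xSeq Q (powerParams c γ₀ r) z₁ (fun i t => u i t ω) t i))‖
        have h4 : 0 ≤ (G - θ) ^ 2 / (2 * θ) := by positivity
        have h5 : (G - θ) ^ 2 / (2 * θ) = θ / 2 + G ^ 2 / (2 * θ) - G := by
          field_simp
          ring
        simp only [Pi.add_apply, pow_one]
        linarith
    rw [integral_add' (integrable_const _) h2, integral_div (2 * θ)] at h3
    simpa only [integral_const, probReal_univ, one_smul] using h3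
  refine (Finset.sum_le_sum fun i _ => h1 i).trans_eq ?_
  rw [Finset.sum_add_distrib, ← Finset.sum_div _ _ (2 * θ), expViolation]
  simp only [Finset.sum_const, Finset.card_univ, Fintype.card_fin, nsmul_eq_mul, mul_div_assoc]

include hn hγ₀

omit [NeZero p] in
theorem integral_netCCV_le (T : ℕ) :
    ∫ ω, netCCV Q T (xSeq Q (powerParams c γ₀ r) z₁ fun i t => u i t ω) ∂P ≤
      ∑ t ∈ Finset.Icc 1 T, expViolation Q (powerParams c γ₀ r) z₁ P u 1 t +
      n * G₂ * (disagreementConst n B w *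
        (2 * R + 2 * (n * (p * G₁) * ∑ t ∈ Finset.Icc 1 T, stepSize c t + p * G₂ * γ₀ *
          ∑ t ∈ Finset.Icc 1 T, expViolation Q (powerParams c γ₀ r) z₁ P u 1 t))) := by
  obtain ⟨hi, h1⟩ := integral_sum_norm_clip (γ₀ := γ₀) hS hc hz hu T
  have hG : 0 ≤ n * G₂ := mul_nonneg (Nat.cast_nonneg n) (hS.G₂_nonneg hn)
  rw [← h1]
  exact integral_le_of_le_affine (integrable_netCCV hS hc hz hu T) hi hi fun ω =>
    (netCCV_le hS hn hc hz (fun i t => u i t ω) T).trans (add_le_add le_rfl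
      (mul_le_mul_of_nonneg_left (sum_diam_zSeq_le hS hn hc hγ₀ hz (fun i t => u i t ω) T) hG))

omit [NeZero p] in
theorem integral_sum_globalLoss_le (T : ℕ) :
    ∫ ω, (1 / (n : ℝ)) * ∑ i, ∑ t ∈ Finset.Icc 1 T,
        Q.globalLoss t (xSeq Q (powerParams c γ₀ r) z₁ (fun i t => u i t ω) t i) ∂P ≤
      (1 / (n : ℝ)) * ∑ t ∈ Finset.Icc 1 T, ∑ j,
          ∫ ω, Q.f j t (xSeq Q (powerParams c γ₀ r) z₁ (fun i t => u i t ω) t j) ∂P +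
      G₁ * (disagreementConst n B w *
        (2 * R + 2 * (n * (p * G₁) * ∑ t ∈ Finset.Icc 1 T, stepSize c t + p * G₂ * γ₀ *
          ∑ t ∈ Finset.Icc 1 T, expViolation Q (powerParams c γ₀ r) z₁ P u 1 t))) := by
  obtain ⟨hi, h1⟩ := integral_sum_norm_clip (γ₀ := γ₀) hS hc hz hu T
  have hfi : ∀ t ∈ Finset.Icc 1 T, ∀ j, Integrable (fun ω =>
      Q.f j t (xSeq Q (powerParams c γ₀ r) z₁ (fun i t => u i t ω) t j)) P := fun t ht j =>
    integrable_comp_xSeq hS hc hz (Finset.mem_Icc.1 ht).1 hu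
      (continuousOn_of_subgradient (hS.functions.loss_subgradient j t (Finset.mem_Icc.1 ht).1)) j
  have hfs : Integrable (fun ω => (1 / (n : ℝ)) * ∑ t ∈ Finset.Icc 1 T, ∑ j,
      Q.f j t (xSeq Q (powerParams c γ₀ r) z₁ (fun i t => u i t ω) t j)) P :=
    (integrable_finsetSum _ fun t ht => integrable_finsetSum _ fun j _ => hfi t ht j).const_mul _
  have hA : Integrable (fun ω => (1 / (n : ℝ)) * ∑ i, ∑ t ∈ Finset.Icc 1 T,
      Q.globalLoss t (xSeq Q (powerParams c γ₀ r) z₁ (fun i t => u i t ω) t i)) P :=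
    (integrable_finsetSum _ fun i _ => integrable_finsetSum _ fun _ ht =>
      integrable_comp_xSeq hS hc hz (Finset.mem_Icc.1 ht).1 hu
        (continuousOn_globalLoss hS (Finset.mem_Icc.1 ht).1) i).const_mul _
  rw [← h1, ← Finset.sum_congr rfl fun t ht => integral_finsetSum _ fun j _ => hfi t ht j,
    ← integral_finsetSum _ fun t ht => integrable_finsetSum _ fun j _ => hfi t ht j,
    ← integral_const_mul]
  exact integral_le_of_le_affine hA hfs hi fun ω =>
    (sum_globalLoss_le hS hn hc hz (fun i t => u i t ω) T).trans (add_le_add le_rfl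
      (mul_le_mul_of_nonneg_left (sum_diam_zSeq_le hS hn hc hγ₀ hz (fun i t => u i t ω) T)
        (hS.G₁_nonneg hn)))

omit hn hγ₀ in
omit [NeZero p] in
theorem sum_integral_norm_zSeq_sub_sq_le {y : Vec p} (hy : y ∈ Q.X) {t : ℕ} (ht : 1 ≤ t) :
    ∑ i, ∫ ω, ‖zSeq Q (powerParams c γ₀ r) z₁ (fun i t => u i t ω) t i - y‖ ^ 2 ∂P ≤
      n * (2 * R) ^ 2 := by
  have h1 : ∀ i : Fin n, ∫ ω, ‖zSeq Q (powerParams c γ₀ r) z₁ (fun i t => u i t ω) t i - y‖ ^ 2 ∂P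
      ≤ (2 * R) ^ 2 := fun i => by
    have h2 := integral_mono (integrable_comp_zSeq (φ := fun x => ‖x - y‖ ^ 2) hS hc hz ht hu
      (by fun_prop) i) (integrable_const ((2 * R) ^ 2)) fun ω => pow_le_pow_left₀ (norm_nonneg _)
        (hS.domain.norm_sub_le (zSeq_mem_X hS hc hz ht (fun i t => u i t ω) i) hy) 2
    simpa only [integral_const, probReal_univ, one_smul] using h2
  refine (Finset.sum_le_sum fun i _ => h1 i).trans_eq ?_
  simp

omit hn hγ₀ in
omit [NeZero p] in
theorem le_sum_integral_loss_sub {y : Vec p} (hy : y ∈ Q.X) {t : ℕ} (ht : 1 ≤ t) :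
    -(n * (2 * F)) ≤ ∑ i,
      (∫ ω, Q.f i t (xSeq Q (powerParams c γ₀ r) z₁ (fun i t => u i t ω) t i) ∂P - Q.f i t y) := by
  have h1 : ∀ i : Fin n, -(2 * F) ≤
      ∫ ω, Q.f i t (xSeq Q (powerParams c γ₀ r) z₁ (fun i t => u i t ω) t i) ∂P - Q.f i t y := by
    intro i
    have h2 := integral_mono (integrable_const (-F)) (integrable_comp_xSeq hS hc hz ht hu
      (continuousOn_of_subgradient (hS.functions.loss_subgradient i t ht)) i) fun ω =>
        (abs_le.1 (hS.functions.loss_bound i t ht _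
          (xSeq_mem hS hc hz ht (fun i t => u i t ω) i))).1
    simp only [integral_const, probReal_univ, one_smul] at h2
    linarith [(abs_le.1 (hS.functions.loss_bound i t ht y hy)).2]
  refine le_trans (le_of_eq ?_) (Finset.sum_le_sum fun i _ => h1 i)
  simp

variable (hμ : 0 ≤ μ) (hμ1 : μ ≤ 1) (hγ : γ₀ * (4 * ((p : ℝ) ^ 2 + 1) * G₂ ^ 2) ≤ 1)
include hμ hμ1 hγ

theorem sum_expViolation_le {y : Vec p} (hy : y ∈ Q.X) {ρ : ℝ} (hρ : 0 ≤ ρ) (T : ℕ)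
    (hyg : ∀ t, 1 ≤ t → t ≤ T → ∀ i k, Q.g i t y k ≤ -ρ) :
    γ₀ * ∑ t ∈ Finset.Icc 1 T, expViolation Q (powerParams c γ₀ r) z₁ P u 2 t +
      2 * γ₀ * ρ * ∑ t ∈ Finset.Icc 1 T, expViolation Q (powerParams c γ₀ r) z₁ P u 1 t ≤
      n * (2 * R) ^ 2 + (2 * (n * (2 * F)) + n * progressConst p γ₀ r R G₁ G₂ μ) *
        ∑ t ∈ Finset.Icc 1 T, stepSize c t := by
  have hK := progressConst_nonneg (p := p) (G₂ := G₂) hγ₀.le hS.domain.r_pos.le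
    hS.domain.R_nonneg (hS.G₁_nonneg hn) hμ
  refine sum_violation_le
    (V := fun t => ∑ i, ∫ ω, ‖zSeq Q (powerParams c γ₀ r) z₁ (fun i t => u i t ω) t i - y‖ ^ 2 ∂P)
    (Φ := fun t => ∑ i,
      (∫ ω, Q.f i t (xSeq Q (powerParams c γ₀ r) z₁ (fun i t => u i t ω) t i) ∂P - Q.f i t y))
    hc hμ (by positivity) (fun t _ => ?_) (fun t ht => ?_) (fun t ht => ?_) T (fun t ht htT => ?_)
  · exact Finset.sum_nonneg fun _ _ => integral_nonneg fun _ => by positivity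
  · exact sum_integral_norm_zSeq_sub_sq_le hS hc hz hu hy ht
  · exact le_sum_integral_loss_sub hS hc hz hu hy ht
  · simpa [expViolation] using sum_integral_norm_zSeq_succ_sub_sq_le hS hc hγ₀ hμ hγ hz ht hu hμ1
      hy hρ (hyg t ht htT)

/-- The expected regret against a feasible point. -/
theorem integral_sum_globalLoss_sub_le (hc₁ : c < 1) {t₀ : ℕ}
    (ht₀ : ∀ t : ℕ, t₀ ≤ t → ((t + 1 : ℕ) : ℝ) ^ c - (t : ℝ) ^ c ≤ μ) {y : Vec p} {T : ℕ}
    (hy : y ∈ Q.feasible T) {κ : ℝ} (hκ : 0 < κ)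
    (hκ' : G₁ * (disagreementConst n B w * (2 * (p * G₂ * γ₀))) ≤ κ) :
    ∫ ω, (1 / (n : ℝ)) * ∑ i, ∑ t ∈ Finset.Icc 1 T,
        Q.globalLoss t (xSeq Q (powerParams c γ₀ r) z₁ (fun i t => u i t ω) t i) ∂P -
      ∑ t ∈ Finset.Icc 1 T, Q.globalLoss t y ≤
      (1 / (n : ℝ)) * (n * (2 * R) ^ 2 * t₀ / 2) + G₁ * (disagreementConst n B w * (2 * R)) +
      ((1 / (n : ℝ)) * (n * progressConst p γ₀ r R G₁ G₂ μ / 2) +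
        G₁ * (disagreementConst n B w * (2 * (n * (p * G₁)))) + κ ^ 2 * n ^ 2 / (2 * γ₀)) *
        ∑ t ∈ Finset.Icc 1 T, stepSize c t := by
  have hn' : (0 : ℝ) < n := Nat.cast_pos.2 hn
  have hyX := hy.1
  have h1 := integral_sum_globalLoss_le hS hn hc hγ₀ hz hu T
  have h2 := sum_loss_le
    (V := fun t => ∑ i, ∫ ω, ‖zSeq Q (powerParams c γ₀ r) z₁ (fun i t => u i t ω) t i - y‖ ^ 2 ∂P)
    (Φ := fun t => ∑ i,
      (∫ ω, Q.f i t (xSeq Q (powerParams c γ₀ r) z₁ (fun i t => u i t ω) t i) ∂P - Q.f i t y))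
    (S₂ := expViolation Q (powerParams c γ₀ r) z₁ P u 2) (γ₀ := γ₀)
    (M := n * (2 * R) ^ 2) (K := n * progressConst p γ₀ r R G₁ G₂ μ)
    hc (by positivity) hc₁.le ht₀ hμ
    (fun t _ => Finset.sum_nonneg fun _ _ => integral_nonneg fun _ => by positivity)
    (fun t ht => sum_integral_norm_zSeq_sub_sq_le hS hc hz hu hyX ht) T
    (fun t ht htT => by
      have := sum_integral_norm_zSeq_succ_sub_sq_le hS hc hγ₀ hμ hγ hz ht hu hμ1 hyX le_rfl
        (fun i k => (hy.2 t (Finset.mem_Icc.2 ⟨ht, htT⟩) ⟨i, k⟩).trans_eq neg_zero.symm)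
      simpa [expViolation] using this)
  -- The weight `κ n α_t / γ₀` is chosen so that the quadratic part is exactly `1 / n` times the
  -- term kept on the left of `h2`; the rest is summable at the rate of the step sizes.
  have h3 : ∀ t ∈ Finset.Icc 1 T, κ * expViolation Q (powerParams c γ₀ r) z₁ P u 1 t ≤
      κ ^ 2 * n ^ 2 / (2 * γ₀) * stepSize c t + (1 / (n : ℝ)) *
        (γ₀ / (2 * stepSize c t) * expViolation Q (powerParams c γ₀ r) z₁ P u 2 t) := by
    intro t ht
    have ht' := (Finset.mem_Icc.1 ht).1
    have ha := stepSize_pos (c := c) ht'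
    have h4 := mul_le_mul_of_nonneg_left (expViolation_one_le (γ₀ := γ₀) hS hc hz hu ht'
      (by positivity : 0 < κ * n * stepSize c t / γ₀)) hκ.le
    refine h4.trans_eq ?_
    field_simp
  have h5 := Finset.sum_le_sum h3
  have h6 : ∑ t ∈ Finset.Icc 1 T, Q.globalLoss t y =
      (1 / (n : ℝ)) * ∑ t ∈ Finset.Icc 1 T, ∑ j, Q.f j t y := by
    simp only [Problem.globalLoss, Finset.mul_sum]
  have h7 := mul_le_mul_of_nonneg_left h2 (by positivity : 0 ≤ 1 / (n : ℝ))
  have h8 := mul_le_mul_of_nonneg_right hκ' (Finset.sum_nonneg fun t (_ : t ∈ Finset.Icc 1 T) =>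
    expViolation_nonneg Q (powerParams c γ₀ r) z₁ P u 1 t)
  simp only [Finset.sum_add_distrib, Finset.sum_sub_distrib, ← Finset.mul_sum] at h5 h7
  rw [h6]
  linarith

theorem integral_netReg_le (hc₁ : c < 1) {t₀ : ℕ}
    (ht₀ : ∀ t : ℕ, t₀ ≤ t → ((t + 1 : ℕ) : ℝ) ^ c - (t : ℝ) ^ c ≤ μ) {T : ℕ} (hT : 1 ≤ T)
    {κ : ℝ} (hκ : 0 < κ) (hκ' : G₁ * (disagreementConst n B w * (2 * (p * G₂ * γ₀))) ≤ κ) :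
    ∫ ω, netReg Q T (xSeq Q (powerParams c γ₀ r) z₁ fun i t => u i t ω) ∂P ≤
      (1 / (n : ℝ)) * (n * (2 * R) ^ 2 * t₀ / 2) + G₁ * (disagreementConst n B w * (2 * R)) +
      ((1 / (n : ℝ)) * (n * progressConst p γ₀ r R G₁ G₂ μ / 2) +
        G₁ * (disagreementConst n B w * (2 * (n * (p * G₁)))) + κ ^ 2 * n ^ 2 / (2 * γ₀)) *
        ∑ t ∈ Finset.Icc 1 T, stepSize c t := by
  have hn' : (n : ℝ) ≠ 0 := Nat.cast_ne_zero.2 hn.ne'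
  set m := sInf ((fun y => ∑ t ∈ Finset.Icc 1 T, Q.globalLoss t y) '' Q.feasible T) with hm
  have h1 : ∀ ω, netReg Q T (xSeq Q (powerParams c γ₀ r) z₁ fun i t => u i t ω) =
      (1 / (n : ℝ)) * ∑ i, ∑ t ∈ Finset.Icc 1 T,
        Q.globalLoss t (xSeq Q (powerParams c γ₀ r) z₁ (fun i t => u i t ω) t i) - m := by
    intro ω
    rw [netReg, Finset.sum_sub_distrib, ← hm]
    simp only [Finset.sum_const, Finset.card_univ, Fintype.card_fin, nsmul_eq_mul]
    field_simp
  have hA : Integrable (fun ω => (1 / (n : ℝ)) * ∑ i, ∑ t ∈ Finset.Icc 1 T,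
      Q.globalLoss t (xSeq Q (powerParams c γ₀ r) z₁ (fun i t => u i t ω) t i)) P :=
    (integrable_finsetSum _ fun i _ => integrable_finsetSum _ fun _ ht =>
      integrable_comp_xSeq hS hc hz (Finset.mem_Icc.1 ht).1 hu
        (continuousOn_globalLoss hS (Finset.mem_Icc.1 ht).1) i).const_mul _
  rw [integral_congr_ae (ae_of_all _ h1), integral_sub hA (integrable_const _)]
  simp only [integral_const, probReal_univ, one_smul]
  rw [sub_le_comm]
  -- It suffices to compare with each feasible point, so attainment of the minimum plays no role.
  refine le_csInf ((hS.feasible_nonempty T hT).image _) ?_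
  rintro _ ⟨y, hy, rfl⟩
  rw [sub_le_comm]
  exact integral_sum_globalLoss_sub_le hS hn hc hγ₀ hz hu hμ hμ1 hγ hc₁ ht₀ hy hκ hκ'

end ExpectedBounds

/-! ### Powers of the horizon and the theorem -/

section FinalRates

theorem BanditOCO.StandingAssumptions.mono {n p : ℕ} {Q : Problem n p}
    {r R F G₁ G₂ w μ μ' : ℝ} {B : ℕ} (hS : StandingAssumptions Q r R F G₁ G₂ w B μ)
    (h : μ' ≤ μ) : StandingAssumptions Q r R F G₁ G₂ w B μ' :=
  { hS with
    strong := fun i t ht x hx y hy s hs => by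
      have h1 := hS.strong i t ht x hx y hy s hs
      have h2 := mul_le_mul_of_nonneg_right h (sq_nonneg ‖x - y‖)
      linarith }

theorem add_mul_sum_stepSize_le {c e k₀ k₁ : ℝ} (hc₀ : 0 < c) (hc₁ : c < 1) (he : 1 - c ≤ e)
    (hk₀ : 0 ≤ k₀) (hk₁ : 0 ≤ k₁) {T : ℕ} (hT : 1 ≤ T) :
    k₀ + k₁ * ∑ t ∈ Finset.Icc 1 T, stepSize c t ≤ (k₀ + k₁ / (1 - c)) * (T : ℝ) ^ e := by
  have hT' : (1 : ℝ) ≤ T := by exact_mod_cast hT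
  have h1 : 0 < 1 - c := by linarith
  have h2 : 1 ≤ (T : ℝ) ^ e := Real.one_le_rpow hT' (by linarith)
  have h3 : ∑ t ∈ Finset.Icc 1 T, stepSize c t ≤ (T : ℝ) ^ e / (1 - c) :=
    (sum_stepSize_le hc₀ hc₁ T).trans (by gcongr)
  have h4 := mul_le_mul_of_nonneg_left h3 hk₁
  have h5 := mul_le_mul_of_nonneg_left h2 hk₀
  have h6 : k₁ / (1 - c) * (T : ℝ) ^ e = k₁ * ((T : ℝ) ^ e / (1 - c)) := by ring
  rw [add_mul, h6]
  linarith

variable {n p : ℕ} [NeZero p] {c γ₀ r R F G₁ G₂ w μ : ℝ} {B : ℕ}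

/-- The constant in the bound of the sum of the squared violations. -/
noncomputable def violationConst (n p : ℕ) (c γ₀ r R F G₁ G₂ μ : ℝ) : ℝ :=
  n * (2 * R) ^ 2 + (2 * (n * (2 * F)) + n * progressConst p γ₀ r R G₁ G₂ μ) / (1 - c)

/-- The constant for the cumulative constraint violation, if the sum of the agents' own violations
is bounded with the constant `k`. -/
noncomputable def ccvConst (n p B : ℕ) (c γ₀ R G₁ G₂ w k : ℝ) : ℝ :=
  k + n * G₂ * (disagreementConst n B w *
    (2 * R + 2 * (n * (p * G₁) / (1 - c) + p * G₂ * γ₀ * k)))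

variable {Q : Problem n p} (hS : StandingAssumptions Q r R F G₁ G₂ w B μ) (hn : 0 < n)
  (hc₀ : 0 < c) (hc₁ : c < 1) (hγ₀ : 0 < γ₀)
  {z₁ : Fin n → Vec p} (hz : ∀ i, z₁ i ∈ (1 - (powerParams c γ₀ r).ξ 1) • Q.X)
  {Ω : Type*} [MeasurableSpace Ω] {P : Measure Ω} [IsProbabilityMeasure P]
  {u : Fin n → ℕ → Ω → Metric.sphere (0 : Vec p) 1} (hu : UniformSampling P u)
  {T : ℕ} (hT : 1 ≤ T)
include hS hn hc₀ hc₁ hγ₀ hz hu hT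

omit [NeZero p] in
theorem integral_netCCV_le_of_sum_le {k e : ℝ} (he : 1 - c ≤ e)
    (h : ∑ t ∈ Finset.Icc 1 T, expViolation Q (powerParams c γ₀ r) z₁ P u 1 t ≤
      k * (T : ℝ) ^ e) :
    ∫ ω, netCCV Q T (xSeq Q (powerParams c γ₀ r) z₁ fun i t => u i t ω) ∂P ≤
      ccvConst n p B c γ₀ R G₁ G₂ w k * (T : ℝ) ^ e := by
  have hG₁ := hS.G₁_nonneg hn
  have hG₂ := hS.G₂_nonneg hn
  have hR := hS.domain.R_nonneg
  have hD := disagreementConst_nonneg (n := n) (B := B) hS.network.w_pos.le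
  have h1 := add_mul_sum_stepSize_le (k₀ := 2 * R) (k₁ := 2 * (n * (p * G₁))) hc₀ hc₁ he
    (by positivity) (by positivity) hT
  refine (integral_netCCV_le hS hn hc₀ hγ₀ hz hu T).trans ?_
  set S := ∑ t ∈ Finset.Icc 1 T, expViolation Q (powerParams c γ₀ r) z₁ P u 1 t
  have h2 : 2 * R + 2 * (n * (p * G₁) * ∑ t ∈ Finset.Icc 1 T, stepSize c t + p * G₂ * γ₀ * S) ≤
      (2 * R + 2 * (n * (p * G₁) / (1 - c) + p * G₂ * γ₀ * k)) * (T : ℝ) ^ e := by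
    have h3 := mul_le_mul_of_nonneg_left h (by positivity : 0 ≤ 2 * (p * G₂ * γ₀))
    have h4 : (2 * R + 2 * (n * (p * G₁)) / (1 - c)) * (T : ℝ) ^ e +
        2 * (p * G₂ * γ₀) * (k * (T : ℝ) ^ e) =
        (2 * R + 2 * (n * (p * G₁) / (1 - c) + p * G₂ * γ₀ * k)) * (T : ℝ) ^ e := by ring
    linarith
  have h5 := mul_le_mul_of_nonneg_left h2 (by positivity : 0 ≤ n * G₂ * disagreementConst n B w)
  rw [ccvConst, add_mul]
  linarith

variable (hμ : 0 ≤ μ) (hμ1 : μ ≤ 1) (hγ : γ₀ * (4 * ((p : ℝ) ^ 2 + 1) * G₂ ^ 2) ≤ 1)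
include hμ hμ1 hγ

theorem sum_expViolation_le_rpow {y : Vec p} (hy : y ∈ Q.X) {ρ : ℝ} (hρ : 0 ≤ ρ)
    (hyg : ∀ t, 1 ≤ t → t ≤ T → ∀ i k, Q.g i t y k ≤ -ρ) :
    γ₀ * ∑ t ∈ Finset.Icc 1 T, expViolation Q (powerParams c γ₀ r) z₁ P u 2 t +
      2 * γ₀ * ρ * ∑ t ∈ Finset.Icc 1 T, expViolation Q (powerParams c γ₀ r) z₁ P u 1 t ≤
      violationConst n p c γ₀ r R F G₁ G₂ μ * (T : ℝ) ^ (1 - c) := by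
  have hK := progressConst_nonneg (p := p) (G₂ := G₂) hγ₀.le hS.domain.r_pos.le
    hS.domain.R_nonneg (hS.G₁_nonneg hn) hμ
  have hF := hS.F_nonneg hn
  exact (sum_expViolation_le hS hn hc₀ hγ₀ hz hu hμ hμ1 hγ hy hρ T hyg).trans
    (add_mul_sum_stepSize_le hc₀ hc₁ le_rfl (by positivity) (by positivity) hT)

theorem integral_netCCV_le_rpow :
    ∫ ω, netCCV Q T (xSeq Q (powerParams c γ₀ r) z₁ fun i t => u i t ω) ∂P ≤
      ccvConst n p B c γ₀ R G₁ G₂ w (n / 2 + violationConst n p c γ₀ r R F G₁ G₂ μ / (2 * γ₀)) *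
        (T : ℝ) ^ (1 - c / 2) := by
  refine integral_netCCV_le_of_sum_le hS hn hc₀ hc₁ hγ₀ hz hu hT (by linarith) ?_
  have hT' : (0 : ℝ) < T := by exact_mod_cast hT
  obtain ⟨y, hyX, hy⟩ := hS.feasible_nonempty T hT
  have h1 := sum_expViolation_le_rpow hS hn hc₀ hc₁ hγ₀ hz hu hT hμ hμ1 hγ hyX le_rfl
    (fun t ht htT i k => (hy t (Finset.mem_Icc.2 ⟨ht, htT⟩) ⟨i, k⟩).trans_eq neg_zero.symm)
  rw [mul_zero, zero_mul, add_zero] at h1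
  -- This weight balances `T θ` against `T ^ (1 - c) / θ`; both equal `T ^ (1 - c / 2)`.
  have hθ : 0 < (T : ℝ) ^ (-(c / 2)) := by positivity
  have h2 := Finset.sum_le_sum fun t (ht : t ∈ Finset.Icc 1 T) =>
    expViolation_one_le (γ₀ := γ₀) hS hc₀ hz hu (Finset.mem_Icc.1 ht).1 hθ
  rw [Finset.sum_add_distrib, ← Finset.sum_div _ _ (2 * _)] at h2
  simp only [Finset.sum_const, Nat.card_Icc, add_tsub_cancel_right, nsmul_eq_mul] at h2
  refine h2.trans ?_
  have h3 : (T : ℝ) * (T : ℝ) ^ (-(c / 2)) = (T : ℝ) ^ (1 - c / 2) := by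
    rw [mul_comm, ← Real.rpow_add_one hT'.ne']
    congr 1
    ring
  have h4 : (T : ℝ) ^ (1 - c) = (T : ℝ) ^ (1 - c / 2) * (T : ℝ) ^ (-(c / 2)) := by
    rw [← Real.rpow_add hT']
    congr 1
    ring
  rw [h4] at h1
  have h5 : (∑ t ∈ Finset.Icc 1 T, expViolation Q (powerParams c γ₀ r) z₁ P u 2 t) /
      (2 * (T : ℝ) ^ (-(c / 2))) ≤
      violationConst n p c γ₀ r R F G₁ G₂ μ / (2 * γ₀) * (T : ℝ) ^ (1 - c / 2) := by
    rw [div_le_iff₀ (by positivity)]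
    refine le_of_mul_le_mul_left (h1.trans_eq ?_) hγ₀
    field_simp
  rw [add_mul, ← h3]
  rw [← h3] at h5
  linarith

theorem integral_netCCV_le_rpow_of_slater {σ : ℝ} (hσ : 0 < σ) (hsl : Slater Q σ) :
    ∫ ω, netCCV Q T (xSeq Q (powerParams c γ₀ r) z₁ fun i t => u i t ω) ∂P ≤
      ccvConst n p B c γ₀ R G₁ G₂ w (violationConst n p c γ₀ r R F G₁ G₂ μ / (2 * γ₀ * σ)) *
        (T : ℝ) ^ (1 - c) := by
  refine integral_netCCV_le_of_sum_le hS hn hc₀ hc₁ hγ₀ hz hu hT le_rfl ?_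
  obtain ⟨y, hyX, hy⟩ := hsl
  have h1 := sum_expViolation_le_rpow hS hn hc₀ hc₁ hγ₀ hz hu hT hμ hμ1 hγ hyX hσ.le
    (fun t ht _ i k => hy t ht ⟨i, k⟩)
  have h2 : 0 ≤ γ₀ * ∑ t ∈ Finset.Icc 1 T, expViolation Q (powerParams c γ₀ r) z₁ P u 2 t :=
    mul_nonneg hγ₀.le (Finset.sum_nonneg fun t _ => expViolation_nonneg Q _ z₁ P u 2 t)
  rw [div_mul_eq_mul_div, le_div_iff₀ (by positivity)]
  linarith

omit hS hn hc₀ hγ₀ hz hu hT hγ hμ in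
/-- The regret bound, with a constant that depends only on the parameters of the assumptions. -/
theorem exists_integral_netReg_le_rpow (hc₀ : 0 < c) (hμ : 0 < μ) (hn : 0 < n) (hγ₀ : 0 < γ₀)
    (hγ : γ₀ * (4 * ((p : ℝ) ^ 2 + 1) * G₂ ^ 2) ≤ 1) :
    ∃ C : ℝ, ∀ Q : Problem n p, StandingAssumptions Q r R F G₁ G₂ w B μ →
      ∀ (Ω : Type*) [MeasurableSpace Ω] (P : Measure Ω) [IsProbabilityMeasure P]
        (u : Fin n → ℕ → Ω → Metric.sphere (0 : Vec p) 1), UniformSampling P u →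
      ∀ z₁ : Fin n → Vec p, (∀ i, z₁ i ∈ (1 - (powerParams c γ₀ r).ξ 1) • Q.X) →
      ∀ T : ℕ, 1 ≤ T →
        ∫ ω, netReg Q T (xSeq Q (powerParams c γ₀ r) z₁ fun i t => u i t ω) ∂P ≤
          C * (T : ℝ) ^ (1 - c) := by
  obtain ⟨t₀, ht₀⟩ := exists_forall_rpow_succ_sub_le hc₁ hμ
  -- The summand `1` makes `κ` positive, since the Young weight is proportional to it. Both `t₀` and
  -- `κ` are fixed before the problem instance, as uniformity of the constant demands.
  set κ := G₁ * (disagreementConst n B w * (2 * (p * G₂ * γ₀))) + 1 with hκ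
  refine ⟨(1 / (n : ℝ)) * (n * (2 * R) ^ 2 * t₀ / 2) + G₁ * (disagreementConst n B w * (2 * R)) +
      ((1 / (n : ℝ)) * (n * progressConst p γ₀ r R G₁ G₂ μ / 2) +
        G₁ * (disagreementConst n B w * (2 * (n * (p * G₁)))) + κ ^ 2 * n ^ 2 / (2 * γ₀)) /
        (1 - c), fun Q hS Ω _ P _ u hu z₁ hz T hT => ?_⟩
  have hG₁ := hS.G₁_nonneg hn
  have hG₂ := hS.G₂_nonneg hn
  have hR := hS.domain.R_nonneg
  have hD := disagreementConst_nonneg (n := n) (B := B) hS.network.w_pos.le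
  have hK := progressConst_nonneg (p := p) (G₂ := G₂) hγ₀.le hS.domain.r_pos.le hR hG₁ hμ.le
  exact (integral_netReg_le hS hn hc₀ hγ₀ hz hu hμ.le hμ1 hγ hc₁ ht₀ hT (by positivity)
    (le_add_of_nonneg_right zero_le_one)).trans
    (add_mul_sum_stepSize_le hc₀ hc₁ le_rfl (by positivity) (by positivity) hT)

end FinalRates

theorem theorem3 (n p : ℕ) (hn : 0 < n) (hp : 0 < p)
    (c γ₀ r R F G₁ G₂ w μ : ℝ) (B : ℕ)
    (hc₀ : 0 < c) (hc₁ : c < 1) (hμ : 0 < μ)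
    (hγ₀ : 0 < γ₀) (hγ : γ₀ * (4 * ((p : ℝ) ^ 2 + 1) * G₂ ^ 2) ≤ 1) :
    (∃ C : ℝ, ∀ Q : Problem n p, StandingAssumptions Q r R F G₁ G₂ w B μ →
      ∀ (Ω : Type*) [MeasurableSpace Ω] (P : Measure Ω) [IsProbabilityMeasure P]
        (u : Fin n → ℕ → Ω → Metric.sphere (0 : Vec p) 1), UniformSampling P u →
      ∀ z₁ : Fin n → Vec p, (∀ i, z₁ i ∈ (1 - (powerParams c γ₀ r).ξ 1) • Q.X) →
      ∀ T : ℕ, 1 ≤ T →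
        Integrable (fun ω => netReg Q T
          (xSeq Q (powerParams c γ₀ r) z₁ fun i t => u i t ω)) P ∧
        Integrable (fun ω => netCCV Q T
          (xSeq Q (powerParams c γ₀ r) z₁ fun i t => u i t ω)) P ∧
        ∫ ω, netReg Q T (xSeq Q (powerParams c γ₀ r) z₁ fun i t => u i t ω) ∂P
          ≤ C * (T : ℝ) ^ (1 - c) ∧
        ∫ ω, netCCV Q T (xSeq Q (powerParams c γ₀ r) z₁ fun i t => u i t ω) ∂P
          ≤ C * (T : ℝ) ^ (1 - c / 2)) ∧
    (∀ σ : ℝ, 0 < σ →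
      ∃ C : ℝ, ∀ Q : Problem n p, StandingAssumptions Q r R F G₁ G₂ w B μ → Slater Q σ →
      ∀ (Ω : Type*) [MeasurableSpace Ω] (P : Measure Ω) [IsProbabilityMeasure P]
        (u : Fin n → ℕ → Ω → Metric.sphere (0 : Vec p) 1), UniformSampling P u →
      ∀ z₁ : Fin n → Vec p, (∀ i, z₁ i ∈ (1 - (powerParams c γ₀ r).ξ 1) • Q.X) →
      ∀ T : ℕ, 1 ≤ T →
        ∫ ω, netCCV Q T (xSeq Q (powerParams c γ₀ r) z₁ fun i t => u i t ω) ∂P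
          ≤ C * (T : ℝ) ^ (1 - c)) := by
  have : NeZero p := ⟨hp.ne'⟩
  -- Strong convexity persists for smaller moduli and the algorithm does not involve `μ`, so `μ` may
  -- be replaced by `min μ 1`, for which `1 - α_t μ ≥ 0`.
  have hm : 0 < min μ 1 := lt_min hμ one_pos
  have hm1 : min μ 1 ≤ 1 := min_le_right μ 1
  constructor
  · obtain ⟨C, hC⟩ := exists_integral_netReg_le_rpow (r := r) (R := R) (F := F) (G₁ := G₁) (w := w)
      (B := B) hc₁ hm1 hc₀ hm hn hγ₀ hγ
    refine ⟨max C (ccvConst n p B c γ₀ R G₁ G₂ w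
      (n / 2 + violationConst n p c γ₀ r R F G₁ G₂ (min μ 1) / (2 * γ₀))),
      fun Q hQ Ω _ P _ u hu z₁ hz T hT => ?_⟩
    have hS := hQ.mono (min_le_left μ 1)
    refine ⟨integrable_netReg hS hc₀ hz hu T, integrable_netCCV hS hc₀ hz hu T, ?_, ?_⟩
    · refine (hC Q hS Ω P u hu z₁ hz T hT).trans ?_
      gcongr
      exact le_max_left _ _
    · refine (integral_netCCV_le_rpow hS hn hc₀ hc₁ hγ₀ hz hu hT hm.le hm1 hγ).trans ?_
      gcongr
      exact le_max_right _ _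
  · intro σ hσ
    exact ⟨_, fun Q hQ hsl Ω _ P _ u hu z₁ hz T hT => integral_netCCV_le_rpow_of_slater
      (hQ.mono (min_le_left μ 1)) hn hc₀ hc₁ hγ₀ hz hu hT hm.le hm1 hγ hσ hsl⟩
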